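/- Let $p\in[1,\infty)$. An $SQ_p$ algebra is a norm-closed subalgebra $A\subseteq B(E)$, where $E$ is a closed subspace of a quotient of an $L_p$ space by a closed subspace; $M_n(A)$ is normed as an algebra of operators on $\ell_p^n(E)$. Put $\tilde A=A$ if $A$ is unital, and $\tilde A=A+\mathbb{C}I_E$ otherwise. $A$ is filtered if there are closed linear subspaces $(A_r)_{r>0}$ of $A$ with $A_r\subseteq A_{r'}$ for $r\le r'$, $A_rA_{r'}\subseteq A_{r+r'}$ and $\bigcup_r A_r$ dense in $A$, and, if $A$ is unital, $1_A\in A_r$ for all $r$ and $\|1_A\|=1$ (unless $A=0$). $\tilde A$ is filtered by $A_r+\mathbb{C}1$. For a closed two-sided ideal $J$ of $A$ put $J_r=J\cap A_r$; the extension $0\to J\to A\xrightarrow{q}A/J\to0$ is $C$-completely filtered if $\inf_{y\in M_n(J_r)}\|x+y\|\le C\inf_{y\in M_n(J)}\|x+y\|$ for all $n$, $r>0$, $x\in M_n(A_r)$. The algebra $\tilde A/J$ is used as the unital algebra attached to $A/J$; it carries the norms of $M_n(\tilde A)/M_n(J)$ and the filtration $q(\tilde A_r)$. Let $B$ be a unital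 algebra with matrix norms and a filtration $(B_r)$. An $(\varepsilon,r,N)$-idempotent in $M_n(B)$ is $e\in M_n(B_r)$ with $\|e^2-e\|<\varepsilon$ and $\|e\|,\|1-e\|\le N$. An $(\varepsilon,r,N)$-invertible is $u\in M_n(B_r)$ with $\|u\|\le N$ having some $v\in M_n(B_r)$ with $\|v\|\le N$ and $\|uv-1\|,\|vu-1\|<\varepsilon$; a homotopy of these is a norm-continuous path admitting a norm-continuous path of such $v$'s. $K_0^{\varepsilon,r,N}(B)$ is the Grothendieck group of the $(\varepsilon,r,N)$-idempotents over $B$ of all sizes (with $e$ identified with $\mathrm{diag}(e,0)$) modulo $(4\varepsilon,r,4N)$-homotopy, and $K_1^{\varepsilon,r,N}(B)$ is the group of $(\varepsilon,r,N)$-invertibles (with $u$ identified with $\mathrm{diag}(u,1)$) modulo $(4\varepsilon,2r,4N)$-homotopy, both with addition given by $\mathrm{diag}$. If $J$ is unital, $K_0^{\varepsilon,r,N}(J)$ is as just defined (with $B=J$ filtered by $J_r+\mathbb{C}1_J$); otherwise it is $\ker\big(K_0^{\varepsilon,r,N}(\tilde J)\to K_0^{\varepsilon,r,N}(\mathbb{C})\big)$.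 Set $K_1^{\varepsilon,r,N}(A/J)=K_1^{\varepsilon,r,N}(\tilde A/J)$ if $A$ is unital, and $\ker\big(K_1^{\varepsilon,r,N}(\tilde A/J)\to K_1^{\varepsilon,r,N}(\mathbb{C})\big)$ otherwise. Relaxation of control is $\iota:[x]_{\varepsilon,r,N}\mapsto[x]_{\varepsilon',r',N'}$. The maps to ordinary $K$-theory are $\kappa_1[u]=[u]$ and $\kappa_0[e]=\big[\frac1{2\pi i}\oint_{|z-1|=\sqrt\varepsilon}(z-e)^{-1}dz\big]$. A control pair $(\lambda,h)$ consists of a non-decreasing function $\lambda:[1,\infty)\to[1,\infty)$, $N\mapsto\lambda_N$, and a function $h:(0,\frac1{20})\times[1,\infty)\to[1,\infty)$, $(\varepsilon,N)\mapsto h_{\varepsilon,N}$, non-increasing in $\varepsilon$. **Proposition.** For every $C\ge1$ there is a control pair $(\lambda,h)$ such that for every $p\in[1,\infty)$, every filtered $SQ_p$ algebra $A$ and every closed ideal $J$ of $A$ for which $0\to J\to A\to A/J\to0$ is $C$-completely filtered, there is a $(\lambda,h)$-controlled morphism $\mathcal D_1=(\partial_1^{\varepsilon,r,N}):\mathcal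 K_1(A/J)\to\mathcal K_0(J)$, that is, a family of group homomorphisms $$\partial_1^{\varepsilon,r,N}:K_1^{\varepsilon,r,N}(A/J)\to K_0^{\lambda_N\varepsilon,\,h_{\varepsilon,N}r,\,\lambda_N}(J)\qquad\Big(0<\varepsilon<\tfrac1{20\lambda_N},\ r>0,\ N\ge1\Big)$$ with $\iota\circ\partial_1^{\varepsilon,r,N}=\partial_1^{\varepsilon',r',N'}\circ\iota$ whenever $0<\varepsilon\le\varepsilon'<\frac1{20\lambda_{N'}}$, $r\le r'$, $h_{\varepsilon,N}r\le h_{\varepsilon',N'}r'$ and $1\le N\le N'$. Moreover $\mathcal D_1$ induces the usual boundary map $\partial_1:K_1(A/J)\to K_0(J)$ of ordinary $K$-theory (given by $\partial_1[u]=[w\,\mathrm{diag}(I_n,0)\,w^{-1}]-[\mathrm{diag}(I_n,0)]$ for $u\in GL_n(\tilde A/J)$ and any lift $w\in GL_{2n}(\tilde A)$ of $\mathrm{diag}(u,u^{-1})$, where $w\,\mathrm{diag}(I_n,0)\,w^{-1}-\mathrm{diag}(I_n,0)\in M_{2n}(J)$ and $\mathrm{diag}(I_n,0)$ is taken over $\tilde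 J$; here $K_1(A/J)=K_1(\tilde A/J)$, and $K_0(J)$ is formed from idempotents over $\tilde J$ up to homotopy, being the kernel of $K_0(\tilde J)\to K_0(\mathbb{C})$ if $J$ is nonunital): $\partial_1$ is the unique homomorphism $F:K_1(A/J)\to K_0(J)$ with $F(\kappa_1(x))=\kappa_0(\partial_1^{\varepsilon,r,N}(x))$ for all $0<\varepsilon<\frac1{20\lambda_N}$, $r>0$, $N\ge1$ and $x\in K_1^{\varepsilon,r,N}(A/J)$. -/

import Mathlib

open scoped ENNReal Topology

universe u v w

namespace QuantK

/-! ### Block sums and groups presented by matrices -/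

/-- The block diagonal matrix `diag(x, y)`. -/
def bdiag {R : Type u} [Zero R] {m n : ℕ} (x : Matrix (Fin m) (Fin m) R)
    (y : Matrix (Fin n) (Fin n) R) : Matrix (Fin (m + n)) (Fin (m + n)) R :=
  Matrix.reindex finSumFinEquiv finSumFinEquiv (Matrix.fromBlocks x 0 0 y)

/-- The matrix `diag(I_n, 0)` of size `2n`. -/
def cornerProj (R : Type u) [Zero R] [One R] (n : ℕ) : Matrix (Fin (n + n)) (Fin (n + n)) R :=
  bdiag (1 : Matrix (Fin n) (Fin n) R) (0 : Matrix (Fin n) (Fin n) R)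

theorem bdiag_map {R : Type u} {R' : Type v} [Zero R] [Zero R'] (f : R → R') (hf : f 0 = 0)
    {m n : ℕ} (x : Matrix (Fin m) (Fin m) R) (y : Matrix (Fin n) (Fin n) R) :
    (bdiag x y).map f = bdiag (x.map f) (y.map f) := by
  ext i j
  simp only [bdiag, Matrix.reindex_apply, Matrix.map_apply, Matrix.submatrix_apply]
  rcases finSumFinEquiv.symm i with a | a <;> rcases finSumFinEquiv.symm j with b | b <;>
    simp [hf]

/-- The data from which a `K`-group is formed: a class of square matrices (idempotents,
invertibles, ...), a homotopy relation between matrices of the same size, and the matrices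
`fill k` (zero or identity) with which a matrix is stabilized, `x ↦ diag(x, fill k)`. -/
structure KSystem (R : Type u) where
  mem : ∀ n : ℕ, Matrix (Fin n) (Fin n) R → Prop
  htpy : ∀ n : ℕ, Matrix (Fin n) (Fin n) R → Matrix (Fin n) (Fin n) R → Prop
  fill : ∀ k : ℕ, Matrix (Fin k) (Fin k) R

namespace KSystem

variable {R : Type u} [Zero R] {R' : Type v} [Zero R']

/-- The square matrices of all sizes in the given class. -/
abbrev Gen (S : KSystem R) : Type u := Σ n : ℕ, {x : Matrix (Fin n) (Fin n) R // S.mem n x}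

/-- Homotopic matrices are identified, a matrix is identified with its stabilizations, and
`[diag(x, y)] = [x] + [y]`. -/
inductive Rel (S : KSystem R) : FreeAbelianGroup S.Gen → Prop
  | htpy (n : ℕ) (x y : {x : Matrix (Fin n) (Fin n) R // S.mem n x}) (h : S.htpy n x.1 y.1) :
      Rel S (FreeAbelianGroup.of ⟨n, x⟩ - FreeAbelianGroup.of ⟨n, y⟩)
  | stab (n k : ℕ) (x : {x : Matrix (Fin n) (Fin n) R // S.mem n x})
      (z : {z : Matrix (Fin (n + k)) (Fin (n + k)) R // S.mem (n + k) z})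
      (h : z.1 = bdiag x.1 (S.fill k)) :
      Rel S (FreeAbelianGroup.of ⟨n + k, z⟩ - FreeAbelianGroup.of ⟨n, x⟩)
  | sum (n m : ℕ) (x : {x : Matrix (Fin n) (Fin n) R // S.mem n x})
      (y : {y : Matrix (Fin m) (Fin m) R // S.mem m y})
      (z : {z : Matrix (Fin (n + m)) (Fin (n + m)) R // S.mem (n + m) z})
      (h : z.1 = bdiag x.1 y.1) :
      Rel S (FreeAbelianGroup.of ⟨n + m, z⟩ -
        (FreeAbelianGroup.of ⟨n, x⟩ + FreeAbelianGroup.of ⟨m, y⟩))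

/-- The Grothendieck group of the abelian semigroup of stable homotopy classes with addition
`[x] + [y] = [diag(x, y)]`, in its presentation by generators `[x]` and relations. When the
classes already form an abelian group, it is that group. -/
def Group (S : KSystem R) : Type u :=
  FreeAbelianGroup S.Gen ⧸ AddSubgroup.closure {a | S.Rel a}

instance (S : KSystem R) : AddCommGroup S.Group :=
  inferInstanceAs (AddCommGroup (FreeAbelianGroup S.Gen ⧸ AddSubgroup.closure {a | S.Rel a}))

/-- The class `[x]`. -/
def cls (S : KSystem R) {n : ℕ} (x : {x : Matrix (Fin n) (Fin n) R // S.mem n x}) : S.Group :=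
  QuotientAddGroup.mk (FreeAbelianGroup.of (⟨n, x⟩ : S.Gen))

theorem mk_eq_of_rel (S : KSystem R) {a b : FreeAbelianGroup S.Gen} (h : S.Rel (a - b)) :
    (QuotientAddGroup.mk a : FreeAbelianGroup S.Gen ⧸ AddSubgroup.closure {a | S.Rel a}) =
      QuotientAddGroup.mk b := by
  rw [← sub_eq_zero, ← QuotientAddGroup.mk_sub, QuotientAddGroup.eq_zero_iff]
  exact AddSubgroup.subset_closure h

/-- Two homomorphisms that agree on all classes `[x]` are equal. -/
theorem hom_ext (S : KSystem R) {H : Type w} [AddCommGroup H] {f g : S.Group →+ H}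
    (h : ∀ (n : ℕ) (x : {x : Matrix (Fin n) (Fin n) R // S.mem n x}), f (S.cls x) = g (S.cls x)) :
    f = g := by
  refine QuotientAddGroup.addMonoidHom_ext _ (FreeAbelianGroup.lift_ext _ _ ?_)
  rintro ⟨n, x⟩
  exact h n x

/-- The homomorphism `[x] ↦ [f x]`. -/
def map {S : KSystem R} {T : KSystem R'}
    (f : ∀ n : ℕ, Matrix (Fin n) (Fin n) R → Matrix (Fin n) (Fin n) R')
    (hmem : ∀ n x, S.mem n x → T.mem n (f n x))
    (hhtpy : ∀ n x y, S.htpy n x y → T.htpy n (f n x) (f n y))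
    (hfill : ∀ n, f n (S.fill n) = T.fill n)
    (hdiag : ∀ n m x y, f (n + m) (bdiag x y) = bdiag (f n x) (f m y)) :
    S.Group →+ T.Group :=
  QuotientAddGroup.lift _
    (FreeAbelianGroup.lift fun g : S.Gen => T.cls ⟨f g.1 g.2.1, hmem g.1 g.2.1 g.2.2⟩) (by
      rw [AddSubgroup.closure_le]
      rintro a (⟨n, x, y, h⟩ | ⟨n, k, x, z, h⟩ | ⟨n, m, x, y, z, h⟩)
      · simp only [SetLike.mem_coe, AddMonoidHom.mem_ker, map_sub, FreeAbelianGroup.lift_apply_of]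
        rw [sub_eq_zero]
        exact T.mk_eq_of_rel (Rel.htpy n _ _ (hhtpy n _ _ h))
      · simp only [SetLike.mem_coe, AddMonoidHom.mem_ker, map_sub, FreeAbelianGroup.lift_apply_of]
        rw [sub_eq_zero]
        refine T.mk_eq_of_rel (Rel.stab n k _ _ ?_)
        simp [h, hdiag, hfill]
      · simp only [SetLike.mem_coe, AddMonoidHom.mem_ker, map_sub, map_add,
          FreeAbelianGroup.lift_apply_of]
        rw [sub_eq_zero]
        refine T.mk_eq_of_rel (Rel.sum n m _ _ _ ?_)
        simp [h, hdiag])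

theorem map_cls {S : KSystem R} {T : KSystem R'}
    (f : ∀ n : ℕ, Matrix (Fin n) (Fin n) R → Matrix (Fin n) (Fin n) R')
    (hmem : ∀ n x, S.mem n x → T.mem n (f n x))
    (hhtpy : ∀ n x y, S.htpy n x y → T.htpy n (f n x) (f n y))
    (hfill : ∀ n, f n (S.fill n) = T.fill n)
    (hdiag : ∀ n m x y, f (n + m) (bdiag x y) = bdiag (f n x) (f m y))
    {n : ℕ} (x : {x : Matrix (Fin n) (Fin n) R // S.mem n x}) :
    map f hmem hhtpy hfill hdiag (S.cls x) = T.cls ⟨f n x.1, hmem n x.1 x.2⟩ := by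
  change FreeAbelianGroup.lift _ (FreeAbelianGroup.of _) = _
  rw [FreeAbelianGroup.lift_apply_of]

theorem map_map_comm {R₁ R₂ R₃ R₄ : Type*} [Zero R₁] [Zero R₂] [Zero R₃] [Zero R₄]
    {S : KSystem R₁} {T : KSystem R₂} {T' : KSystem R₃} {V : KSystem R₄}
    (f : ∀ n : ℕ, Matrix (Fin n) (Fin n) R₁ → Matrix (Fin n) (Fin n) R₂)
    (g : ∀ n : ℕ, Matrix (Fin n) (Fin n) R₂ → Matrix (Fin n) (Fin n) R₄)
    (f' : ∀ n : ℕ, Matrix (Fin n) (Fin n) R₁ → Matrix (Fin n) (Fin n) R₃)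
    (g' : ∀ n : ℕ, Matrix (Fin n) (Fin n) R₃ → Matrix (Fin n) (Fin n) R₄)
    {f₁ : ∀ n x, S.mem n x → T.mem n (f n x)} {f₂ f₃ f₄}
    {g₁ : ∀ n x, T.mem n x → V.mem n (g n x)} {g₂ g₃ g₄}
    {f₁' : ∀ n x, S.mem n x → T'.mem n (f' n x)} {f₂' f₃' f₄'}
    {g₁' : ∀ n x, T'.mem n x → V.mem n (g' n x)} {g₂' g₃' g₄'}
    (h : ∀ n x, g n (f n x) = g' n (f' n x)) (x : S.Group) :
    map g g₁ g₂ g₃ g₄ (map f f₁ f₂ f₃ f₄ x) = map g' g₁' g₂' g₃' g₄' (map f' f₁' f₂' f₃' f₄' x) := by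
  have : (map g g₁ g₂ g₃ g₄).comp (map f f₁ f₂ f₃ f₄) =
      (map g' g₁' g₂' g₃' g₄').comp (map f' f₁' f₂' f₃' f₄') := by
    refine hom_ext _ fun n x => ?_
    rw [AddMonoidHom.comp_apply, AddMonoidHom.comp_apply, map_cls, map_cls, map_cls, map_cls]
    congr 2
    exact h n x.1
  exact DFunLike.congr_fun this x

end KSystem

/-! ### Unital algebras with matrix norms and a filtration -/

/-- A unital complex algebra with a norm on each of its matrix algebras and an increasing family
of subspaces. It carries the data from which `K`-groups and quantitative `K`-groups are formed. -/
structure MatrixAlg where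
  carrier : Type u
  [ring : Ring carrier]
  [algebra : Algebra ℂ carrier]
  nrm : ∀ n : ℕ, Matrix (Fin n) (Fin n) carrier → ℝ
  nrm_nonneg : ∀ (n : ℕ) (x : Matrix (Fin n) (Fin n) carrier), 0 ≤ nrm n x
  fil : ℝ → Submodule ℂ carrier
  fil_mono : ∀ r r' : ℝ, 0 < r → r ≤ r' → fil r ≤ fil r'

namespace MatrixAlg

instance (B : MatrixAlg.{u}) : Ring B.carrier := B.ring
instance (B : MatrixAlg.{u}) : Algebra ℂ B.carrier := B.algebra

/-- The square matrices of size `n` over `B`. -/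
abbrev Mat (B : MatrixAlg.{u}) (n : ℕ) : Type u := Matrix (Fin n) (Fin n) B.carrier

/-- `(ε, r, N)`-idempotents in `M_n(B)`. -/
def QIdem (B : MatrixAlg.{u}) (ε r N : ℝ) (n : ℕ) (e : B.Mat n) : Prop :=
  B.nrm n (e * e - e) < ε ∧ (∀ i j, e i j ∈ B.fil r) ∧ B.nrm n e ≤ N ∧ B.nrm n (1 - e) ≤ N

/-- `(ε, r, N)`-inverse pairs in `M_n(B)`. -/
def QInvPair (B : MatrixAlg.{u}) (ε r N : ℝ) (n : ℕ) (u v : B.Mat n) : Prop :=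
  (∀ i j, u i j ∈ B.fil r) ∧ (∀ i j, v i j ∈ B.fil r) ∧ B.nrm n u ≤ N ∧ B.nrm n v ≤ N ∧
    B.nrm n (u * v - 1) < ε ∧ B.nrm n (v * u - 1) < ε

/-- `(ε, r, N)`-invertibles in `M_n(B)`. -/
def QInv (B : MatrixAlg.{u}) (ε r N : ℝ) (n : ℕ) (u : B.Mat n) : Prop :=
  ∃ v, B.QInvPair ε r N n u v

/-- Norm continuity of a path in `M_n(B)`. -/
def NormCont (B : MatrixAlg.{u}) (n : ℕ) (γ : unitInterval → B.Mat n) : Prop :=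
  ∀ t, Filter.Tendsto (fun s => B.nrm n (γ s - γ t)) (𝓝 t) (𝓝 0)

/-- `(ε, r, N)`-homotopy of quasi-idempotents in `M_n(B)`. -/
def QIdemHtpy (B : MatrixAlg.{u}) (ε r N : ℝ) (n : ℕ) (e f : B.Mat n) : Prop :=
  ∃ γ : unitInterval → B.Mat n, B.NormCont n γ ∧ (∀ t, B.QIdem ε r N n (γ t)) ∧
    γ 0 = e ∧ γ 1 = f

/-- `(ε, r, N)`-homotopy of quasi-invertibles in `M_n(B)`, with a continuous path of
quasi-inverses. -/
def QInvHtpy (B : MatrixAlg.{u}) (ε r N : ℝ) (n : ℕ) (u v : B.Mat n) : Prop :=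
  ∃ γ δ : unitInterval → B.Mat n, B.NormCont n γ ∧ B.NormCont n δ ∧
    (∀ t, B.QInvPair ε r N n (γ t) (δ t)) ∧ γ 0 = u ∧ γ 1 = v

/-- Quasi-idempotents up to `(4ε, r, 4N)`-homotopy. -/
def qIdemSystem (B : MatrixAlg.{u}) (ε r N : ℝ) : KSystem B.carrier where
  mem := B.QIdem ε r N
  htpy := B.QIdemHtpy (4 * ε) r (4 * N)
  fill := fun _ => 0

/-- Quasi-invertibles up to `(4ε, 2r, 4N)`-homotopy. -/
def qInvSystem (B : MatrixAlg.{u}) (ε r N : ℝ) : KSystem B.carrier where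
  mem := B.QInv ε r N
  htpy := B.QInvHtpy (4 * ε) (2 * r) (4 * N)
  fill := fun _ => 1

/-- Idempotents up to homotopy. -/
def idemSystem (B : MatrixAlg.{u}) : KSystem B.carrier where
  mem := fun _ e => e * e = e
  htpy := fun n e f => ∃ γ : unitInterval → B.Mat n, B.NormCont n γ ∧
    (∀ t, γ t * γ t = γ t) ∧ γ 0 = e ∧ γ 1 = f
  fill := fun _ => 0

/-- Invertibles up to homotopy. -/
def invSystem (B : MatrixAlg.{u}) : KSystem B.carrier where
  mem := fun _ u => IsUnit u
  htpy := fun n u v => ∃ γ : unitInterval → B.Mat n, B.NormCont n γ ∧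
    (∀ t, IsUnit (γ t)) ∧ γ 0 = u ∧ γ 1 = v
  fill := fun _ => 1

/-- The group `K_0^{ε,r,N}` of a unital algebra. -/
abbrev QK0 (B : MatrixAlg.{u}) (ε r N : ℝ) : Type u := (B.qIdemSystem ε r N).Group

/-- The group `K_1^{ε,r,N}` of a unital algebra. -/
abbrev QK1 (B : MatrixAlg.{u}) (ε r N : ℝ) : Type u := (B.qInvSystem ε r N).Group

/-- The ordinary group `K_0` of a unital algebra. -/
abbrev K0 (B : MatrixAlg.{u}) : Type u := B.idemSystem.Group

/-- The ordinary group `K_1` of a unital algebra. -/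
abbrev K1 (B : MatrixAlg.{u}) : Type u := B.invSystem.Group

theorem QIdem.mono {B : MatrixAlg.{u}} {ε ε' r r' N N' : ℝ} (hε : ε ≤ ε') (hr₀ : 0 < r)
    (hr : r ≤ r') (hN : N ≤ N') {n : ℕ} {e : B.Mat n} (h : B.QIdem ε r N n e) :
    B.QIdem ε' r' N' n e :=
  ⟨h.1.trans_le hε, fun i j => B.fil_mono r r' hr₀ hr (h.2.1 i j), h.2.2.1.trans hN,
    h.2.2.2.trans hN⟩

theorem QInvPair.mono {B : MatrixAlg.{u}} {ε ε' r r' N N' : ℝ} (hε : ε ≤ ε') (hr₀ : 0 < r)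
    (hr : r ≤ r') (hN : N ≤ N') {n : ℕ} {x y : B.Mat n} (h : B.QInvPair ε r N n x y) :
    B.QInvPair ε' r' N' n x y :=
  ⟨fun i j => B.fil_mono r r' hr₀ hr (h.1 i j), fun i j => B.fil_mono r r' hr₀ hr (h.2.1 i j),
    h.2.2.1.trans hN, h.2.2.2.1.trans hN, h.2.2.2.2.1.trans_le hε, h.2.2.2.2.2.trans_le hε⟩

/-- Relaxation of control, `[e]_{ε,r,N} ↦ [e]_{ε',r',N'}`. -/
def relaxQK0 (B : MatrixAlg.{u}) {ε ε' r r' N N' : ℝ} (hε : ε ≤ ε') (hr₀ : 0 < r) (hr : r ≤ r')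
    (hN : N ≤ N') : B.QK0 ε r N →+ B.QK0 ε' r' N' :=
  KSystem.map (fun _ x => x) (fun _ _ h => QIdem.mono hε hr₀ hr hN h)
    (fun _ _ _ ⟨γ, hγ, hm, h0, h1⟩ => ⟨γ, hγ, fun t =>
      QIdem.mono (by linarith) hr₀ hr (by linarith) (hm t), h0, h1⟩)
    (fun _ => rfl) (fun _ _ _ _ => rfl)

/-- Relaxation of control, `[u]_{ε,r,N} ↦ [u]_{ε',r',N'}`. -/
def relaxQK1 (B : MatrixAlg.{u}) {ε ε' r r' N N' : ℝ} (hε : ε ≤ ε') (hr₀ : 0 < r) (hr : r ≤ r')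
    (hN : N ≤ N') : B.QK1 ε r N →+ B.QK1 ε' r' N' :=
  KSystem.map (fun _ x => x)
    (fun _ _ ⟨v, h⟩ => ⟨v, QInvPair.mono hε hr₀ hr hN h⟩)
    (fun _ _ _ ⟨γ, δ, hγ, hδ, hm, h0, h1⟩ => ⟨γ, δ, hγ, hδ, fun t =>
      QInvPair.mono (by linarith) (by linarith) (by linarith) (by linarith) (hm t), h0, h1⟩)
    (fun _ => rfl) (fun _ _ _ _ => rfl)

/-- A unital homomorphism that is contractive on all matrix algebras and preserves the
filtrations. -/
structure Hom (B : MatrixAlg.{u}) (B' : MatrixAlg.{v}) where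
  toRingHom : B.carrier →+* B'.carrier
  contr : ∀ (n : ℕ) (x : B.Mat n), B'.nrm n (x.map toRingHom) ≤ B.nrm n x
  fil : ∀ r : ℝ, ∀ x ∈ B.fil r, toRingHom x ∈ B'.fil r

namespace Hom

variable {B : MatrixAlg.{u}} {B' : MatrixAlg.{v}} (φ : Hom B B')

/-- The homomorphism `M_n(B) → M_n(B')`. -/
def mat (n : ℕ) : B.Mat n →+* B'.Mat n := φ.toRingHom.mapMatrix

theorem nrm_mat (n : ℕ) (x : B.Mat n) : B'.nrm n (φ.mat n x) ≤ B.nrm n x := φ.contr n x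

theorem mat_bdiag (n m : ℕ) (x : B.Mat n) (y : B.Mat m) :
    φ.mat (n + m) (bdiag x y) = bdiag (φ.mat n x) (φ.mat m y) :=
  bdiag_map _ (map_zero _) x y

theorem normCont {n : ℕ} {γ : unitInterval → B.Mat n} (h : B.NormCont n γ) :
    B'.NormCont n (fun t => φ.mat n (γ t)) := fun t =>
  squeeze_zero (fun _ => B'.nrm_nonneg n _)
    (fun s => by rw [← map_sub]; exact φ.nrm_mat n _) (h t)

theorem qIdem {ε r N : ℝ} {n : ℕ} {e : B.Mat n} (h : B.QIdem ε r N n e) :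
    B'.QIdem ε r N n (φ.mat n e) := by
  refine ⟨?_, fun i j => φ.fil r _ (h.2.1 i j), (φ.nrm_mat n e).trans h.2.2.1, ?_⟩
  · rw [← map_mul, ← map_sub]
    exact (φ.nrm_mat n _).trans_lt h.1
  · rw [← map_one (φ.mat n), ← map_sub]
    exact (φ.nrm_mat n _).trans h.2.2.2

theorem qInvPair {ε r N : ℝ} {n : ℕ} {x y : B.Mat n}
    (h : B.QInvPair ε r N n x y) : B'.QInvPair ε r N n (φ.mat n x) (φ.mat n y) := by
  refine ⟨fun i j => φ.fil r _ (h.1 i j), fun i j => φ.fil r _ (h.2.1 i j),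
    (φ.nrm_mat n x).trans h.2.2.1, (φ.nrm_mat n y).trans h.2.2.2.1, ?_, ?_⟩
  · rw [← map_one (φ.mat n), ← map_mul, ← map_sub]
    exact (φ.nrm_mat n _).trans_lt h.2.2.2.2.1
  · rw [← map_one (φ.mat n), ← map_mul, ← map_sub]
    exact (φ.nrm_mat n _).trans_lt h.2.2.2.2.2

/-- The induced homomorphism of the groups `K_0^{ε,r,N}`. -/
def mapQK0 (ε r N : ℝ) : B.QK0 ε r N →+ B'.QK0 ε r N :=
  KSystem.map (fun n => φ.mat n) (fun _ _ h => φ.qIdem h)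
    (fun n _ _ ⟨γ, hγ, hm, h0, h1⟩ => ⟨fun t => φ.mat n (γ t), φ.normCont hγ,
      fun t => φ.qIdem (hm t), congrArg _ h0, congrArg _ h1⟩)
    (fun n => map_zero (φ.mat n)) φ.mat_bdiag

/-- The induced homomorphism of the groups `K_1^{ε,r,N}`. -/
def mapQK1 (ε r N : ℝ) : B.QK1 ε r N →+ B'.QK1 ε r N :=
  KSystem.map (fun n => φ.mat n) (fun n _ ⟨v, h⟩ => ⟨φ.mat n v, φ.qInvPair h⟩)
    (fun n _ _ ⟨γ, δ, hγ, hδ, hm, h0, h1⟩ => ⟨fun t => φ.mat n (γ t), fun t => φ.mat n (δ t),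
      φ.normCont hγ, φ.normCont hδ, fun t => φ.qInvPair (hm t),
      congrArg _ h0, congrArg _ h1⟩)
    (fun n => map_one (φ.mat n)) φ.mat_bdiag

/-- The induced homomorphism of the groups `K_0`. -/
def mapK0 : B.K0 →+ B'.K0 :=
  KSystem.map (fun n => φ.mat n)
    (fun n x (h : x * x = x) => show φ.mat n x * φ.mat n x = φ.mat n x by rw [← map_mul, h])
    (fun n _ _ ⟨γ, hγ, hm, h0, h1⟩ => ⟨fun t => φ.mat n (γ t), φ.normCont hγ,
      fun t => by rw [← map_mul, hm t], congrArg _ h0, congrArg _ h1⟩)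
    (fun n => map_zero (φ.mat n)) φ.mat_bdiag

theorem mapQK0_relax {ε ε' r r' N N' : ℝ} (hε : ε ≤ ε') (hr₀ : 0 < r) (hr : r ≤ r')
    (hN : N ≤ N') (x : B.QK0 ε r N) :
    φ.mapQK0 ε' r' N' (B.relaxQK0 hε hr₀ hr hN x) =
      B'.relaxQK0 hε hr₀ hr hN (φ.mapQK0 ε r N x) := by
  unfold mapQK0 relaxQK0
  refine KSystem.map_map_comm (fun _ x => x) (fun n => ⇑(φ.mat n)) (fun n => ⇑(φ.mat n))
    (fun _ x => x) (fun n y => ?_) x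
  rfl

theorem mapQK1_relax {ε ε' r r' N N' : ℝ} (hε : ε ≤ ε') (hr₀ : 0 < r) (hr : r ≤ r')
    (hN : N ≤ N') (x : B.QK1 ε r N) :
    φ.mapQK1 ε' r' N' (B.relaxQK1 hε hr₀ hr hN x) =
      B'.relaxQK1 hε hr₀ hr hN (φ.mapQK1 ε r N x) := by
  unfold mapQK1 relaxQK1
  refine KSystem.map_map_comm (fun _ x => x) (fun n => ⇑(φ.mat n)) (fun n => ⇑(φ.mat n))
    (fun _ x => x) (fun n y => ?_) x
  rfl

end Hom

end MatrixAlg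

/-! ### Operators on `ℓ_p^n(E)` and `SQ_p` spaces -/

/-- `E` is isometric to a closed subspace of a quotient of an `L_p` space by a closed subspace. -/
def IsSQpSpace (p : ℝ≥0∞) [Fact (1 ≤ p)] (E : Type u) [NormedAddCommGroup E] [NormedSpace ℂ E] :
    Prop :=
  ∃ (X : Type v) (_ : MeasurableSpace X) (μ : MeasureTheory.Measure X)
    (M : Submodule ℂ (MeasureTheory.Lp ℂ p μ))
    (F : Submodule ℂ (MeasureTheory.Lp ℂ p μ ⧸ M)),
    IsClosed (M : Set (MeasureTheory.Lp ℂ p μ)) ∧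
      IsClosed (F : Set (MeasureTheory.Lp ℂ p μ ⧸ M)) ∧ Nonempty (E ≃ₗᵢ[ℂ] F)

section Operators

variable {E : Type u} [NormedAddCommGroup E] [NormedSpace ℂ E]

/-- A matrix of operators on `E`, as an operator on `ℓ_p^n(E)`. -/
noncomputable def matOp (p : ℝ≥0∞) [Fact (1 ≤ p)] {n : ℕ}
    (T : Matrix (Fin n) (Fin n) (E →L[ℂ] E)) :
    PiLp p (fun _ : Fin n => E) →L[ℂ] PiLp p (fun _ : Fin n => E) :=
  ((PiLp.continuousLinearEquiv p ℂ (fun _ : Fin n => E)).symm :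
      (Fin n → E) →L[ℂ] PiLp p (fun _ : Fin n => E)) ∘L
    (ContinuousLinearMap.pi fun i => ∑ j, (T i j) ∘L ContinuousLinearMap.proj j) ∘L
    (PiLp.continuousLinearEquiv p ℂ (fun _ : Fin n => E) :
      PiLp p (fun _ : Fin n => E) →L[ℂ] (Fin n → E))

theorem matOp_apply (p : ℝ≥0∞) [Fact (1 ≤ p)] {n : ℕ} (T : Matrix (Fin n) (Fin n) (E →L[ℂ] E))
    (x : PiLp p (fun _ : Fin n => E)) (i : Fin n) : matOp p T x i = ∑ j, T i j (x j) := by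
  simp [matOp]

end Operators

/-- The complex numbers, with `M_n(ℂ)` normed as `B(ℓ_p^n)` and the constant filtration. -/
noncomputable def complexAlg (p : ℝ≥0∞) [Fact (1 ≤ p)] : MatrixAlg.{0} where
  carrier := ℂ
  nrm := fun _ x => ‖matOp p (x.map fun z => z • (1 : ℂ →L[ℂ] ℂ))‖
  nrm_nonneg := fun _ _ => norm_nonneg _
  fil := fun _ => ⊤
  fil_mono := fun _ _ _ _ => le_rfl

/-! ### Filtered algebras of operators -/

/-- A closed subalgebra of `B(E)` with an increasing family of subspaces. -/
structure OpAlg (E : Type u) [NormedAddCommGroup E] [NormedSpace ℂ E] where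
  alg : NonUnitalSubalgebra ℂ (E →L[ℂ] E)
  isClosed : IsClosed (alg : Set (E →L[ℂ] E))
  fil : ℝ → Submodule ℂ (E →L[ℂ] E)
  fil_mono : ∀ r r' : ℝ, 0 < r → r ≤ r' → fil r ≤ fil r'

namespace OpAlg

variable {E : Type u} [NormedAddCommGroup E] [NormedSpace ℂ E]

theorem smul_mem (A : OpAlg E) {a : E →L[ℂ] E} (ha : a ∈ A.alg) (c : ℂ) : c • a ∈ A.alg :=
  SMulMemClass.smul_mem c ha

/-- `e` is an identity element of the algebra. -/
def IsIdentity (A : OpAlg E) (e : E →L[ℂ] E) : Prop :=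
  e ∈ A.alg ∧ ∀ a ∈ A.alg, e * a = a ∧ a * e = a

/-- The algebra has an identity element (which may differ from the identity operator). -/
def IsUnital (A : OpAlg E) : Prop := ∃ e, A.IsIdentity e

open Classical in
/-- The unit of `Ã`: the identity of `A` if `A` is unital, and the identity operator otherwise. -/
noncomputable def unit (A : OpAlg E) : E →L[ℂ] E :=
  if h : A.IsUnital then h.choose else 1

theorem unit_mul (A : OpAlg E) {a : E →L[ℂ] E} (ha : a ∈ A.alg) : A.unit * a = a := by
  unfold unit
  split_ifs with h
  · exact (h.choose_spec.2 a ha).1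
  · exact one_mul a

theorem mul_unit (A : OpAlg E) {a : E →L[ℂ] E} (ha : a ∈ A.alg) : a * A.unit = a := by
  unfold unit
  split_ifs with h
  · exact (h.choose_spec.2 a ha).2
  · exact mul_one a

theorem unit_mul_unit (A : OpAlg E) : A.unit * A.unit = A.unit := by
  unfold unit
  split_ifs with h
  · exact (h.choose_spec.2 _ h.choose_spec.1).2
  · exact mul_one _

theorem unit_of_not (A : OpAlg E) (h : ¬ A.IsUnital) : A.unit = 1 := dif_neg h

/-- `Ã`: it is `A` if `A` is unital, and `A + ℂ I_E` otherwise. -/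
noncomputable def tildeAlg (A : OpAlg E) : NonUnitalSubalgebra ℂ (E →L[ℂ] E) where
  carrier := {x | ∃ a ∈ A.alg, ∃ z : ℂ, x = a + z • A.unit}
  add_mem' := by
    rintro _ _ ⟨a, ha, z, rfl⟩ ⟨b, hb, w, rfl⟩
    exact ⟨a + b, add_mem ha hb, z + w, by rw [add_smul]; abel⟩
  zero_mem' := ⟨0, zero_mem _, 0, by simp⟩
  mul_mem' := by
    rintro _ _ ⟨a, ha, z, rfl⟩ ⟨b, hb, w, rfl⟩
    refine ⟨a * b + w • a + z • b, add_mem (add_mem (mul_mem ha hb) (A.smul_mem ha w))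
      (A.smul_mem hb z), z * w, ?_⟩
    simp only [add_mul, mul_add, smul_mul_assoc, mul_smul_comm, A.unit_mul hb, A.mul_unit ha,
      A.unit_mul_unit]
    module
  smul_mem' := by
    rintro c _ ⟨a, ha, z, rfl⟩
    exact ⟨c • a, A.smul_mem ha c, c * z, by rw [smul_add, smul_smul]⟩

/-- The type of elements of `Ã`. -/
def Tilde (A : OpAlg E) : Type u := A.tildeAlg

noncomputable instance (A : OpAlg E) : NonUnitalRing A.Tilde :=
  inferInstanceAs (NonUnitalRing A.tildeAlg)

noncomputable instance (A : OpAlg E) : Module ℂ A.Tilde := inferInstanceAs (Module ℂ A.tildeAlg)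

/-- The inclusion `Ã → B(E)`. -/
def val (A : OpAlg E) (x : A.Tilde) : E →L[ℂ] E := x.1

theorem val_injective (A : OpAlg E) : Function.Injective A.val := Subtype.val_injective

@[simp] theorem val_add (A : OpAlg E) (x y : A.Tilde) : A.val (x + y) = A.val x + A.val y := rfl
@[simp] theorem val_sub (A : OpAlg E) (x y : A.Tilde) : A.val (x - y) = A.val x - A.val y := rfl
@[simp] theorem val_mul (A : OpAlg E) (x y : A.Tilde) : A.val (x * y) = A.val x * A.val y := rfl
@[simp] theorem val_zero (A : OpAlg E) : A.val 0 = 0 := rfl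
@[simp] theorem val_smul (A : OpAlg E) (c : ℂ) (x : A.Tilde) : A.val (c • x) = c • A.val x := rfl

theorem unit_mul_val (A : OpAlg E) (x : A.Tilde) : A.unit * A.val x = A.val x := by
  obtain ⟨a, ha, z, h⟩ := x.2
  change A.unit * x.1 = x.1
  rw [h, mul_add, A.unit_mul ha, mul_smul_comm, A.unit_mul_unit]

theorem val_mul_unit (A : OpAlg E) (x : A.Tilde) : A.val x * A.unit = A.val x := by
  obtain ⟨a, ha, z, h⟩ := x.2
  change x.1 * A.unit = x.1
  rw [h, add_mul, A.mul_unit ha, smul_mul_assoc, A.unit_mul_unit]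

noncomputable instance (A : OpAlg E) : Ring A.Tilde :=
  { (inferInstance : NonUnitalRing A.Tilde) with
    one := ⟨A.unit, 0, zero_mem _, 1, by simp⟩
    one_mul := fun x => A.val_injective (A.unit_mul_val x)
    mul_one := fun x => A.val_injective (A.val_mul_unit x) }

@[simp] theorem val_one (A : OpAlg E) : A.val 1 = A.unit := rfl

noncomputable instance (A : OpAlg E) : Algebra ℂ A.Tilde :=
  Algebra.ofModule (fun c x y => A.val_injective (smul_mul_assoc c (A.val x) (A.val y)))
    (fun c x y => A.val_injective (mul_smul_comm c (A.val x) (A.val y)))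

/-- `Ã` as an algebra with matrix norms: `M_n(Ã)` carries the operator norm on `ℓ_p^n(E)`, and the
filtration is `A_r + ℂ 1`. -/
noncomputable def tilde (p : ℝ≥0∞) [Fact (1 ≤ p)] (A : OpAlg E) : MatrixAlg.{u} where
  carrier := A.Tilde
  nrm := fun _ x => ‖matOp p (x.map A.val)‖
  nrm_nonneg := fun _ _ => norm_nonneg _
  fil := fun r =>
    { carrier := {x | ∃ a ∈ A.fil r, ∃ z : ℂ, A.val x = a + z • A.unit}
      add_mem' := by
        rintro x y ⟨a, ha, z, hx⟩ ⟨b, hb, w, hy⟩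
        exact ⟨a + b, add_mem ha hb, z + w, by rw [A.val_add, hx, hy, add_smul]; abel⟩
      zero_mem' := ⟨0, zero_mem _, 0, by simp⟩
      smul_mem' := by
        rintro c x ⟨a, ha, z, hx⟩
        exact ⟨c • a, (A.fil r).smul_mem c ha, c * z, by
          rw [A.val_smul, hx, smul_add, smul_smul]⟩ }
  fil_mono := fun r r' hr h _ ⟨a, ha, z, hx⟩ => ⟨a, A.fil_mono r r' hr h ha, z, hx⟩

/-! ### The character of the unitization of a nonunital algebra -/

section Character

variable (A : OpAlg E)

theorem coeff_unique (h : ¬ A.IsUnital) {a b : E →L[ℂ] E} (ha : a ∈ A.alg) (hb : b ∈ A.alg)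
    {z w : ℂ} (hab : a + z • (1 : E →L[ℂ] E) = b + w • (1 : E →L[ℂ] E)) : z = w := by
  by_contra hne
  apply h
  refine ⟨1, ?_, fun _ _ => ⟨one_mul _, mul_one _⟩⟩
  have h1 : (z - w) • (1 : E →L[ℂ] E) = b - a := by
    rw [sub_smul, sub_eq_sub_iff_add_eq_add, add_comm, hab]
  have h2 : (1 : E →L[ℂ] E) = (z - w)⁻¹ • (b - a) := by
    rw [← h1, smul_smul, inv_mul_cancel₀ (sub_ne_zero.2 hne), one_smul]
  rw [h2]
  exact A.smul_mem (sub_mem hb ha) _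

/-- The scalar part of an element of `Ã`. -/
noncomputable def coeff (x : A.Tilde) : ℂ := x.2.choose_spec.2.choose

theorem coeff_spec (x : A.Tilde) : ∃ a ∈ A.alg, A.val x = a + A.coeff x • A.unit :=
  ⟨x.2.choose, x.2.choose_spec.1, x.2.choose_spec.2.choose_spec⟩

theorem coeff_eq (h : ¬ A.IsUnital) {x : A.Tilde} {a : E →L[ℂ] E} (ha : a ∈ A.alg) {z : ℂ}
    (hx : A.val x = a + z • (1 : E →L[ℂ] E)) : A.coeff x = z := by
  obtain ⟨b, hb, hxb⟩ := A.coeff_spec x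
  rw [A.unit_of_not h] at hxb
  exact A.coeff_unique h hb ha (hxb.symm.trans hx)

/-- The character `Ã → ℂ` of a nonunital algebra `A`, with kernel `A`. -/
noncomputable def character (h : ¬ A.IsUnital) : A.Tilde →+* ℂ where
  toFun := A.coeff
  map_one' := A.coeff_eq h (zero_mem _) (by rw [A.val_one, A.unit_of_not h]; simp)
  map_zero' := A.coeff_eq h (zero_mem _) (by simp)
  map_add' x y := by
    obtain ⟨a, ha, hx⟩ := A.coeff_spec x
    obtain ⟨b, hb, hy⟩ := A.coeff_spec y
    refine A.coeff_eq h (add_mem ha hb) ?_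
    rw [A.val_add, hx, hy, A.unit_of_not h, add_smul]
    abel
  map_mul' x y := by
    obtain ⟨a, ha, hx⟩ := A.coeff_spec x
    obtain ⟨b, hb, hy⟩ := A.coeff_spec y
    refine A.coeff_eq h (add_mem (add_mem (mul_mem ha hb) (A.smul_mem ha (A.coeff y)))
      (A.smul_mem hb (A.coeff x))) ?_
    rw [A.val_mul, hx, hy, A.unit_of_not h]
    simp only [add_mul, mul_add, smul_mul_assoc, mul_smul_comm, one_mul, mul_one]
    module

theorem character_eq_zero (h : ¬ A.IsUnital) {x : A.Tilde} (hx : A.val x ∈ A.alg) :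
    A.character h x = 0 := A.coeff_eq h hx (by simp)

/-- The character of the unitization is contractive. -/
theorem norm_coeff_le [CompleteSpace E] (h : ¬ A.IsUnital) {a : E →L[ℂ] E} (ha : a ∈ A.alg)
    (z : ℂ) : ‖z‖ ≤ ‖a + z • (1 : E →L[ℂ] E)‖ := by
  by_contra! hlt
  have hz : z ≠ 0 := by
    rintro rfl
    rw [norm_zero] at hlt
    exact absurd hlt (not_lt.2 (norm_nonneg _))
  set x : E →L[ℂ] E := z⁻¹ • (a + z • (1 : E →L[ℂ] E)) with hx
  have hx1 : ‖x‖ < 1 := by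
    rw [hx, norm_smul, norm_inv, inv_mul_lt_iff₀ (norm_pos_iff.2 hz), mul_one]
    exact hlt
  have hxa : 1 - x = -(z⁻¹ • a) := by
    rw [hx, smul_add, smul_smul, inv_mul_cancel₀ hz, one_smul]
    abel
  have hmem : ∀ n : ℕ, (1 - x) * x ^ n ∈ A.alg := by
    intro n
    induction n with
    | zero =>
      rw [pow_zero, mul_one, hxa]
      exact neg_mem (A.smul_mem ha _)
    | succ n ih =>
      have hx2 : x = 1 + z⁻¹ • a := by 
        rw [hx, smul_add, smul_smul, inv_mul_cancel₀ hz, one_smul, add_comm]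
      rw [pow_succ, ← mul_assoc]
      nth_rewrite 3 [hx2]
      rw [mul_add, mul_one]
      exact add_mem ih (mul_mem ih (A.smul_mem ha _))
  apply h
  refine ⟨1, ?_, fun _ _ => ⟨one_mul _, mul_one _⟩⟩
  have hs : HasSum (fun n : ℕ => (1 - x) * x ^ n) 1 := by
    have := (summable_geometric_of_norm_lt_one hx1).hasSum.mul_left (1 - x)
    rwa [mul_neg_geom_series x hx1] at this
  exact A.isClosed.mem_of_tendsto hs (Filter.Eventually.of_forall fun s =>
    sum_mem fun n _ => hmem n)

end Character

end OpAlg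

section Contraction

variable {E : Type u} [NormedAddCommGroup E] [NormedSpace ℂ E]

theorem piLp_norm_mono (p : ℝ≥0∞) [Fact (1 ≤ p)] {n : ℕ} {F G : Type*} [NormedAddCommGroup F]
    [NormedAddCommGroup G] (x : PiLp p (fun _ : Fin n => F)) (y : PiLp p (fun _ : Fin n => G))
    (h : ∀ i, ‖x i‖ ≤ ‖y i‖) : ‖x‖ ≤ ‖y‖ := by
  by_cases hp : p = ∞
  · subst hp
    rw [PiLp.norm_eq_ciSup, PiLp.norm_eq_ciSup]
    exact ciSup_mono (Set.finite_range _).bddAbove h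
  · have hp0 : 0 < p.toReal := p.toReal_pos_iff_ne_top.2 hp
    rw [PiLp.norm_eq_sum hp0, PiLp.norm_eq_sum hp0]
    gcongr with i
    exact h i

/-- A functional on `ℓ_p^n` of norm at most one acts contractively from `ℓ_p^n(E)` to `E`. -/
theorem norm_sum_smul_le (p : ℝ≥0∞) [Fact (1 ≤ p)] {n : ℕ} (α : Fin n → ℂ)
    (hα : ∀ c : PiLp p (fun _ : Fin n => ℂ), ‖∑ i, α i * c i‖ ≤ ‖c‖)
    (x : PiLp p (fun _ : Fin n => E)) : ‖∑ i, α i • x i‖ ≤ ‖x‖ := by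
  obtain ⟨f, hf, hfx⟩ := exists_dual_vector'' ℂ (∑ i, α i • x i)
  have h1 : ‖∑ i, α i • x i‖ = ‖∑ i, α i * f (x i)‖ := by
    have : f (∑ i, α i • x i) = ∑ i, α i * f (x i) := by simp
    rw [← this, hfx]
    simp
  rw [h1]
  refine (hα (WithLp.toLp p fun i => f (x i))).trans (piLp_norm_mono p _ _ fun i => ?_)
  exact (f.le_opNorm (x i)).trans (mul_le_of_le_one_left (norm_nonneg _) hf)

namespace OpAlg

variable (A : OpAlg E)

/-- The character of the unitization is contractive on all matrix algebras. -/
theorem norm_character_le [CompleteSpace E] (p : ℝ≥0∞) [Fact (1 ≤ p)] (h : ¬ A.IsUnital) (n : ℕ)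
    (x : Matrix (Fin n) (Fin n) A.Tilde) :
    ‖matOp p ((x.map (A.character h)).map fun z => z • (1 : ℂ →L[ℂ] ℂ))‖ ≤
      ‖matOp p (x.map A.val)‖ := by
  refine ContinuousLinearMap.opNorm_le_bound _ (norm_nonneg _) fun β => ?_
  set w := matOp p ((x.map (A.character h)).map fun z => z • (1 : ℂ →L[ℂ] ℂ)) β with hw
  have hwi : ∀ i, w i = ∑ j, A.coeff (x i j) * β j := by
    intro i
    rw [hw, matOp_apply]
    rfl
  obtain ⟨g, hg, hgw⟩ := exists_dual_vector'' ℂ w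
  set α : Fin n → ℂ := fun i => g (PiLp.basisFun p ℂ (Fin n) i) with hα
  have hgα : ∀ c : PiLp p (fun _ : Fin n => ℂ), g c = ∑ i, α i * c i := by
    intro c
    conv_lhs => rw [← (PiLp.basisFun p ℂ (Fin n)).sum_repr c]
    rw [map_sum]
    refine Finset.sum_congr rfl fun i _ => ?_
    rw [map_smul, PiLp.basisFun_repr, smul_eq_mul, mul_comm]
  have hα1 : ∀ c : PiLp p (fun _ : Fin n => ℂ), ‖∑ i, α i * c i‖ ≤ ‖c‖ := by
    intro c
    rw [← hgα]
    exact (g.le_opNorm c).trans (mul_le_of_le_one_left (norm_nonneg _) hg)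
  choose a ha hxa using fun i j => A.coeff_spec (x i j)
  rw [A.unit_of_not h] at hxa
  have key : ‖(∑ i, ∑ j, (α i * β j) • a i j) +
      (∑ i, α i * w i) • (1 : E →L[ℂ] E)‖ ≤ ‖matOp p (x.map A.val)‖ * ‖β‖ := by
    refine ContinuousLinearMap.opNorm_le_bound _ (by positivity) fun v => ?_
    set y : PiLp p (fun _ : Fin n => E) := WithLp.toLp p fun j => β j • v with hy
    have hyn : ‖y‖ ≤ ‖β‖ * ‖v‖ := by
      have : ‖y‖ ≤ ‖(‖v‖ : ℂ) • β‖ := piLp_norm_mono p _ _ fun i => by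
        simp [hy, norm_smul, mul_comm]
      refine this.trans ?_
      rw [norm_smul]
      simp [mul_comm]
    have hval : ((∑ i, ∑ j, (α i * β j) • a i j) + (∑ i, α i * w i) • (1 : E →L[ℂ] E)) v =
        ∑ i, α i • (matOp p (x.map A.val) y) i := by
      have : ∀ i, (matOp p (x.map A.val) y) i =
          ∑ j, β j • (a i j v) + w i • v := by
        intro i
        rw [matOp_apply, hwi, Finset.sum_smul, ← Finset.sum_add_distrib]
        refine Finset.sum_congr rfl fun j _ => ?_
        rw [Matrix.map_apply, hxa]
        simp only [hy, map_smul, add_apply, smul_apply, one_apply_eq_self, smul_add, smul_smul]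
        rw [mul_comm]
      simp only [this, smul_add, Finset.sum_add_distrib, Finset.smul_sum, smul_smul]
      simp [Finset.sum_smul]
    rw [hval]
    calc _ ≤ ‖matOp p (x.map A.val) y‖ := norm_sum_smul_le p α hα1 _
      _ ≤ ‖matOp p (x.map A.val)‖ * ‖y‖ := ContinuousLinearMap.le_opNorm _ _
      _ ≤ ‖matOp p (x.map A.val)‖ * (‖β‖ * ‖v‖) := by gcongr
      _ = _ := by ring
  have h1 := A.norm_coeff_le h (a := ∑ i, ∑ j, (α i * β j) • a i j)
    (sum_mem fun i _ => sum_mem fun j _ => A.smul_mem (ha i j) _) (∑ i, α i * w i)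
  have h2 : ‖w‖ = ‖∑ i, α i * w i‖ := by
    rw [← hgα, hgw]
    simp
  rw [h2]
  exact h1.trans key

/-- The character of the unitization of a nonunital algebra, as a morphism. -/
noncomputable def characterHom [CompleteSpace E] (p : ℝ≥0∞) [Fact (1 ≤ p)] (h : ¬ A.IsUnital) :
    MatrixAlg.Hom (A.tilde p) (complexAlg p) where
  toRingHom := A.character h
  contr := A.norm_character_le p h
  fil := fun _ _ _ => (Submodule.mem_top : _ ∈ (⊤ : Submodule ℂ ℂ))

end OpAlg

end Contraction

/-! ### Filtered `SQ_p` algebras, closed ideals and completely filtered extensions -/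

section Extensions

variable {E : Type u} [NormedAddCommGroup E] [NormedSpace ℂ E]

/-- `A ⊆ B(E)` is a filtered `SQ_p` algebra: `E` is a subquotient of an `L_p` space, and
`(A_r)_{r>0}` is a filtration of `A` by closed subspaces. If `A` is unital, then its identity
belongs to every `A_r` and has norm one (norm zero if `A = 0`). -/
structure IsFilteredSQpAlg (p : ℝ≥0∞) [Fact (1 ≤ p)] (A : OpAlg E) : Prop where
  space : IsSQpSpace.{u, v} p E
  fil_le : ∀ r, 0 < r → ∀ a ∈ A.fil r, a ∈ A.alg
  fil_closed : ∀ r, 0 < r → IsClosed (A.fil r : Set (E →L[ℂ] E))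
  fil_mul : ∀ r r', 0 < r → 0 < r' → ∀ a ∈ A.fil r, ∀ b ∈ A.fil r', a * b ∈ A.fil (r + r')
  dense : ∀ a ∈ A.alg, a ∈ closure {b | ∃ r, 0 < r ∧ b ∈ A.fil r}
  unit_mem : ∀ e, A.IsIdentity e → ∀ r, 0 < r → e ∈ A.fil r
  norm_unit : ∀ e, A.IsIdentity e → ‖e‖ ≤ 1

/-- A closed two-sided ideal `J` of `A`. -/
structure ClosedIdeal (A : OpAlg E) where
  alg : NonUnitalSubalgebra ℂ (E →L[ℂ] E)
  isClosed : IsClosed (alg : Set (E →L[ℂ] E))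
  le : ∀ x ∈ alg, x ∈ A.alg
  mul_mem_left : ∀ a ∈ A.alg, ∀ x ∈ alg, a * x ∈ alg
  mul_mem_right : ∀ a ∈ A.alg, ∀ x ∈ alg, x * a ∈ alg

namespace ClosedIdeal

variable {A : OpAlg E} (J : ClosedIdeal A)

/-- The ideal as an algebra of operators, with `J_r = J ∩ A_r`. -/
def opAlg : OpAlg E where
  alg := J.alg
  isClosed := J.isClosed
  fil := fun r => A.fil r ⊓ J.alg.toSubmodule
  fil_mono := fun r r' hr h => inf_le_inf_right _ (A.fil_mono r r' hr h)

/-- The extension `0 → J → A → A/J → 0` is `C`-completely filtered: for `x ∈ M_n(A_r)`,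
`inf_{y ∈ M_n(J_r)} ‖x + y‖ ≤ C inf_{y ∈ M_n(J)} ‖x + y‖`. -/
def IsCompletelyFiltered (p : ℝ≥0∞) [Fact (1 ≤ p)] (C : ℝ) : Prop :=
  ∀ (n : ℕ) (r : ℝ), 0 < r → ∀ x : Matrix (Fin n) (Fin n) (E →L[ℂ] E), (∀ i j, x i j ∈ A.fil r) →
    sInf {t : ℝ | ∃ y : Matrix (Fin n) (Fin n) (E →L[ℂ] E),
        (∀ i j, y i j ∈ J.opAlg.fil r) ∧ t = ‖matOp p (x + y)‖} ≤
      C * sInf {t : ℝ | ∃ y : Matrix (Fin n) (Fin n) (E →L[ℂ] E),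
        (∀ i j, y i j ∈ J.alg) ∧ t = ‖matOp p (x + y)‖}

/-- `J` as an ideal of `Ã`. -/
noncomputable def tildeIdeal : Ideal A.Tilde where
  carrier := {x | A.val x ∈ J.alg}
  add_mem' := fun hx hy => add_mem (S := NonUnitalSubalgebra ℂ (E →L[ℂ] E)) hx hy
  zero_mem' := zero_mem J.alg
  smul_mem' := by
    rintro c x hx
    obtain ⟨a, ha, hc⟩ := A.coeff_spec c
    change A.val c * A.val x ∈ J.alg
    rw [hc, add_mul, smul_mul_assoc, A.unit_mul_val]
    exact add_mem (J.mul_mem_left a ha _ hx) (SMulMemClass.smul_mem (A.coeff c) hx)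

instance : J.tildeIdeal.IsTwoSided where
  mul_mem_of_left := by
    rintro x c hx
    obtain ⟨a, ha, hc⟩ := A.coeff_spec c
    change A.val x * A.val c ∈ J.alg
    rw [hc, mul_add, mul_smul_comm, A.val_mul_unit]
    exact add_mem (J.mul_mem_right a ha _ hx) (SMulMemClass.smul_mem (A.coeff c) hx)

/-- `Ã/J`, with the quotient norms of `M_n(Ã)/M_n(J)` and the quotient filtration. -/
noncomputable def quot (p : ℝ≥0∞) [Fact (1 ≤ p)] : MatrixAlg.{u} where
  carrier := A.Tilde ⧸ J.tildeIdeal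
  nrm := fun n x => sInf {t : ℝ | ∃ y : Matrix (Fin n) (Fin n) A.Tilde,
    y.map (Ideal.Quotient.mk J.tildeIdeal) = x ∧ t = ‖matOp p (y.map A.val)‖}
  nrm_nonneg := by
    rintro n x
    refine Real.sInf_nonneg ?_
    rintro _ ⟨y, -, rfl⟩
    exact norm_nonneg _
  fil := fun r => ((A.tilde p).fil r).map (Ideal.Quotient.mkₐ ℂ J.tildeIdeal).toLinearMap
  fil_mono := fun r r' hr h => Submodule.map_mono ((A.tilde p).fil_mono r r' hr h)

/-- The character `Ã/J → ℂ` for nonunital `A`. -/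
noncomputable def character (h : ¬ A.IsUnital) : A.Tilde ⧸ J.tildeIdeal →+* ℂ :=
  Ideal.Quotient.lift J.tildeIdeal (A.character h) fun _ hx =>
    A.character_eq_zero h (J.le _ hx)

/-- The character `Ã/J → ℂ` for nonunital `A`, as a morphism. -/
noncomputable def characterHom [CompleteSpace E] (p : ℝ≥0∞) [Fact (1 ≤ p)] (h : ¬ A.IsUnital) :
    MatrixAlg.Hom (J.quot p) (complexAlg p) where
  toRingHom := J.character h
  contr := by
    intro n x
    refine le_csInf ?_ ?_
    · choose y hy using fun i j => Ideal.Quotient.mk_surjective (I := J.tildeIdeal) (x i j)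
      exact ⟨_, Matrix.of y, by ext i j; exact hy i j, rfl⟩
    · rintro _ ⟨y, rfl, rfl⟩
      exact A.norm_character_le p h n y
  fil := fun _ _ _ => (Submodule.mem_top : _ ∈ (⊤ : Submodule ℂ ℂ))

end ClosedIdeal

end Extensions

/-! ### Control pairs and controlled morphisms -/

/-- A control pair `(λ, h)`. -/
structure ControlPair where
  lam : ℝ → ℝ
  h : ℝ → ℝ → ℝ
  one_le_lam : ∀ N, 1 ≤ N → 1 ≤ lam N
  lam_mono : ∀ N N', 1 ≤ N → N ≤ N' → lam N ≤ lam N'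
  one_le_h : ∀ ε N, 0 < ε → ε < 1 / 20 → 1 ≤ N → 1 ≤ h ε N
  h_anti : ∀ ε ε' N, 0 < ε → ε ≤ ε' → ε' < 1 / 20 → 1 ≤ N → h ε' N ≤ h ε N

namespace ControlPair

variable (c : ControlPair)

theorem lam_mul_le {ε ε' N N' : ℝ} (hε₀ : 0 < ε) (hε : ε ≤ ε') (hN₁ : 1 ≤ N) (hN : N ≤ N') :
    c.lam N * ε ≤ c.lam N' * ε' :=
  mul_le_mul (c.lam_mono N N' hN₁ hN) hε hε₀.le
    (zero_le_one.trans (c.one_le_lam N' (hN₁.trans hN)))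

theorem lt_of_lt {ε N : ℝ} (hN : 1 ≤ N) (h : ε < 1 / (20 * c.lam N)) : ε < 1 / 20 := by
  refine h.trans_le (one_div_le_one_div_of_le (by norm_num) ?_)
  linarith [c.one_le_lam N hN]

theorem h_mul_pos {ε ε' r N N' : ℝ} (hε₀ : 0 < ε) (hε : ε ≤ ε') (hN₁ : 1 ≤ N) (hN : N ≤ N')
    (hε' : ε' < 1 / (20 * c.lam N')) (hr : 0 < r) : 0 < c.h ε N * r :=
  mul_pos (zero_lt_one.trans_le
    (c.one_le_h ε N hε₀ (hε.trans_lt (c.lt_of_lt (hN₁.trans hN) hε')) hN₁)) hr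

end ControlPair

/-- A family of abelian groups indexed by `(ε, r, N)`, with relaxation of control maps. -/
structure ControlledFamily where
  grp : ℝ → ℝ → ℝ → Type u
  [inst : ∀ ε r N, AddCommGroup (grp ε r N)]
  relax : ∀ {ε ε' r r' N N' : ℝ}, ε ≤ ε' → 0 < r → r ≤ r' → N ≤ N' → (grp ε r N →+ grp ε' r' N')

instance (G : ControlledFamily.{u}) (ε r N : ℝ) : AddCommGroup (G.grp ε r N) := G.inst ε r N

/-- A `(λ, h)`-controlled morphism: homomorphisms
`F^{ε,r,N} : G^{ε,r,N} → H^{λ_N ε, h_{ε,N} r, λ_N}` that commute with relaxation of control. Only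
the values for `0 < ε < 1/(20 λ_N)`, `r > 0` and `N ≥ 1` are relevant. -/
structure ControlledMorphism (c : ControlPair) (G : ControlledFamily.{u})
    (H : ControlledFamily.{v}) where
  map : ∀ ε r N : ℝ, G.grp ε r N →+ H.grp (c.lam N * ε) (c.h ε N * r) (c.lam N)
  comm : ∀ {ε ε' r r' N N' : ℝ} (hε₀ : 0 < ε) (hε : ε ≤ ε') (hε' : ε' < 1 / (20 * c.lam N'))
    (hr₀ : 0 < r) (hr : r ≤ r') (hh : c.h ε N * r ≤ c.h ε' N' * r') (hN₁ : 1 ≤ N) (hN : N ≤ N')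
    (x : G.grp ε r N),
    map ε' r' N' (G.relax hε hr₀ hr hN x) =
      H.relax (c.lam_mul_le hε₀ hε hN₁ hN) (c.h_mul_pos hε₀ hε hN₁ hN hε' hr₀) hh
        (c.lam_mono N N' hN₁ hN) (map ε r N x)

/-! ### `K`-groups of algebras of operators and of quotients -/

section KGroups

variable {E : Type u} [NormedAddCommGroup E] [NormedSpace ℂ E] [CompleteSpace E]

namespace OpAlg

variable (p : ℝ≥0∞) [Fact (1 ≤ p)] (A : OpAlg E)

open Classical in
/-- `K_0^{ε,r,N}(A)`: the whole group `K_0^{ε,r,N}(Ã)` if `A` is unital (so that `Ã = A`), and the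
kernel of `K_0^{ε,r,N}(Ã) → K_0^{ε,r,N}(ℂ)` otherwise. -/
noncomputable def QK0 (ε r N : ℝ) : AddSubgroup ((A.tilde p).QK0 ε r N) :=
  if h : A.IsUnital then ⊤ else ((A.characterHom p h).mapQK0 ε r N).ker

open Classical in
/-- The ordinary group `K_0(A)`. -/
noncomputable def K0 : AddSubgroup (A.tilde p).K0 :=
  if h : A.IsUnital then ⊤ else (A.characterHom p h).mapK0.ker

theorem relaxQK0_mem {ε ε' r r' N N' : ℝ} (hε : ε ≤ ε') (hr₀ : 0 < r) (hr : r ≤ r')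
    (hN : N ≤ N') (x : A.QK0 p ε r N) :
    (A.tilde p).relaxQK0 hε hr₀ hr hN x ∈ A.QK0 p ε' r' N' := by
  obtain ⟨x, hx⟩ := x
  unfold QK0 at hx ⊢
  split_ifs at hx ⊢ with h
  · exact AddSubgroup.mem_top _
  · rw [AddMonoidHom.mem_ker] at hx ⊢
    rw [MatrixAlg.Hom.mapQK0_relax, hx, map_zero]

/-- The family `(K_0^{ε,r,N}(A))`. -/
noncomputable def familyK0 : ControlledFamily.{u} where
  grp := fun ε r N => A.QK0 p ε r N
  relax := fun hε hr₀ hr hN =>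
    (((A.tilde p).relaxQK0 hε hr₀ hr hN).comp (AddSubgroup.subtype _)).codRestrict _
      (A.relaxQK0_mem p hε hr₀ hr hN)

end OpAlg

namespace ClosedIdeal

variable (p : ℝ≥0∞) [Fact (1 ≤ p)] {A : OpAlg E} (J : ClosedIdeal A)

open Classical in
/-- `K_1^{ε,r,N}(A/J)`, where `Ã/J` is used as the unital algebra attached to `A/J`: the whole group `K_1^{ε,r,N}(Ã/J)` if `A` is unital, and the kernel of
`K_1^{ε,r,N}(Ã/J) → K_1^{ε,r,N}(ℂ)` otherwise. -/
noncomputable def quotQK1 (ε r N : ℝ) : AddSubgroup ((J.quot p).QK1 ε r N) :=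
  if h : A.IsUnital then ⊤ else ((J.characterHom p h).mapQK1 ε r N).ker

theorem relaxQK1_mem {ε ε' r r' N N' : ℝ} (hε : ε ≤ ε') (hr₀ : 0 < r) (hr : r ≤ r')
    (hN : N ≤ N') (x : J.quotQK1 p ε r N) :
    (J.quot p).relaxQK1 hε hr₀ hr hN x ∈ J.quotQK1 p ε' r' N' := by
  obtain ⟨x, hx⟩ := x
  unfold quotQK1 at hx ⊢
  split_ifs at hx ⊢ with h
  · exact AddSubgroup.mem_top _
  · rw [AddMonoidHom.mem_ker] at hx ⊢
    rw [MatrixAlg.Hom.mapQK1_relax, hx, map_zero]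

/-- The family `(K_1^{ε,r,N}(A/J))`. -/
noncomputable def familyQuotK1 : ControlledFamily.{u} where
  grp := fun ε r N => J.quotQK1 p ε r N
  relax := fun hε hr₀ hr hN =>
    (((J.quot p).relaxQK1 hε hr₀ hr hN).comp (AddSubgroup.subtype _)).codRestrict _
      (J.relaxQK1_mem p hε hr₀ hr hN)

/-- The ordinary group `K_1(A/J) = K_1(Ã/J)`. -/
abbrev quotK1 : Type u := (J.quot p).K1

end ClosedIdeal

/-! ### Comparison with ordinary `K`-theory and the boundary map -/

/-- `f ∈ M_n(Ã)` is the idempotent `κ_0(e) = (1/2πi) ∮ (z - e)⁻¹ dz`, the integral being taken over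
the circle of radius `√ε` around `1`. -/
def IsKappaIdem (p : ℝ≥0∞) [Fact (1 ≤ p)] (A : OpAlg E) (ε : ℝ) {n : ℕ}
    (e f : Matrix (Fin n) (Fin n) A.Tilde) : Prop :=
  matOp p (f.map A.val) = (2 * Real.pi * Complex.I : ℂ)⁻¹ •
    ∮ z in C((1 : ℂ), Real.sqrt ε),
      Ring.inverse (z • (1 : PiLp p (fun _ : Fin n => E) →L[ℂ] PiLp p (fun _ : Fin n => E)) -
        matOp p (e.map A.val))

/-- `κ` is the homomorphism `K_0^{ε,r,N}(Ã) → K_0(Ã)`, `[e] ↦ [κ_0(e)]`. -/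
def IsKappa0 (p : ℝ≥0∞) [Fact (1 ≤ p)] (A : OpAlg E) (ε r N : ℝ)
    (κ : (A.tilde p).QK0 ε r N →+ (A.tilde p).K0) : Prop :=
  ∀ (n : ℕ) (e : {e : (A.tilde p).Mat n // (A.tilde p).QIdem ε r N n e}),
    ∃ f : {f : (A.tilde p).Mat n // f * f = f}, IsKappaIdem p A ε e.1 f.1 ∧
      κ (((A.tilde p).qIdemSystem ε r N).cls e) = (A.tilde p).idemSystem.cls f

/-- `κ` is the homomorphism `K_1^{ε,r,N}(B) → K_1(B)`, `[u] ↦ [u]`, for a unital algebra `B`. -/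
def IsKappa1 (B : MatrixAlg.{u}) (ε r N : ℝ) (κ : B.QK1 ε r N →+ B.K1) : Prop :=
  ∀ (n : ℕ) (u : {u : B.Mat n // B.QInv ε r N n u}),
    ∃ h : IsUnit u.1, κ ((B.qInvSystem ε r N).cls u) = B.invSystem.cls ⟨u.1, h⟩

namespace ClosedIdeal

variable (p : ℝ≥0∞) [Fact (1 ≤ p)] {A : OpAlg E} (J : ClosedIdeal A)

/-- `∂` is the boundary map `K_1(A/J) → K_0(J)` of ordinary `K`-theory: if `u ∈ GL_n(Ã/J)` and
`w ∈ GL_{2n}(Ã)` is a lift of `diag(u, u⁻¹)`, then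
`∂[u] = [w diag(I_n, 0) w⁻¹] - [diag(I_n, 0)]`. Here `w diag(I_n, 0) w⁻¹ = diag(I_n, 0) + y` with
`y ∈ M_{2n}(J)`, and this is read in `M_{2n}(J̃)` with the unit of `J̃` in the entries of
`diag(I_n, 0)`. -/
def IsBoundaryMap (d : J.quotK1 p →+ J.opAlg.K0 p) : Prop :=
  ∀ (n : ℕ) (u : {u : (J.quot p).Mat n // IsUnit u}) (u' : (J.quot p).Mat n)
    (w w' : Matrix (Fin (n + n)) (Fin (n + n)) A.Tilde),
    u.1 * u' = 1 → u' * u.1 = 1 → w * w' = 1 → w' * w = 1 →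
    w.map (Ideal.Quotient.mk J.tildeIdeal) = bdiag u.1 u' →
    ∃ e q : {e : (J.opAlg.tilde p).Mat (n + n) // e * e = e},
      q.1 = cornerProj (J.opAlg.tilde p).carrier n ∧
      (∀ i j, J.opAlg.val ((e.1 - q.1) i j) =
        A.val ((w * cornerProj A.Tilde n * w' - cornerProj A.Tilde n) i j)) ∧
      (d ((J.quot p).invSystem.cls u) : (J.opAlg.tilde p).K0) =
        (J.opAlg.tilde p).idemSystem.cls e - (J.opAlg.tilde p).idemSystem.cls q

/-- The controlled morphism `D : K_1(A/J) → K_0(J)` induces the homomorphism `F` in ordinary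
`K`-theory: `F(κ_1(x)) = κ_0(D(x))` for all `x ∈ K_1^{ε,r,N}(A/J)`. -/
def Induces {c : ControlPair} (D : ControlledMorphism c (J.familyQuotK1 p) (J.opAlg.familyK0 p))
    (F : J.quotK1 p →+ J.opAlg.K0 p) : Prop :=
  ∀ ε r N : ℝ, 0 < ε → ε < 1 / (20 * c.lam N) → 0 < r → 1 ≤ N →
    ∃ (κ₁ : (J.quot p).QK1 ε r N →+ (J.quot p).K1)
      (κ₀ : (J.opAlg.tilde p).QK0 (c.lam N * ε) (c.h ε N * r) (c.lam N) →+ (J.opAlg.tilde p).K0),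
      IsKappa1 (J.quot p) ε r N κ₁ ∧
      IsKappa0 p J.opAlg (c.lam N * ε) (c.h ε N * r) (c.lam N) κ₀ ∧
      ∀ x : J.quotQK1 p ε r N,
        (F (κ₁ x) : (J.opAlg.tilde p).K0) = κ₀ (D.map ε r N x : J.opAlg.QK0 p _ _ _).1

end ClosedIdeal

end KGroups

end QuantK

/-! Suppose first that J has no identity. For any matrices U, V over Ã the Whitehead product of
elementary matrices w = `liftUnit U V` is invertible, whether or not U and V are related. So w
diag(1,0) w⁻¹ = diag(1,0) + `relIdem U V` is an exact idempotent, and the entries of `relIdem U V`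
are polynomials of degree at most five in those of U and V. Every block of `relIdem U V` has a
factor 1 - UV or 1 - VU. It therefore lies over J when U, V lift an inverse pair of the quotient,
and it is small modulo J when they lift a quasi-inverse pair. In the second case complete filtration
supplies a nearby Y over J with the same propagation, and diag(1,0) + Y is a quasi-idempotent over
J̃. The controlled boundary of [u] is [diag(1,0) + Y] - [diag(1,0)]. The factor h = 10 is degree
five times the propagation 2r of homotopies, and λ_N collects the norm estimates. None of these
constants involves p, A or J.

The hypothesis on the filtration speaks of A_r, whereas lifts live in A_r + ℂ1. If A is nonunital,
the scalar part has to be split off at no uncontrolled cost: the character of Ã is completely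
contractive, and on a subquotient of a finite-exponent L_p space a scalar matrix has norm at most
its norm on ℓ_p^n (`norm_matOp_scalar_le`). This is where the SQ_p condition enters. It yields
`IsCompletelyFiltered.exists_correction` and `IsCompletelyFiltered.exists_lift` with constant 2C +
1.

The construction involves choices, but each choice ranges over a convex set: the bounded lifts U of
u, then the V that are nearly inverse to u modulo J, then the Y over J_{10r} within a given distance
of `relIdem U V`. Local constant choices glue by a partition of unity (`exists_path_of_convex`), so
any two choices are homotopic, and a homotopy of quasi-inverse pairs can be followed by a path of
lifts with exact end points. The boundary is thus handled as a relation, `IsQuantBoundary`, which is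
shown to be functional, homotopy invariant and additive; `KSystem.exists_hom_of_rel` turns it into a
homomorphism. Relaxing control keeps the same U, V, Y.

The ordinary boundary map comes from the same argument with exact inverses and no filtration
(`IsExactBoundary`). An arbitrary lift of diag(u, u⁻¹) differs from w by an invertible congruent to
1 modulo J, which comes from J̃ and only conjugates the idempotent. For the comparison, κ_0 is
computed by an algebraic formula, `spectralIdem`, that agrees with the Riesz integral
(`riesz_integral`), is continuous, and is respected by nonunital homomorphisms. Moving V to a lift
of the true inverse of u along a path gives κ_0 ∘ ∂ = ∂ ∘ κ_1 (`exists_quantBoundary_kappa0`).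

Uniqueness holds because every class of K_1(A/J) is κ_1 of a quantitative class
(`exists_kappa1_eq`): perturb into the dense filtration, after moving the scalar part to 1 through
the connected group GL_n(ℂ) when A is nonunital.

If J has an identity f, multiplication by f is a unital homomorphism Ã → J̃. It sends w to an
invertible that conjugates diag(1,0) to the boundary idempotent, so the ordinary boundary vanishes
and the zero morphism induces it. -/

namespace QuantK

/-! ### Matrices over `Ã` as a complete normed algebra -/

section MatOp

variable {E : Type u} [NormedAddCommGroup E] [NormedSpace ℂ E] (p : ℝ≥0∞) [Fact (1 ≤ p)]

theorem matOp_add {n : ℕ} (S T : Matrix (Fin n) (Fin n) (E →L[ℂ] E)) :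
    matOp p (S + T) = matOp p S + matOp p T := by
  ext x i
  simp [matOp_apply, Finset.sum_add_distrib]

theorem matOp_smul {n : ℕ} (c : ℂ) (T : Matrix (Fin n) (Fin n) (E →L[ℂ] E)) :
    matOp p (c • T) = c • matOp p T := by
  ext x i
  simp [matOp_apply, Finset.smul_sum]

theorem matOp_zero {n : ℕ} :
    matOp p (0 : Matrix (Fin n) (Fin n) (E →L[ℂ] E)) = 0 := by
  ext x i
  simp [matOp_apply]

theorem matOp_mul {n : ℕ} (S T : Matrix (Fin n) (Fin n) (E →L[ℂ] E)) :
    matOp p (S * T) = matOp p S * matOp p T := by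
  ext x i
  simp only [matOp_apply, Matrix.mul_apply, mul_apply_eq_comp,
    sum_apply, map_sum]
  rw [Finset.sum_comm]

/-- The matrix entries of an operator on `ℓ_p^n(E)`. -/
noncomputable def opEntry {n : ℕ} (i j : Fin n) :
    (PiLp p (fun _ : Fin n => E) →L[ℂ] PiLp p (fun _ : Fin n => E)) → (E →L[ℂ] E) := fun T =>
  (PiLp.proj p (fun _ : Fin n => E) i (𝕜 := ℂ)) ∘L T ∘L
    ((PiLp.continuousLinearEquiv p ℂ (fun _ : Fin n => E)).symm :
      (Fin n → E) →L[ℂ] PiLp p (fun _ : Fin n => E)) ∘L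
        (ContinuousLinearMap.single ℂ (fun _ : Fin n => E) j)

theorem continuous_opEntry {n : ℕ} (i j : Fin n) :
    Continuous (opEntry (E := E) p i j) := by
  unfold opEntry
  fun_prop

theorem opEntry_matOp {n : ℕ} (i j : Fin n) (T : Matrix (Fin n) (Fin n) (E →L[ℂ] E)) :
    opEntry p i j (matOp p T) = T i j := by
  ext x
  change matOp p T (WithLp.toLp p (Pi.single j x)) i = _
  rw [matOp_apply, Finset.sum_eq_single j]
  · simp
  · intro k _ hk
    simp [hk]
  · simp

theorem matOp_opEntry {n : ℕ} (T : PiLp p (fun _ : Fin n => E) →L[ℂ] PiLp p (fun _ : Fin n => E)) :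
    matOp p (Matrix.of fun i j => opEntry p i j T) = T := by
  ext x i
  rw [matOp_apply]
  change ∑ j, T (WithLp.toLp p (Pi.single j (x j))) i = T x i
  have : x = ∑ j, WithLp.toLp p (Pi.single j (x j)) := by
    ext k
    simp [Finset.sum_apply, Pi.single_apply]
  conv_rhs => rw [this, map_sum]
  simp

end MatOp

namespace OpAlg

variable {E : Type u} [NormedAddCommGroup E] [NormedSpace ℂ E] (p : ℝ≥0∞) [Fact (1 ≤ p)]
  (A : OpAlg E)

/-- Adding the line spanned by the unit to the closed subspace A gives a closed subspace, since a
finite-dimensional summand does not destroy closedness. -/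
theorem isClosed_tildeAlg : IsClosed (A.tildeAlg : Set (E →L[ℂ] E)) := by
  have h : (A.tildeAlg : Set (E →L[ℂ] E)) =
      ((A.alg.toSubmodule ⊔ Submodule.span ℂ {A.unit} : Submodule ℂ (E →L[ℂ] E)) :
        Set (E →L[ℂ] E)) := by
    ext x
    simp only [SetLike.mem_coe, Submodule.mem_sup, Submodule.mem_span_singleton]
    constructor
    · rintro ⟨a, ha, z, rfl⟩
      exact ⟨a, ha, _, ⟨z, rfl⟩, rfl⟩
    · rintro ⟨a, ha, _, ⟨z, rfl⟩, rfl⟩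
      exact ⟨a, ha, z, rfl⟩
  rw [h]
  exact Submodule.isClosed_sup_finiteDimensional _ _ A.isClosed

/-- `M_n(Ã)` as an algebra of operators on `ℓ_p^n(E)`. -/
noncomputable def toOp (n : ℕ) : (A.tilde p).Mat n →ₙₐ[ℂ]
    (PiLp p (fun _ : Fin n => E) →L[ℂ] PiLp p (fun _ : Fin n => E)) where
  toFun X := matOp p (X.map A.val)
  map_smul' c X := matOp_smul p c (X.map A.val)
  map_zero' := matOp_zero p
  map_add' X Y := matOp_add p (X.map A.val) (Y.map A.val)
  map_mul' X Y := by
    rw [← matOp_mul]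
    congr 1
    ext1 i j
    change A.val (∑ k, X i k * Y k j) = ∑ k, A.val (X i k) * A.val (Y k j)
    exact map_sum (AddMonoidHom.mk' A.val fun _ _ => rfl) _ _

theorem toOp_apply (n : ℕ) (X : (A.tilde p).Mat n) : A.toOp p n X = matOp p (X.map A.val) := rfl

theorem toOp_injective (n : ℕ) : Function.Injective (A.toOp p n) := by
  intro X Y h
  ext i j
  apply A.val_injective
  have := congrArg (opEntry p i j) h
  rwa [toOp_apply, toOp_apply, opEntry_matOp, opEntry_matOp] at this

/-- The norm is pulled back along the faithful representation on ℓ_p^n(E), so it agrees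
definitionally with `nrm`, and normed-ring estimates apply directly to the quantitative predicates.
The ring unit acts through `A.unit`, which need not be the identity operator. -/
noncomputable instance matNormedRing (n : ℕ) : NormedRing ((A.tilde p).Mat n) :=
  NormedRing.induced _ _ (A.toOp p n) (A.toOp_injective p n)

theorem norm_def {n : ℕ} (X : (A.tilde p).Mat n) : ‖X‖ = (A.tilde p).nrm n X := rfl

theorem norm_toOp {n : ℕ} (X : (A.tilde p).Mat n) : ‖A.toOp p n X‖ = ‖X‖ := rfl

noncomputable instance matNormedAlgebra (n : ℕ) : NormedAlgebra ℂ ((A.tilde p).Mat n) where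
  norm_smul_le c X := by
    rw [← norm_toOp, ← norm_toOp, map_smul]
    exact norm_smul_le (α := ℂ) (β := PiLp p (fun _ : Fin n => E) →L[ℂ] PiLp p (fun _ : Fin n => E))
      c _

theorem isometry_toOp (n : ℕ) : Isometry (A.toOp p n) :=
  AddMonoidHomClass.isometry_of_norm _ (A.norm_toOp p)

/-- Belonging to the range is a condition on each matrix entry separately, entries depend
continuously on the operator, and Ã is closed. Completeness of M_n(Ã), on which all power series
below rest, follows. -/
theorem isClosed_range_toOp (n : ℕ) : IsClosed (Set.range (A.toOp p n)) := by
  have : Set.range (A.toOp p n) = ⋂ i, ⋂ j, opEntry p i j ⁻¹' (A.tildeAlg : Set (E →L[ℂ] E)) := by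
    ext T
    simp only [Set.mem_range, Set.mem_iInter, Set.mem_preimage]
    constructor
    · rintro ⟨X, rfl⟩ i j
      rw [toOp_apply, opEntry_matOp]
      exact (X i j).2
    · intro h
      refine ⟨Matrix.of fun i j => ⟨opEntry p i j T, h i j⟩, ?_⟩
      exact matOp_opEntry p T
  rw [this]
  exact isClosed_iInter fun i => isClosed_iInter fun j =>
    A.isClosed_tildeAlg.preimage (continuous_opEntry p i j)

instance matComplete [CompleteSpace E] (n : ℕ) : CompleteSpace ((A.tilde p).Mat n) :=
  (completeSpace_iff_isComplete_range (A.isometry_toOp p n).isUniformInducing).2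
    (A.isClosed_range_toOp p n).isComplete

theorem normCont_iff {n : ℕ} {γ : unitInterval → (A.tilde p).Mat n} :
    (A.tilde p).NormCont n γ ↔ Continuous γ := by
  rw [continuous_iff_continuousAt]
  have h : ∀ t, ContinuousAt γ t ↔ Filter.Tendsto (fun s => ‖γ s - γ t‖) (𝓝 t) (𝓝 0) := fun t =>
    tendsto_iff_norm_sub_tendsto_zero
  simp only [h]
  rfl

end OpAlg


/-! ### Block matrices -/

section Blocks

variable {R : Type u} {n m : ℕ}

/-- The block matrix `(a, b; c, d)`. -/
def blk [Zero R] (a b c d : Matrix (Fin n) (Fin n) R) : Matrix (Fin (n + n)) (Fin (n + n)) R :=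
  Matrix.reindex finSumFinEquiv finSumFinEquiv (Matrix.fromBlocks a b c d)

theorem bdiag_eq_blk [Zero R] (a d : Matrix (Fin n) (Fin n) R) : bdiag a d = blk a 0 0 d := rfl

theorem blk_map {R' : Type v} [Zero R] [Zero R'] (f : R → R') (a b c d : Matrix (Fin n) (Fin n) R) :
    (blk a b c d).map f = blk (a.map f) (b.map f) (c.map f) (d.map f) := by
  ext i j
  simp only [blk, Matrix.reindex_apply, Matrix.map_apply, Matrix.submatrix_apply]
  rcases finSumFinEquiv.symm i with a | a <;> rcases finSumFinEquiv.symm j with b | b <;> simp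

theorem blk_forall [Zero R] {P : R → Prop} {a b c d : Matrix (Fin n) (Fin n) R}
    (ha : ∀ i j, P (a i j)) (hb : ∀ i j, P (b i j)) (hc : ∀ i j, P (c i j))
    (hd : ∀ i j, P (d i j)) (i j : Fin (n + n)) : P (blk a b c d i j) := by
  simp only [blk, Matrix.reindex_apply, Matrix.submatrix_apply]
  rcases finSumFinEquiv.symm i with k | k <;> rcases finSumFinEquiv.symm j with l | l
  · exact ha _ _
  · exact hb _ _
  · exact hc _ _
  · exact hd _ _

theorem bdiag_forall [Zero R] {P : R → Prop} {a : Matrix (Fin n) (Fin n) R}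
    {d : Matrix (Fin m) (Fin m) R} (h0 : P 0)
    (ha : ∀ i j, P (a i j)) (hd : ∀ i j, P (d i j)) (i j : Fin (n + m)) : P (bdiag a d i j) := by
  simp only [bdiag, Matrix.reindex_apply, Matrix.submatrix_apply]
  rcases finSumFinEquiv.symm i with k | k <;> rcases finSumFinEquiv.symm j with l | l
  · exact ha _ _
  · exact h0
  · exact h0
  · exact hd _ _

theorem blk_add [AddZeroClass R] (a b c d a' b' c' d' : Matrix (Fin n) (Fin n) R) :
    blk a b c d + blk a' b' c' d' = blk (a + a') (b + b') (c + c') (d + d') := by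
  simp only [blk, ← Matrix.fromBlocks_add]
  rfl

theorem blk_sub [AddGroup R] (a b c d a' b' c' d' : Matrix (Fin n) (Fin n) R) :
    blk a b c d - blk a' b' c' d' = blk (a - a') (b - b') (c - c') (d - d') := by
  ext i j
  simp only [blk, Matrix.reindex_apply, Matrix.sub_apply, Matrix.submatrix_apply]
  rcases finSumFinEquiv.symm i with a | a <;> rcases finSumFinEquiv.symm j with b | b <;> simp

theorem blk_smul {S : Type v} [MonoidWithZero S] [AddMonoid R] [DistribMulAction S R] (s : S)
    (a b c d : Matrix (Fin n) (Fin n) R) :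
    s • blk a b c d = blk (s • a) (s • b) (s • c) (s • d) := by
  ext i j
  simp only [blk, Matrix.reindex_apply, Matrix.smul_apply, Matrix.submatrix_apply]
  rcases finSumFinEquiv.symm i with a | a <;> rcases finSumFinEquiv.symm j with b | b <;> simp

theorem blk_mul [NonUnitalNonAssocSemiring R] (a b c d a' b' c' d' : Matrix (Fin n) (Fin n) R) :
    blk a b c d * blk a' b' c' d' =
      blk (a * a' + b * c') (a * b' + b * d') (c * a' + d * c') (c * b' + d * d') := by
  simp only [blk, Matrix.reindex_apply, Matrix.submatrix_mul_equiv, Matrix.fromBlocks_multiply]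

theorem blk_one [Zero R] [One R] : blk (1 : Matrix (Fin n) (Fin n) R) 0 0 1 = 1 := by
  simp [blk, Matrix.fromBlocks_one]

theorem bdiag_mul [NonUnitalNonAssocSemiring R] (a a' : Matrix (Fin n) (Fin n) R)
    (d d' : Matrix (Fin m) (Fin m) R) : bdiag a d * bdiag a' d' = bdiag (a * a') (d * d') := by
  simp [bdiag, Matrix.reindex_apply, Matrix.submatrix_mul_equiv, Matrix.fromBlocks_multiply]

theorem bdiag_add [AddZeroClass R] (a a' : Matrix (Fin n) (Fin n) R)
    (d d' : Matrix (Fin m) (Fin m) R) : bdiag a d + bdiag a' d' = bdiag (a + a') (d + d') := by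
  ext i j
  simp only [bdiag, Matrix.reindex_apply, Matrix.add_apply, Matrix.submatrix_apply]
  rcases finSumFinEquiv.symm i with a | a <;> rcases finSumFinEquiv.symm j with b | b <;> simp

theorem bdiag_sub [AddGroup R] (a a' : Matrix (Fin n) (Fin n) R)
    (d d' : Matrix (Fin m) (Fin m) R) : bdiag a d - bdiag a' d' = bdiag (a - a') (d - d') := by
  ext i j
  simp only [bdiag, Matrix.reindex_apply, Matrix.sub_apply, Matrix.submatrix_apply]
  rcases finSumFinEquiv.symm i with a | a <;> rcases finSumFinEquiv.symm j with b | b <;> simp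

theorem bdiag_one [Zero R] [One R] :
    bdiag (1 : Matrix (Fin n) (Fin n) R) (1 : Matrix (Fin m) (Fin m) R) = 1 := by
  simp [bdiag, Matrix.fromBlocks_one]

theorem bdiag_zero [Zero R] :
    bdiag (0 : Matrix (Fin n) (Fin n) R) (0 : Matrix (Fin m) (Fin m) R) = 0 := by
  simp [bdiag, Matrix.fromBlocks_zero]

theorem cornerProj_mul_self [Semiring R] : cornerProj R n * cornerProj R n = cornerProj R n := by
  simp [cornerProj, bdiag_mul]

theorem cornerProj_map {R' : Type v} [Zero R] [One R] [Zero R'] [One R'] (f : R → R')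
    (h0 : f 0 = 0) (h1 : f 1 = 1) : (cornerProj R n).map f = cornerProj R' n := by
  rw [cornerProj, bdiag_map f h0, Matrix.map_one f h0 h1, Matrix.map_zero f h0]
  rfl

/-- The exchange of the two halves of the index set. -/
def halfSwap (n : ℕ) : Fin (n + n) ≃ Fin (n + n) :=
  (finSumFinEquiv.symm.trans (Equiv.sumComm _ _)).trans finSumFinEquiv

theorem blk_eq [AddZeroClass R] (a b c d : Matrix (Fin n) (Fin n) R) :
    blk a b c d = bdiag a d + (bdiag b c).submatrix (Equiv.refl _) (halfSwap n) := by
  ext i j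
  simp only [blk, bdiag, Matrix.reindex_apply, Matrix.add_apply, Matrix.submatrix_apply, halfSwap]
  simp only [Equiv.trans_apply, Equiv.symm_apply_apply, Equiv.refl_apply]
  rcases finSumFinEquiv.symm i with a | a <;> rcases finSumFinEquiv.symm j with b | b <;> simp

end Blocks

/-! ### Norms of permuted matrices and block matrices on ℓ_p^n(E) -/

section BlockNorms

variable {E : Type u} [NormedAddCommGroup E] [NormedSpace ℂ E] (p : ℝ≥0∞) [Fact (1 ≤ p)]

theorem piLp_norm_comp_equiv {a b : ℕ} (σ : Fin a ≃ Fin b) (x : PiLp p (fun _ : Fin b => E)) :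
    ‖(WithLp.toLp p fun i => x (σ i) : PiLp p (fun _ : Fin a => E))‖ = ‖x‖ :=
  (LinearIsometryEquiv.piLpCongrLeft p ℂ E σ.symm).norm_map x

theorem norm_matOp_submatrix_le {a b : ℕ} (σ τ : Fin a ≃ Fin b)
    (X : Matrix (Fin b) (Fin b) (E →L[ℂ] E)) : ‖matOp p (X.submatrix σ τ)‖ ≤ ‖matOp p X‖ := by
  refine ContinuousLinearMap.opNorm_le_bound _ (norm_nonneg _) fun x => ?_
  have h : matOp p (X.submatrix σ τ) x =
      WithLp.toLp p fun i => matOp p X (WithLp.toLp p fun i => x (τ.symm i)) (σ i) := by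
    ext i
    simp only [matOp_apply, Matrix.submatrix_apply]
    rw [← τ.sum_comp]
    simp
  rw [h, piLp_norm_comp_equiv, ← piLp_norm_comp_equiv p τ.symm x]
  exact ContinuousLinearMap.le_opNorm _ _

/-- For finite p the p-th power of the norm is the sum over the two halves, and for p = ∞ the norm
is their maximum; either way a common constant c survives. -/
theorem piLp_norm_le_of_halves {E : Type*} [NormedAddCommGroup E] {m n : ℕ} {c : ℝ} (hc : 0 ≤ c)
    (x y : PiLp p (fun _ : Fin (m + n) => E))
    (h₁ : ‖(WithLp.toLp p fun i => x (Fin.castAdd n i) : PiLp p (fun _ : Fin m => E))‖ ≤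
      c * ‖(WithLp.toLp p fun i => y (Fin.castAdd n i) : PiLp p (fun _ : Fin m => E))‖)
    (h₂ : ‖(WithLp.toLp p fun i => x (Fin.natAdd m i) : PiLp p (fun _ : Fin n => E))‖ ≤
      c * ‖(WithLp.toLp p fun i => y (Fin.natAdd m i) : PiLp p (fun _ : Fin n => E))‖) :
    ‖x‖ ≤ c * ‖y‖ := by
  by_cases hp : p = ∞
  · subst hp
    have hy₁ : ‖(WithLp.toLp ∞ fun i => y (Fin.castAdd n i) : PiLp ∞ (fun _ : Fin m => E))‖ ≤
        ‖y‖ := by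
      rw [PiLp.norm_eq_ciSup]
      exact Real.iSup_le (fun i => PiLp.norm_apply_le y _) (norm_nonneg _)
    have hy₂ : ‖(WithLp.toLp ∞ fun i => y (Fin.natAdd m i) : PiLp ∞ (fun _ : Fin n => E))‖ ≤
        ‖y‖ := by
      rw [PiLp.norm_eq_ciSup]
      exact Real.iSup_le (fun i => PiLp.norm_apply_le y _) (norm_nonneg _)
    rw [PiLp.norm_eq_ciSup x]
    refine Real.iSup_le (fun i => ?_) (by positivity)
    refine Fin.addCases (fun k => ?_) (fun k => ?_) i
    · refine le_trans ?_ (h₁.trans (mul_le_mul_of_nonneg_left hy₁ hc))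
      exact PiLp.norm_apply_le
        (WithLp.toLp ∞ fun i => x (Fin.castAdd n i) : PiLp ∞ (fun _ : Fin m => E)) k
    · refine le_trans ?_ (h₂.trans (mul_le_mul_of_nonneg_left hy₂ hc))
      exact PiLp.norm_apply_le
        (WithLp.toLp ∞ fun i => x (Fin.natAdd m i) : PiLp ∞ (fun _ : Fin n => E)) k
  · have hp0 : 0 < p.toReal := p.toReal_pos_iff_ne_top.2 hp
    have key : ∀ z : PiLp p (fun _ : Fin (m + n) => E), ‖z‖ ^ p.toReal =
        ‖(WithLp.toLp p fun i => z (Fin.castAdd n i) : PiLp p (fun _ : Fin m => E))‖ ^ p.toReal +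
        ‖(WithLp.toLp p fun i => z (Fin.natAdd m i) : PiLp p (fun _ : Fin n => E))‖ ^ p.toReal := by
      intro z
      have hs : ∀ {k : ℕ} (z : PiLp p (fun _ : Fin k => E)),
          ‖z‖ ^ p.toReal = ∑ i, ‖z i‖ ^ p.toReal := by
        intro k z
        rw [PiLp.norm_eq_sum hp0, ← Real.rpow_mul (by positivity), one_div,
          inv_mul_cancel₀ hp0.ne', Real.rpow_one]
      rw [hs, hs, hs, Fin.sum_univ_add]
    rw [← Real.rpow_le_rpow_iff (norm_nonneg _) (by positivity) hp0,
      Real.mul_rpow hc (norm_nonneg _), key, key, mul_add, ← Real.mul_rpow hc (norm_nonneg _),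
      ← Real.mul_rpow hc (norm_nonneg _)]
    gcongr

theorem norm_matOp_bdiag_le {m n : ℕ} (X : Matrix (Fin m) (Fin m) (E →L[ℂ] E))
    (Y : Matrix (Fin n) (Fin n) (E →L[ℂ] E)) :
    ‖matOp p (bdiag X Y)‖ ≤ max ‖matOp p X‖ ‖matOp p Y‖ := by
  refine ContinuousLinearMap.opNorm_le_bound _ (by positivity) fun x => ?_
  have h₁ : (WithLp.toLp p fun i => matOp p (bdiag X Y) x (Fin.castAdd n i) :
      PiLp p (fun _ : Fin m => E)) = matOp p X (WithLp.toLp p fun i => x (Fin.castAdd n i)) := by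
    ext i
    simp [matOp_apply, Fin.sum_univ_add, bdiag]
  have h₂ : (WithLp.toLp p fun i => matOp p (bdiag X Y) x (Fin.natAdd m i) :
      PiLp p (fun _ : Fin n => E)) = matOp p Y (WithLp.toLp p fun i => x (Fin.natAdd m i)) := by
    ext i
    simp [matOp_apply, Fin.sum_univ_add, bdiag]
  refine piLp_norm_le_of_halves p (by positivity) _ _ ?_ ?_
  · rw [h₁]
    refine (ContinuousLinearMap.le_opNorm _ _).trans ?_
    gcongr
    exact le_max_left _ _
  · rw [h₂]
    refine (ContinuousLinearMap.le_opNorm _ _).trans ?_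
    gcongr
    exact le_max_right _ _

namespace OpAlg

variable (A : OpAlg E)

theorem norm_submatrix_le {a b : ℕ} (σ τ : Fin a ≃ Fin b) (X : (A.tilde p).Mat b) :
    ‖(X.submatrix σ τ : (A.tilde p).Mat a)‖ ≤ ‖X‖ :=
  norm_matOp_submatrix_le p σ τ (X.map A.val)

theorem norm_bdiag_le {m n : ℕ} (X : (A.tilde p).Mat m) (Y : (A.tilde p).Mat n) :
    ‖(bdiag X Y : (A.tilde p).Mat (m + n))‖ ≤ max ‖X‖ ‖Y‖ := by
  have h : (bdiag X Y).map A.val = bdiag (X.map A.val) (Y.map A.val) :=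
    bdiag_map (R := (A.tilde p).carrier) A.val rfl X Y
  exact (congrArg (fun T : Matrix _ _ (E →L[ℂ] E) => ‖matOp p T‖) h).trans_le (norm_matOp_bdiag_le p _ _)

/-- The matrix splits into its diagonal and off-diagonal parts, and exchanging the two halves of the
columns makes the off-diagonal part block diagonal without increasing its norm. -/
theorem norm_blk_le {n : ℕ} (a b c d : (A.tilde p).Mat n) :
    ‖(blk a b c d : (A.tilde p).Mat (n + n))‖ ≤ max ‖a‖ ‖d‖ + max ‖b‖ ‖c‖ := by
  rw [blk_eq]
  refine (norm_add_le _ _).trans (add_le_add (A.norm_bdiag_le p a d) ?_)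
  exact (A.norm_submatrix_le p _ _ _).trans (A.norm_bdiag_le p b c)

theorem norm_one_le (h : ‖A.unit‖ ≤ 1) (n : ℕ) : ‖(1 : (A.tilde p).Mat n)‖ ≤ 1 := by
  refine ContinuousLinearMap.opNorm_le_bound _ zero_le_one fun x => ?_
  rw [one_mul]
  refine piLp_norm_mono p _ _ fun i => ?_
  rw [toOp_apply, matOp_apply, Finset.sum_eq_single i]
  · change ‖A.val ((1 : Matrix (Fin n) (Fin n) A.Tilde) i i) (x i)‖ ≤ _
    rw [Matrix.one_apply_eq, A.val_one]
    exact (A.unit.le_opNorm _).trans (mul_le_of_le_one_left (norm_nonneg _) h)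
  · intro j _ hj
    change A.val ((1 : Matrix (Fin n) (Fin n) A.Tilde) i j) (x j) = 0
    rw [Matrix.one_apply_ne hj.symm, A.val_zero]
    rfl
  · simp

end OpAlg

end BlockNorms


/-! ### The spectral idempotent of a quasi-idempotent in a Banach algebra -/

section Spectral

variable {R : Type u} [NormedRing R] [NormedAlgebra ℂ R]

theorem catalan_le_four_pow (n : ℕ) : catalan n ≤ 4 ^ n := by
  rw [catalan_eq_centralBinom_div]
  exact (Nat.div_le_self _ _).trans n.centralBinom_le_four_pow

/-- The solution `η = ∑ C_n x^{n+1}` of `η - η² = x`, where `C_n` are the Catalan numbers. -/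
noncomputable def catalanSum (x : R) : R := ∑' n : ℕ, (catalan n : ℂ) • x ^ (n + 1)

theorem norm_catalan_smul_le {q : ℝ} {x : R} (hx : ‖x‖ ≤ q) (n : ℕ) :
    ‖(catalan n : ℂ) • x ^ (n + 1)‖ ≤ q * (4 * q) ^ n := by
  have hq : 0 ≤ q := (norm_nonneg _).trans hx
  rw [norm_smul, Complex.norm_natCast]
  calc (catalan n : ℝ) * ‖x ^ (n + 1)‖ ≤ 4 ^ n * ‖x‖ ^ (n + 1) := by
        gcongr
        · exact_mod_cast catalan_le_four_pow n
        · exact norm_pow_le' x n.succ_pos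
    _ ≤ 4 ^ n * q ^ (n + 1) := by gcongr
    _ = _ := by ring

theorem summable_geometric_bound {q : ℝ} (hq : 0 ≤ q) (h : q < 1 / 4) :
    Summable fun n : ℕ => q * (4 * q) ^ n :=
  (summable_geometric_of_lt_one (by linarith) (by linarith)).mul_left _

theorem summable_norm_catalan {x : R} (hx : ‖x‖ < 1 / 4) :
    Summable fun n : ℕ => ‖(catalan n : ℂ) • x ^ (n + 1)‖ :=
  Summable.of_nonneg_of_le (fun _ => norm_nonneg _) (norm_catalan_smul_le le_rfl)
    (summable_geometric_bound (norm_nonneg _) hx)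

theorem norm_catalanSum_le {x : R} (hx : ‖x‖ < 1 / 4) :
    ‖catalanSum x‖ ≤ ‖x‖ / (1 - 4 * ‖x‖) := by
  have h := tsum_of_norm_bounded
    (((hasSum_geometric_of_lt_one (r := 4 * ‖x‖) (by positivity) (by linarith)).mul_left ‖x‖))
    (norm_catalan_smul_le (le_refl ‖x‖))
  exact h.trans_eq (div_eq_mul_inv _ _).symm

theorem catalanSum_zero : catalanSum (0 : R) = 0 := by
  simp [catalanSum]

theorem Commute.catalanSum_right {a x : R} (h : Commute a x) : Commute a (catalanSum x) :=
  Commute.tsum_right a fun n => ((h.pow_right (n + 1)).smul_right (catalan n : ℂ))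

/-- The square root `(1 - 4x)^{1/2}`. -/
noncomputable def sqrtSeries (x : R) : R := 1 - (2 : ℂ) • catalanSum x

/-- The spectral idempotent of a quasi-idempotent `e`, for the part of the spectrum near `1`. -/
noncomputable def spectralIdem (e : R) : R :=
  -- With y = 2e - 1 one has y² = 1 - 4(e - e²), so y (y²)^{-1/2} is an involution near y, and half
  -- of 1 plus it is an idempotent.
  (1 / 2 : ℂ) • (1 + ((2 : ℂ) • e - 1) * Ring.inverse (sqrtSeries (e - e * e)))

theorem commute_sqrtSeries {a x : R} (h : Commute a x) : Commute a (sqrtSeries x) :=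
  (Commute.one_right a).sub_right ((Commute.catalanSum_right h).smul_right (2 : ℂ))

theorem commute_inverse {R : Type*} [Ring R] {a x : R} (h : Commute a x) (hx : IsUnit x) :
    Commute a (Ring.inverse x) := by
  obtain ⟨y, rfl⟩ := hx
  rw [Ring.inverse_unit]
  exact h.units_inv_right

theorem commute_self_sub {R : Type*} [Ring R] (e : R) : Commute e (e - e * e) :=
  (Commute.refl e).sub_right ((Commute.refl e).mul_right (Commute.refl e))

theorem spectralIdem_of_idem {e : R} (h : e * e = e) : spectralIdem e = e := by
  simp only [spectralIdem, h, sub_self, sqrtSeries, catalanSum_zero, smul_zero, sub_zero,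
    Ring.inverse_one, mul_one]
  module

variable [CompleteSpace R]

/-- The convolution recursion of the Catalan numbers says that the square of the series is the
series without its first term x. -/
theorem catalanSum_sub_sq {x : R} (hx : ‖x‖ < 1 / 4) :
    catalanSum x - catalanSum x * catalanSum x = x := by
  have hs := summable_norm_catalan hx
  have h1 : catalanSum x * catalanSum x = ∑' n : ℕ, (catalan (n + 1) : ℂ) • x ^ (n + 2) := by
    rw [catalanSum, tsum_mul_tsum_eq_tsum_sum_antidiagonal_of_summable_norm hs hs]
    refine tsum_congr fun n => ?_
    rw [catalan_succ', Nat.cast_sum, Finset.sum_smul]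
    refine Finset.sum_congr rfl fun kl hkl => ?_
    rw [smul_mul_smul_comm, ← pow_add, ← Finset.HasAntidiagonal.mem_antidiagonal.1 hkl]
    push_cast
    congr 2
    ring
  have h2 : catalanSum x = x + ∑' n : ℕ, (catalan (n + 1) : ℂ) • x ^ (n + 2) := by
    rw [catalanSum, hs.of_norm.tsum_eq_zero_add]
    simp
  rw [h1]
  nth_rewrite 1 [h2]
  abel

theorem continuousOn_catalanSum {q : ℝ} (hq : q < 1 / 4) :
    ContinuousOn (catalanSum : R → R) {x | ‖x‖ ≤ q} := by
  rcases lt_or_ge q 0 with h0 | h0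
  · intro x hx
    exact absurd ((norm_nonneg x).trans hx) (not_le.2 h0)
  · exact continuousOn_tsum (fun n => by fun_prop) (summable_geometric_bound h0 hq)
      fun n x hx => norm_catalan_smul_le hx n

theorem sqrtSeries_mul_self {x : R} (hx : ‖x‖ < 1 / 4) :
    sqrtSeries x * sqrtSeries x = 1 - (4 : ℂ) • x := by
  have h := catalanSum_sub_sq hx
  nth_rewrite 3 [← h]
  simp only [sqrtSeries, sub_mul, mul_sub, one_mul, mul_one, smul_mul_smul_comm]
  module

/-- Its square 1 - 4x is invertible by the Neumann series, and a root of a unit is a unit. -/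
theorem isUnit_sqrtSeries {x : R} (hx : ‖x‖ < 1 / 4) : IsUnit (sqrtSeries x) := by
  have h : IsUnit (sqrtSeries x ^ 2) := by
    rw [pow_two, sqrtSeries_mul_self hx]
    refine isUnit_one_sub_of_norm_lt_one ?_
    rw [norm_smul]
    norm_num
    linarith
  exact (isUnit_pow_iff two_ne_zero).1 h

/-- Everything commutes with e, and (2e - 1)² = 1 - 4x cancels the square of the inverse root; so
(2e - 1)s squares to 1. -/
theorem spectralIdem_mul_self {e : R} (h : ‖e * e - e‖ < 1 / 4) :
    spectralIdem e * spectralIdem e = spectralIdem e := by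
  rw [norm_sub_rev] at h
  set x := e - e * e with hx
  set s := Ring.inverse (sqrtSeries x) with hs
  have hu := isUnit_sqrtSeries h
  have hc : Commute e s := commute_inverse (commute_sqrtSeries (commute_self_sub e)) hu
  have hss : s * s * (1 - (4 : ℂ) • x) = 1 := by
    rw [← sqrtSeries_mul_self h, mul_assoc, ← mul_assoc s (sqrtSeries x),
      Ring.inverse_mul_cancel _ hu, one_mul, Ring.inverse_mul_cancel _ hu]
  have hcy : Commute ((2 : ℂ) • e - 1) s :=
    (hc.smul_left (2 : ℂ)).sub_left (Commute.one_left s)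
  have hy : (((2 : ℂ) • e - 1) * s) * (((2 : ℂ) • e - 1) * s) = 1 := by
    rw [hcy.symm.mul_mul_mul_comm]
    have hyy : ((2 : ℂ) • e - 1) * ((2 : ℂ) • e - 1) = 1 - (4 : ℂ) • x := by
      simp only [hx, sub_mul, mul_sub, one_mul, mul_one, smul_mul_smul_comm]
      module
    rw [hyy]
    have hc2 : Commute (1 - (4 : ℂ) • x) (s * s) := by
      rw [← hyy]
      exact (hcy.mul_right hcy).mul_left (hcy.mul_right hcy)
    rw [hc2.eq, hss]
  have : spectralIdem e = (1 / 2 : ℂ) • (1 + ((2 : ℂ) • e - 1) * s) := rfl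
  rw [this, smul_mul_smul_comm, add_mul]
  simp only [one_mul, mul_one, mul_add, hy]
  module

theorem continuous_spectralIdem {X : Type*} [TopologicalSpace X] {γ : X → R} (hγ : Continuous γ)
    {q : ℝ} (hq : q < 1 / 4) (h : ∀ t, ‖γ t * γ t - γ t‖ ≤ q) :
    Continuous fun t => spectralIdem (γ t) := by
  have h' : ∀ t, ‖γ t - γ t * γ t‖ ≤ q := fun t => by rw [norm_sub_rev]; exact h t
  have h1 : Continuous fun t => catalanSum (γ t - γ t * γ t) :=
    (continuousOn_catalanSum hq).comp_continuous (by fun_prop) h'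
  have h2 : Continuous fun t => Ring.inverse (sqrtSeries (γ t - γ t * γ t)) := by
    rw [continuous_iff_continuousAt]
    intro t
    obtain ⟨y, hy⟩ := isUnit_sqrtSeries ((h' t).trans_lt hq)
    have hi := NormedRing.inverse_continuousAt y
    rw [hy] at hi
    refine ContinuousAt.comp (f := fun t => sqrtSeries (γ t - γ t * γ t)) hi ?_
    exact continuousAt_const.sub (h1.continuousAt.const_smul (2 : ℂ))
  unfold spectralIdem
  fun_prop

/-- The spectral idempotent is preserved by continuous homomorphisms that need not be unital. -/
theorem map_spectralIdem {R' : Type v} [NormedRing R'] [NormedAlgebra ℂ R'] [CompleteSpace R']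
    (θ : R →ₙₐ[ℂ] R') (hθ : Continuous θ) (hn : ∀ x, ‖θ x‖ ≤ ‖x‖) {e : R}
    (h : ‖e * e - e‖ < 1 / 4) : θ (spectralIdem e) = spectralIdem (θ e) := by
  rw [norm_sub_rev] at h
  set x := e - e * e with hx
  have hx' : θ e - θ e * θ e = θ x := by rw [hx, map_sub, map_mul]
  have h' : ‖θ x‖ < 1 / 4 := (hn x).trans_lt h
  have hcat : θ (catalanSum x) = catalanSum (θ x) := by
    have hpow : ∀ n : ℕ, θ (x ^ (n + 1)) = θ x ^ (n + 1) := by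
      intro n
      induction n with
      | zero => simp
      | succ n ih => rw [pow_succ, map_mul, ih, pow_succ (θ x) (n + 1)]
    have := (summable_norm_catalan h).of_norm.map_tsum θ hθ
    rw [catalanSum, catalanSum, this]
    exact tsum_congr fun n => by rw [map_smul, hpow]
  set s := Ring.inverse (sqrtSeries x) with hs
  set s' := Ring.inverse (sqrtSeries (θ x)) with hs'
  have hu := isUnit_sqrtSeries h
  have hu' := isUnit_sqrtSeries h'
  -- Since θ may fail to preserve 1, the inverse root s cannot be transported directly. The element
  -- s - 1 satisfies an equation in which the unit does not occur, and that equation determines it.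
  have hg : θ (s - 1) = s' - 1 := by
    have h1 : sqrtSeries x * s = 1 := Ring.mul_inverse_cancel _ hu
    have h2 : (s - 1) - (2 : ℂ) • catalanSum x - (2 : ℂ) • (catalanSum x * (s - 1)) = 0 := by
      rw [sqrtSeries, sub_mul, one_mul, smul_mul_assoc] at h1
      rw [mul_sub, mul_one, ← sub_eq_zero.2 h1]
      module
    have h3 := congrArg θ h2
    rw [map_sub, map_sub, map_smul, map_smul, map_mul, hcat, map_zero] at h3
    have h4 : sqrtSeries (θ x) * (1 + θ (s - 1)) = 1 := by
      rw [← sub_eq_zero, ← h3, sqrtSeries, sub_mul, mul_add, mul_add, smul_mul_assoc,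
        smul_mul_assoc, mul_one, mul_one, one_mul]
      abel
    have h5 : s' * (sqrtSeries (θ x) * (1 + θ (s - 1))) = s' * 1 := by rw [h4]
    rw [← mul_assoc, Ring.inverse_mul_cancel _ hu', one_mul, mul_one] at h5
    rw [← h5]
    abel
  have e1 : spectralIdem e = e + e * (s - 1) - (1 / 2 : ℂ) • (s - 1) := by
    have : spectralIdem e = (1 / 2 : ℂ) • (1 + ((2 : ℂ) • e - 1) * s) := rfl
    rw [this, sub_mul, mul_sub, smul_mul_assoc]
    simp only [one_mul, mul_one]
    module
  have e2 : spectralIdem (θ e) = θ e + θ e * (s' - 1) - (1 / 2 : ℂ) • (s' - 1) := by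
    have : spectralIdem (θ e) = (1 / 2 : ℂ) • (1 + ((2 : ℂ) • θ e - 1) * s') := by
      rw [spectralIdem, hx']
    rw [this, sub_mul, mul_sub, smul_mul_assoc]
    simp only [one_mul, mul_one]
    module
  rw [e1, e2, map_sub, map_add, map_mul, map_smul, hg]

/-! ### The Riesz integral of a quasi-idempotent -/

theorem differentiableAt_resolvent {a : R} {z : ℂ} (h : IsUnit (z • (1 : R) - a)) :
    DifferentiableAt ℂ (fun z : ℂ => Ring.inverse (z • (1 : R) - a)) z :=
  DifferentiableAt.comp z (f := fun z : ℂ => z • (1 : R) - a) (differentiableAt_inverse (𝕜 := ℂ) h)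
    (by fun_prop)

theorem circleIntegral_resolvent_eq_zero {a : R} {c : ℂ} {ρ : ℝ} (hρ : 0 ≤ ρ)
    (h : ∀ z ∈ Metric.closedBall c ρ, IsUnit (z • (1 : R) - a)) :
    ∮ z in C(c, ρ), Ring.inverse (z • (1 : R) - a) = 0 :=
  Complex.circleIntegral_eq_zero_of_differentiable_on_off_countable hρ Set.countable_empty
    (fun z hz => (differentiableAt_resolvent (h z hz)).continuousAt.continuousWithinAt)
    fun z hz => differentiableAt_resolvent (h z (Metric.ball_subset_closedBall hz.1))

theorem isUnit_smul_one_sub {a : R} {z : ℂ} (h : ‖a‖ < ‖z‖) : IsUnit (z • (1 : R) - a) := by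
  have hz : z ≠ 0 := norm_pos_iff.1 ((norm_nonneg a).trans_lt h)
  have h1 : IsUnit (1 - z⁻¹ • a) := by
    refine isUnit_one_sub_of_norm_lt_one ?_
    rw [norm_smul, norm_inv, inv_mul_lt_iff₀ (norm_pos_iff.2 hz), mul_one]
    exact h
  have h2 : z • (1 : R) - a = (Units.mk0 z hz) • (1 - z⁻¹ • a) := by
    rw [Units.smul_def, Units.val_mk0, smul_sub, smul_smul, mul_inv_cancel₀ hz, one_smul]
  rw [h2]
  exact h1.smul _

/-- With b = a - c, iterating G(z) = (z - c)⁻¹(1 + bG(z)) expresses the integral as 2πi plus a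
remainder. The remainder is the same at every later stage, because higher negative powers of z - c
integrate to zero, and it is bounded by a multiple of (‖b‖/ρ)^{k+1}; hence it vanishes. -/
theorem circleIntegral_resolvent_center {a : R} {c : ℂ} {ρ : ℝ} (h : ‖a - c • (1 : R)‖ < ρ) :
    ∮ z in C(c, ρ), Ring.inverse (z • (1 : R) - a) = (2 * Real.pi * Complex.I : ℂ) • (1 : R) := by
  have hρ : 0 < ρ := (norm_nonneg _).trans_lt h
  set b := a - c • (1 : R) with hb
  set G : ℂ → R := fun z => Ring.inverse (z • (1 : R) - a) with hG
  have hsub : ∀ z : ℂ, z • (1 : R) - a = (z - c) • (1 : R) - b := fun z => by rw [hb]; module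
  have hu : ∀ z ∈ Metric.sphere c ρ, IsUnit (z • (1 : R) - a) := by
    intro z hz
    rw [hsub]
    refine isUnit_smul_one_sub ?_
    rwa [mem_sphere_iff_norm.1 hz]
  have hGc : ContinuousOn G (Metric.sphere c ρ) := fun z hz =>
    (differentiableAt_resolvent (hu z hz)).continuousAt.continuousWithinAt
  have hne : ∀ z ∈ Metric.sphere c ρ, z - c ≠ 0 := by
    intro z hz h0
    have := mem_sphere_iff_norm.1 hz
    rw [h0, norm_zero] at this
    exact hρ.ne this
  have hic : ∀ k : ℕ, ContinuousOn (fun z : ℂ => ((z - c)⁻¹) ^ k) (Metric.sphere c ρ) := fun k =>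
    ((continuousOn_id.sub continuousOn_const).inv₀ hne).pow k
  have hrec : ∀ z ∈ Metric.sphere c ρ, G z = (z - c)⁻¹ • (1 + b * G z) := by
    intro z hz
    have h1 : (z - c) • G z - b * G z = 1 := by
      rw [← one_mul (G z), ← smul_mul_assoc, ← mul_assoc, mul_one, ← sub_mul, ← hsub]
      exact Ring.mul_inverse_cancel _ (hu z hz)
    rw [← h1, sub_add_cancel, smul_smul, inv_mul_cancel₀ (hne z hz), one_smul]
  set J : ℕ → R := fun k => ∮ z in C(c, ρ), ((z - c)⁻¹) ^ k • (b ^ k * G z) with hJ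
  have hJi : ∀ k, CircleIntegrable (fun z => ((z - c)⁻¹) ^ k • (b ^ k * G z)) c ρ := fun k =>
    ((hic k).smul (continuousOn_const.mul hGc)).circleIntegrable hρ.le
  have hdiff : ∀ k, J k - J (k + 1) = (∮ z in C(c, ρ), ((z - c)⁻¹) ^ (k + 1)) • b ^ k := by
    intro k
    change (∮ z in C(c, ρ), _) - (∮ z in C(c, ρ), _) = _
    rw [← circleIntegral.integral_sub (hJi k) (hJi (k + 1)), ← circleIntegral.integral_smul_const]
    refine circleIntegral.integral_congr hρ.le fun z hz => ?_
    nth_rewrite 1 [hrec z hz]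
    rw [mul_smul_comm, smul_smul, ← pow_succ, ← smul_sub, mul_add, mul_one, pow_succ b,
      mul_assoc (b ^ k), add_sub_cancel_right]
  have h0 : J 0 - J 1 = (2 * Real.pi * Complex.I : ℂ) • (1 : R) := by
    rw [hdiff 0]
    simp only [zero_add, pow_one, pow_zero]
    rw [circleIntegral.integral_sub_center_inv c hρ.ne']
  have hk : ∀ k, J (k + 1) = J 1 := by
    intro k
    induction k with
    | zero => rfl
    | succ k ih =>
      rw [← ih, eq_comm, ← sub_eq_zero, hdiff (k + 1)]
      have : (∮ z in C(c, ρ), ((z - c)⁻¹) ^ (k + 1 + 1)) = 0 := by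
        rw [← circleIntegral.integral_sub_zpow_of_ne (n := -((k + 2 : ℕ) : ℤ)) (by omega) c c ρ]
        refine circleIntegral.integral_congr hρ.le fun z _ => ?_
        change ((z - c)⁻¹) ^ (k + 2) = (z - c) ^ (-((k + 2 : ℕ) : ℤ))
        rw [zpow_neg, zpow_natCast, inv_pow]
      rw [this, zero_smul]
  obtain ⟨B, hB⟩ := (isCompact_sphere c ρ).exists_bound_of_continuousOn hGc
  have hJ1 : J 1 = 0 := by
    have hle : ∀ k, ‖J 1‖ ≤ 2 * Real.pi * ρ * B * (‖b‖ / ρ) ^ (k + 1) := by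
      intro k
      rw [← hk k]
      refine (circleIntegral.norm_integral_le_of_norm_le_const hρ.le
        (C := (‖b‖ / ρ) ^ (k + 1) * B) fun z hz => ?_).trans_eq (by ring)
      rw [norm_smul, norm_pow, norm_inv, mem_sphere_iff_norm.1 hz, div_pow, inv_pow]
      calc (ρ ^ (k + 1))⁻¹ * ‖b ^ (k + 1) * G z‖
          ≤ (ρ ^ (k + 1))⁻¹ * (‖b‖ ^ (k + 1) * B) := by
            gcongr
            refine (norm_mul_le _ _).trans ?_
            gcongr
            · exact norm_pow_le' b k.succ_pos
            · exact hB z hz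
        _ = _ := by ring
    have hlim : Filter.Tendsto (fun k : ℕ => 2 * Real.pi * ρ * B * (‖b‖ / ρ) ^ (k + 1))
        Filter.atTop (𝓝 (2 * Real.pi * ρ * B * 0)) :=
      ((tendsto_pow_atTop_nhds_zero_of_lt_one (by positivity)
        ((div_lt_one hρ).2 h)).comp (Filter.tendsto_add_atTop_nat 1)).const_mul _
    rw [mul_zero] at hlim
    exact norm_le_zero_iff.1 (ge_of_tendsto' hlim hle)
  have hJ0 : J 0 = ∮ z in C(c, ρ), G z := by
    rw [hJ]
    simp
  rw [← hJ0, ← sub_zero (J 0), ← hJ1, h0]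

/-- For η = `catalanSum (e - e²)` and f = `spectralIdem e` one has e = (1 - η)f + η(1 - f), so the
resolvent of e splits into those of 1 - η and η. As ‖η‖ < √ε < 1/4, the circle encloses the spectrum
of 1 - η, while the resolvent of η is holomorphic on the whole disc. -/
theorem riesz_integral {e : R} {ε : ℝ} (hε : ε < 1 / 20)
    (h : ‖e * e - e‖ < ε) :
    (2 * Real.pi * Complex.I : ℂ)⁻¹ • (∮ z in C((1 : ℂ), Real.sqrt ε),
      Ring.inverse (z • (1 : R) - e)) = spectralIdem e := by
  have hε0 : 0 < ε := (norm_nonneg _).trans_lt h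
  set ρ := Real.sqrt ε with hρ
  have hρ0 : 0 < ρ := Real.sqrt_pos.2 hε0
  have hρ2 : ρ * ρ = ε := Real.mul_self_sqrt hε0.le
  have hρ1 : ρ < 1 / 4 := by nlinarith
  rw [norm_sub_rev] at h
  set x := e - e * e with hx
  have hx4 : ‖x‖ < 1 / 4 := by linarith
  set η := catalanSum x with hη
  -- The required inequality ‖x‖ < ρ(1 - 4‖x‖) follows from ‖x‖ < ρ² because ρ + 4ρ² < 1 when ρ <
  -- 1/4.
  have hη1 : ‖η‖ < ρ := by
    refine (norm_catalanSum_le hx4).trans_lt ?_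
    rw [div_lt_iff₀ (by linarith)]
    nlinarith [norm_nonneg x]
  set f := spectralIdem e with hf
  set s := Ring.inverse (sqrtSeries x) with hs
  have hu := isUnit_sqrtSeries hx4
  have heη : Commute e η := Commute.catalanSum_right (commute_self_sub e)
  have hff : f * f = f := spectralIdem_mul_self (by rw [norm_sub_rev, ← hx]; exact hx4)
  have hf' : f = (1 / 2 : ℂ) • (1 + ((2 : ℂ) • e - 1) * s) := rfl
  have hes : Commute e s := commute_inverse (commute_sqrtSeries (commute_self_sub e)) hu
  have hηs : Commute η s := commute_inverse (commute_sqrtSeries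
    ((heη.symm.sub_right (heη.symm.mul_right heη.symm)))) hu
  have hef : Commute e f := by
    rw [hf']
    exact ((Commute.one_right e).add_right ((((Commute.refl e).smul_right (2 : ℂ)).sub_right
      (Commute.one_right e)).mul_right hes)).smul_right _
  have hηf : Commute η f := by
    rw [hf']
    exact ((Commute.one_right η).add_right (((heη.symm.smul_right (2 : ℂ)).sub_right
      (Commute.one_right η)).mul_right hηs)).smul_right _
  have he2 : (2 : ℂ) • e - 1 = ((2 : ℂ) • f - 1) * (1 - (2 : ℂ) • η) := by
    have h1 : (2 : ℂ) • f - 1 = ((2 : ℂ) • e - 1) * s := by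
      rw [hf']
      module
    have h2 : s * (1 - (2 : ℂ) • η) = 1 := Ring.inverse_mul_cancel _ hu
    rw [h1, mul_assoc, h2, mul_one]
  have he : e = f - (2 : ℂ) • (f * η) + η := by
    have : e = (1 / 2 : ℂ) • (1 + ((2 : ℂ) • e - 1)) := by module
    rw [this, he2]
    simp only [sub_mul, mul_sub, one_mul, mul_one, smul_mul_assoc, mul_smul_comm]
    module
  have hef1 : e * f = (1 - η) * f := by
    conv_lhs => rw [he]
    rw [add_mul, sub_mul, hff, smul_mul_assoc, mul_assoc, hηf.eq, ← mul_assoc, hff, sub_mul,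
      one_mul, hηf.eq]
    module
  have hef2 : e * (1 - f) = η * (1 - f) := by
    rw [mul_sub, hef1, mul_one]
    conv_lhs => rw [he]
    rw [mul_sub, mul_one, hηf.eq, sub_mul, one_mul, hηf.eq]
    module
  have hnorm1 : ‖(1 - η) - (1 : ℂ) • (1 : R)‖ < ρ := by
    rw [one_smul, sub_sub_cancel_left, norm_neg]
    exact hη1
  have hU1 : ∀ z ∈ Metric.sphere (1 : ℂ) ρ, IsUnit (z • (1 : R) - (1 - η)) := by
    intro z hz
    have : z • (1 : R) - (1 - η) = (z - 1) • (1 : R) - (-η) := by module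
    rw [this]
    refine isUnit_smul_one_sub ?_
    rw [norm_neg, mem_sphere_iff_norm.1 hz]
    exact hη1
  have hU2 : ∀ z ∈ Metric.closedBall (1 : ℂ) ρ, IsUnit (z • (1 : R) - η) := by
    intro z hz
    refine isUnit_smul_one_sub (hη1.trans ?_)
    have h1 := mem_closedBall_iff_norm.1 hz
    have h2 : ‖(1 : ℂ)‖ ≤ ‖z‖ + ‖z - 1‖ := by
      rw [norm_sub_rev]
      simpa using norm_add_le z (1 - z)
    rw [norm_one] at h2
    linarith
  have hres : ∀ z ∈ Metric.sphere (1 : ℂ) ρ, Ring.inverse (z • (1 : R) - e) =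
      Ring.inverse (z • (1 : R) - (1 - η)) * f + Ring.inverse (z • (1 : R) - η) * (1 - f) := by
    intro z hz
    have u1 := hU1 z hz
    have u2 := hU2 z (Metric.sphere_subset_closedBall hz)
    have hz1 : ∀ a : R, Commute a (z • (1 : R)) := fun a => (Commute.one_right a).smul_right z
    set a := Ring.inverse (z • (1 : R) - (1 - η))
    set b := Ring.inverse (z • (1 : R) - η)
    have ca : Commute e a := commute_inverse
      ((hz1 e).sub_right ((Commute.one_right e).sub_right heη)) u1
    have cb : Commute e b := commute_inverse ((hz1 e).sub_right heη) u2
    have caz : Commute (z • (1 : R) - e) a := ((hz1 a).symm).sub_left ca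
    have cbz : Commute (z • (1 : R) - e) b := ((hz1 b).symm).sub_left cb
    have cfz : Commute (z • (1 : R) - e) f := ((hz1 f).symm).sub_left hef
    have k1 : (z • (1 : R) - e) * f = (z • (1 : R) - (1 - η)) * f := by
      rw [sub_mul, sub_mul, hef1]
    have k2 : (z • (1 : R) - e) * (1 - f) = (z • (1 : R) - η) * (1 - f) := by
      rw [sub_mul, sub_mul (z • (1 : R)) η, hef2]
    have m1 : (a * f + b * (1 - f)) * (z • (1 : R) - e) = 1 := by
      rw [add_mul, mul_assoc, mul_assoc, ← cfz.eq, k1,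
        ← ((Commute.one_right (z • (1 : R) - e)).sub_right cfz).eq, k2, ← mul_assoc, ← mul_assoc,
        Ring.inverse_mul_cancel _ u1, Ring.inverse_mul_cancel _ u2]
      simp
    have m2 : (z • (1 : R) - e) * (a * f + b * (1 - f)) = 1 := by
      refine Eq.trans ?_ m1
      exact ((caz.mul_right cfz).add_right (cbz.mul_right
        ((Commute.one_right (z • (1 : R) - e)).sub_right cfz))).eq
    exact Ring.inverse_unit (⟨z • (1 : R) - e, a * f + b * (1 - f), m2, m1⟩ : Rˣ)
  have hc1 : ContinuousOn (fun z : ℂ => Ring.inverse (z • (1 : R) - (1 - η)))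
      (Metric.sphere 1 ρ) := fun z hz =>
    (differentiableAt_resolvent (hU1 z hz)).continuousAt.continuousWithinAt
  have hc2 : ContinuousOn (fun z : ℂ => Ring.inverse (z • (1 : R) - η))
      (Metric.sphere 1 ρ) := fun z hz =>
    (differentiableAt_resolvent
      (hU2 z (Metric.sphere_subset_closedBall hz))).continuousAt.continuousWithinAt
  have hmul : ∀ (g : ℂ → R) (y : R), ContinuousOn g (Metric.sphere 1 ρ) →
      (∮ z in C((1 : ℂ), ρ), g z * y) = (∮ z in C((1 : ℂ), ρ), g z) * y := by
    intro g y hg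
    have := ((ContinuousLinearMap.mul ℂ R).flip y).intervalIntegral_comp_comm
      (hg.circleIntegrable hρ0.le).out
    simp only [ContinuousLinearMap.flip_apply, ContinuousLinearMap.mul_apply'] at this
    simp only [circleIntegral, ← smul_mul_assoc]
    exact this
  have i1 : CircleIntegrable (fun z : ℂ => Ring.inverse (z • (1 : R) - (1 - η)) * f) 1 ρ :=
    (hc1.mul continuousOn_const).circleIntegrable hρ0.le
  have i2 : CircleIntegrable (fun z : ℂ => Ring.inverse (z • (1 : R) - η) * (1 - f)) 1 ρ :=
    (hc2.mul continuousOn_const).circleIntegrable hρ0.le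
  rw [circleIntegral.integral_congr hρ0.le hres, circleIntegral.integral_add i1 i2, hmul _ _ hc1, hmul _ _ hc2,
    circleIntegral_resolvent_center hnorm1, circleIntegral_resolvent_eq_zero hρ0.le hU2, zero_mul,
    add_zero, smul_mul_assoc, one_mul, smul_smul, inv_mul_cancel₀, one_smul]
  exact mul_ne_zero (mul_ne_zero two_ne_zero (by exact_mod_cast Real.pi_ne_zero)) Complex.I_ne_zero

end Spectral


/-! ### Homomorphisms out of groups presented by matrices -/

namespace KSystem

variable {R : Type u} [Zero R] (S : KSystem R)

theorem cls_eq_of_htpy {n : ℕ} (x y : {x : Matrix (Fin n) (Fin n) R // S.mem n x})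
    (h : S.htpy n x.1 y.1) : S.cls x = S.cls y :=
  S.mk_eq_of_rel (Rel.htpy n x y h)

theorem cls_stab {n k : ℕ} (x : {x : Matrix (Fin n) (Fin n) R // S.mem n x})
    (z : {z : Matrix (Fin (n + k)) (Fin (n + k)) R // S.mem (n + k) z})
    (h : z.1 = bdiag x.1 (S.fill k)) : S.cls z = S.cls x :=
  S.mk_eq_of_rel (Rel.stab n k x z h)

theorem cls_sum {n m : ℕ} (x : {x : Matrix (Fin n) (Fin n) R // S.mem n x})
    (y : {y : Matrix (Fin m) (Fin m) R // S.mem m y})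
    (z : {z : Matrix (Fin (n + m)) (Fin (n + m)) R // S.mem (n + m) z})
    (h : z.1 = bdiag x.1 y.1) : S.cls z = S.cls x + S.cls y :=
  S.mk_eq_of_rel (Rel.sum n m x y z h)

variable {S}

/-- A function on matrices that respects the defining relations induces a homomorphism. -/
def lift {H : Type w} [AddCommGroup H]
    (g : ∀ n : ℕ, {x : Matrix (Fin n) (Fin n) R // S.mem n x} → H)
    (hhtpy : ∀ n x y, S.htpy n x.1 y.1 → g n x = g n y)
    (hstab : ∀ n k x (z : {z : Matrix (Fin (n + k)) (Fin (n + k)) R // S.mem (n + k) z}),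
      z.1 = bdiag x.1 (S.fill k) → g (n + k) z = g n x)
    (hsum : ∀ n m x y (z : {z : Matrix (Fin (n + m)) (Fin (n + m)) R // S.mem (n + m) z}),
      z.1 = bdiag x.1 y.1 → g (n + m) z = g n x + g m y) :
    S.Group →+ H :=
  QuotientAddGroup.lift _ (FreeAbelianGroup.lift fun a : S.Gen => g a.1 a.2) (by
    rw [AddSubgroup.closure_le]
    rintro a (⟨n, x, y, h⟩ | ⟨n, k, x, z, h⟩ | ⟨n, m, x, y, z, h⟩)
    · simp only [SetLike.mem_coe, AddMonoidHom.mem_ker, map_sub, FreeAbelianGroup.lift_apply_of]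
      rw [sub_eq_zero]
      exact hhtpy n x y h
    · simp only [SetLike.mem_coe, AddMonoidHom.mem_ker, map_sub, FreeAbelianGroup.lift_apply_of]
      rw [sub_eq_zero]
      exact hstab n k x z h
    · simp only [SetLike.mem_coe, AddMonoidHom.mem_ker, map_sub, map_add,
        FreeAbelianGroup.lift_apply_of]
      rw [sub_eq_zero]
      exact hsum n m x y z h)

theorem lift_cls {H : Type w} [AddCommGroup H]
    (g : ∀ n : ℕ, {x : Matrix (Fin n) (Fin n) R // S.mem n x} → H) {h₁ h₂ h₃} {n : ℕ}
    (x : {x : Matrix (Fin n) (Fin n) R // S.mem n x}) :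
    lift g h₁ h₂ h₃ (S.cls x) = g n x := by
  change FreeAbelianGroup.lift _ (FreeAbelianGroup.of _) = _
  rw [FreeAbelianGroup.lift_apply_of]

end KSystem

/-! ### The homomorphism from quantitative to ordinary `K_0` -/

namespace OpAlg

variable {E : Type u} [NormedAddCommGroup E] [NormedSpace ℂ E] (p : ℝ≥0∞) [Fact (1 ≤ p)]
  (A : OpAlg E)

/-- Block sum as a homomorphism. -/
noncomputable def bdiagHom (m n : ℕ) :
    (A.tilde p).Mat m × (A.tilde p).Mat n →ₙₐ[ℂ] (A.tilde p).Mat (m + n) where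
  toFun x := bdiag x.1 x.2
  map_smul' c x := by
    ext i j
    change bdiag (c • x.1) (c • x.2) i j = c • bdiag x.1 x.2 i j
    simp only [bdiag, Matrix.reindex_apply, Matrix.submatrix_apply]
    rcases finSumFinEquiv.symm i with a | a <;> rcases finSumFinEquiv.symm j with b | b <;> simp
  map_zero' := bdiag_zero
  map_add' x y := (bdiag_add _ _ _ _).symm
  map_mul' x y := (bdiag_mul _ _ _ _).symm

variable [CompleteSpace E]

/-- Block sum is a contractive homomorphism from the product algebra, and so are the two projections
of the product; `map_spectralIdem` applies to all three. -/
theorem spectralIdem_bdiag {m n : ℕ} {x : (A.tilde p).Mat m} {y : (A.tilde p).Mat n}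
    (hx : ‖x * x - x‖ < 1 / 4) (hy : ‖y * y - y‖ < 1 / 4) :
    spectralIdem (bdiag x y : (A.tilde p).Mat (m + n)) =
      bdiag (spectralIdem x) (spectralIdem y) := by
  have hn : ∀ z, ‖A.bdiagHom p m n z‖ ≤ ‖z‖ := fun z => A.norm_bdiag_le p z.1 z.2
  have hxy : ‖(x, y) * (x, y) - (x, y)‖ < 1 / 4 := max_lt hx hy
  have h := map_spectralIdem (A.bdiagHom p m n)
    (AddMonoidHomClass.continuous_of_bound (A.bdiagHom p m n) 1
      fun z => by rw [one_mul]; exact hn z) hn hxy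
  have h1 := map_spectralIdem (NonUnitalAlgHom.fst ℂ ((A.tilde p).Mat m) ((A.tilde p).Mat n))
    continuous_fst (fun z => le_max_left _ _) hxy
  have h2 := map_spectralIdem (NonUnitalAlgHom.snd ℂ ((A.tilde p).Mat m) ((A.tilde p).Mat n))
    continuous_snd (fun z => le_max_right _ _) hxy
  refine h.symm.trans ?_
  change bdiag (spectralIdem (x, y)).1 (spectralIdem (x, y)).2 = _
  exact congrArg₂ bdiag h1 h2

theorem idem_cls_eq_of_path {n : ℕ} {γ : unitInterval → (A.tilde p).Mat n} (hγ : Continuous γ)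
    {q : ℝ} (hq : q < 1 / 4) (h : ∀ t, ‖γ t * γ t - γ t‖ ≤ q)
    (x y : {f : (A.tilde p).Mat n // f * f = f}) (hx : x.1 = spectralIdem (γ 0))
    (hy : y.1 = spectralIdem (γ 1)) :
    (A.tilde p).idemSystem.cls x = (A.tilde p).idemSystem.cls y :=
  KSystem.cls_eq_of_htpy _ _ _ ⟨fun t => spectralIdem (γ t),
    (A.normCont_iff p).2 (continuous_spectralIdem hγ hq h),
    fun t => spectralIdem_mul_self ((h t).trans_lt hq), hx.symm, hy.symm⟩

/-- The homomorphism `κ_0`. -/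
noncomputable def kappa0 {ε r N : ℝ} (hε : ε < 1 / 20) :
    (A.tilde p).QK0 ε r N →+ (A.tilde p).K0 :=
  KSystem.lift (S := (A.tilde p).qIdemSystem ε r N)
    (fun n e => (A.tilde p).idemSystem.cls
      ⟨spectralIdem e.1, spectralIdem_mul_self (e.2.1.trans (by linarith))⟩)
    (fun n x y ⟨γ, hγ, hm, h0, h1⟩ => A.idem_cls_eq_of_path p ((A.normCont_iff p).1 hγ)
      -- Homotopies in the defining relations have defect below 4ε < 1/5, still inside the radius
      -- 1/4 of the Catalan series.
      (q := 1 / 5) (by norm_num) (fun t => (hm t).1.le.trans (by linarith)) _ _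
      (by rw [h0]) (by rw [h1]))
    (fun n k x z h => by
      refine KSystem.cls_stab _ _ _ ?_
      change spectralIdem z.1 = bdiag (spectralIdem x.1) 0
      rw [h]
      refine (A.spectralIdem_bdiag p (x.2.1.trans (by linarith)) ?_).trans ?_
      · change ‖(0 : (A.tilde p).Mat k) * 0 - 0‖ < _
        rw [mul_zero, sub_zero, norm_zero]
        norm_num
      · exact congrArg (bdiag _) (spectralIdem_of_idem (e := (0 : (A.tilde p).Mat k)) (mul_zero _)))
    (fun n m x y z h => by
      refine KSystem.cls_sum _ _ _ _ ?_
      change spectralIdem z.1 = bdiag (spectralIdem x.1) (spectralIdem y.1)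
      rw [h]
      exact A.spectralIdem_bdiag p (x.2.1.trans (by linarith)) (y.2.1.trans (by linarith)))

theorem kappa0_cls {ε r N : ℝ} (hε : ε < 1 / 20) {n : ℕ}
    (e : {e : (A.tilde p).Mat n // (A.tilde p).QIdem ε r N n e})
    (f : {f : (A.tilde p).Mat n // f * f = f}) (h : f.1 = spectralIdem e.1) :
    A.kappa0 p hε (((A.tilde p).qIdemSystem ε r N).cls e) = (A.tilde p).idemSystem.cls f := by
  refine (KSystem.lift_cls (S := (A.tilde p).qIdemSystem ε r N) _ e).trans ?_
  exact congrArg (fun f => (A.tilde p).idemSystem.cls f) (Subtype.ext h.symm)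

/-- The Riesz integral is taken among all operators on ℓ_p^n(E), whose identity may differ from the
image of the unit of M_n(Ã). The nonunital invariance of `spectralIdem` bridges the two. -/
theorem isKappaIdem_spectralIdem {ε : ℝ} (hε : ε < 1 / 20) {n : ℕ} {e : (A.tilde p).Mat n}
    (h : ‖e * e - e‖ < ε) : IsKappaIdem p A ε e (spectralIdem e : (A.tilde p).Mat n) := by
  have h1 := map_spectralIdem (A.toOp p n) (A.isometry_toOp p n).continuous
    (fun x => (A.norm_toOp p x).le) (h.trans (by linarith))
  have h2 : ‖A.toOp p n e * A.toOp p n e - A.toOp p n e‖ < ε := by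
    rw [← map_mul, ← map_sub, norm_toOp]
    exact h
  exact h1.trans (riesz_integral hε h2).symm

theorem isKappa0_kappa0 {ε r N : ℝ} (hε : ε < 1 / 20) :
    IsKappa0 p A ε r N (A.kappa0 p hε) := fun _ e =>
  ⟨⟨spectralIdem e.1, spectralIdem_mul_self (e.2.1.trans (by linarith))⟩,
    A.isKappaIdem_spectralIdem p hε e.2.1, A.kappa0_cls p hε e _ rfl⟩

end OpAlg

theorem IsKappa1.unique {B : MatrixAlg.{u}} {ε r N : ℝ} {κ κ' : B.QK1 ε r N →+ B.K1}
    (h : IsKappa1 B ε r N κ) (h' : IsKappa1 B ε r N κ') : κ = κ' := by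
  refine KSystem.hom_ext _ fun n u => ?_
  obtain ⟨_, hκ⟩ := h n u
  obtain ⟨_, hκ'⟩ := h' n u
  rw [hκ, hκ']

/-! ### The matrix algebras of the quotient -/

theorem IsKappa0.unique {E : Type u} [NormedAddCommGroup E] [NormedSpace ℂ E] [CompleteSpace E]
    {p : ℝ≥0∞} [Fact (1 ≤ p)] {A : OpAlg E} {ε r N : ℝ}
    {κ κ' : (A.tilde p).QK0 ε r N →+ (A.tilde p).K0}
    (h : IsKappa0 p A ε r N κ) (h' : IsKappa0 p A ε r N κ') : κ = κ' := by
  refine KSystem.hom_ext _ fun n e => ?_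
  obtain ⟨f, hf, hκ⟩ := h n e
  obtain ⟨f', hf', hκ'⟩ := h' n e
  have : f = f' := Subtype.ext (A.toOp_injective p n (hf.trans hf'.symm))
  rw [hκ, hκ', this]

namespace ClosedIdeal

variable {E : Type u} [NormedAddCommGroup E] [NormedSpace ℂ E] (p : ℝ≥0∞) [Fact (1 ≤ p)]
  {A : OpAlg E} (J : ClosedIdeal A)

/-- The quotient map `M_n(Ã) → M_n(Ã/J)`. -/
noncomputable def mkMat (n : ℕ) : (A.tilde p).Mat n →ₐ[ℂ] (J.quot p).Mat n :=
  (Ideal.Quotient.mkₐ ℂ J.tildeIdeal).mapMatrix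

theorem mkMat_surjective (n : ℕ) : Function.Surjective (J.mkMat p n) := by
  intro x
  choose y hy using fun i j => Ideal.Quotient.mk_surjective (I := J.tildeIdeal) (x i j)
  exact ⟨Matrix.of y, by ext i j; exact hy i j⟩

theorem mkMat_eq_zero_iff {n : ℕ} (X : (A.tilde p).Mat n) :
    J.mkMat p n X = 0 ↔ ∀ i j, A.val (X i j) ∈ J.alg := by
  rw [← Matrix.ext_iff]
  exact forall₂_congr fun i j => Ideal.Quotient.eq_zero_iff_mem

theorem mkMat_bdiag {m n : ℕ} (X : (A.tilde p).Mat m) (Y : (A.tilde p).Mat n) :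
    J.mkMat p (m + n) (bdiag X Y) = bdiag (J.mkMat p m X) (J.mkMat p n Y) :=
  bdiag_map _ (map_zero _) X Y

theorem mkMat_blk {n : ℕ} (a b c d : (A.tilde p).Mat n) :
    J.mkMat p (n + n) (blk a b c d) =
      blk (J.mkMat p n a) (J.mkMat p n b) (J.mkMat p n c) (J.mkMat p n d) :=
  blk_map _ a b c d

theorem nrm_lt_iff {n : ℕ} {x : (J.quot p).Mat n} {δ : ℝ} :
    (J.quot p).nrm n x < δ ↔ ∃ X, J.mkMat p n X = x ∧ ‖X‖ < δ := by
  have hne : {t : ℝ | ∃ y : Matrix (Fin n) (Fin n) A.Tilde,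
      y.map (Ideal.Quotient.mk J.tildeIdeal) = x ∧ t = ‖matOp p (y.map A.val)‖}.Nonempty := by
    obtain ⟨X, hX⟩ := J.mkMat_surjective p n x
    exact ⟨_, X, hX, rfl⟩
  have hbd : BddBelow {t : ℝ | ∃ y : Matrix (Fin n) (Fin n) A.Tilde,
      y.map (Ideal.Quotient.mk J.tildeIdeal) = x ∧ t = ‖matOp p (y.map A.val)‖} :=
    ⟨0, by rintro _ ⟨y, -, rfl⟩; exact norm_nonneg _⟩
  refine (csInf_lt_iff hbd hne).trans ⟨?_, ?_⟩
  · rintro ⟨_, ⟨y, hy, rfl⟩, h⟩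
    exact ⟨y, hy, h⟩
  · rintro ⟨X, hX, h⟩
    exact ⟨_, ⟨X, hX, rfl⟩, h⟩

theorem nrm_mkMat_le {n : ℕ} (X : (A.tilde p).Mat n) : (J.quot p).nrm n (J.mkMat p n X) ≤ ‖X‖ :=
  le_of_forall_gt fun _ h => (J.nrm_lt_iff p).2 ⟨X, rfl, h⟩

/-- The quotient norm on `M_n(Ã/J)`. -/
noncomputable def quotSeminorm (n : ℕ) : RingSeminorm ((J.quot p).Mat n) where
  toFun := (J.quot p).nrm n
  map_zero' := by
    refine le_antisymm ?_ ((J.quot p).nrm_nonneg n _)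
    have := J.nrm_mkMat_le p (0 : (A.tilde p).Mat n)
    rwa [map_zero, norm_zero] at this
  add_le' x y := by
    refine le_of_forall_pos_lt_add fun δ hδ => ?_
    obtain ⟨X, rfl, hX⟩ := (J.nrm_lt_iff p).1 (lt_add_of_pos_right ((J.quot p).nrm n x) (half_pos hδ))
    obtain ⟨Y, rfl, hY⟩ := (J.nrm_lt_iff p).1 (lt_add_of_pos_right ((J.quot p).nrm n y) (half_pos hδ))
    rw [← map_add]
    refine ((J.nrm_mkMat_le p _).trans (norm_add_le X Y)).trans_lt ?_
    linarith
  neg' x := by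
    have h : ∀ x, (J.quot p).nrm n (-x) ≤ (J.quot p).nrm n x := by
      intro x
      refine le_of_forall_gt fun δ h => ?_
      obtain ⟨X, rfl, hX⟩ := (J.nrm_lt_iff p).1 h
      exact (J.nrm_lt_iff p).2 ⟨-X, map_neg _ _, by rwa [norm_neg]⟩
    refine le_antisymm (h x) ?_
    have := h (-x)
    rwa [neg_neg] at this
  mul_le' x y := by
    set a := (J.quot p).nrm n x
    set b := (J.quot p).nrm n y
    have ha : 0 ≤ a := (J.quot p).nrm_nonneg n x
    have hb : 0 ≤ b := (J.quot p).nrm_nonneg n y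
    have key : ∀ δ : ℝ, 0 < δ → (J.quot p).nrm n (x * y) ≤ (a + δ) * (b + δ) := by
      intro δ hδ
      obtain ⟨X, hX', hX⟩ := (J.nrm_lt_iff p).1 (lt_add_of_pos_right a hδ)
      obtain ⟨Y, hY', hY⟩ := (J.nrm_lt_iff p).1 (lt_add_of_pos_right b hδ)
      rw [← hX', ← hY', ← map_mul]
      exact ((J.nrm_mkMat_le p _).trans (norm_mul_le X Y)).trans (by gcongr)
    have hlim : Filter.Tendsto (fun δ : ℝ => (a + δ) * (b + δ)) (𝓝[>] 0) (𝓝 (a * b)) := by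
      have : Filter.Tendsto (fun δ : ℝ => (a + δ) * (b + δ)) (𝓝 0) (𝓝 ((a + 0) * (b + 0))) :=
        (by fun_prop : Continuous fun δ : ℝ => (a + δ) * (b + δ)).tendsto 0
      rw [add_zero, add_zero] at this
      exact this.mono_left nhdsWithin_le_nhds
    exact ge_of_tendsto hlim (Filter.eventually_of_mem self_mem_nhdsWithin key)

noncomputable instance quotSeminormedRing (n : ℕ) : SeminormedRing ((J.quot p).Mat n) :=
  (J.quotSeminorm p n).toSeminormedRing

theorem norm_lt_iff {n : ℕ} {x : (J.quot p).Mat n} {δ : ℝ} :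
    ‖x‖ < δ ↔ ∃ X, J.mkMat p n X = x ∧ ‖X‖ < δ := J.nrm_lt_iff p

theorem norm_mkMat_le {n : ℕ} (X : (A.tilde p).Mat n) : ‖J.mkMat p n X‖ ≤ ‖X‖ := J.nrm_mkMat_le p X

noncomputable instance quotNormedAlgebra (n : ℕ) : NormedAlgebra ℂ ((J.quot p).Mat n) where
  norm_smul_le c x := by
    refine le_of_forall_gt fun δ h => ?_
    rcases eq_or_ne c 0 with rfl | hc
    · rw [norm_zero, zero_mul] at h
      rw [zero_smul, norm_zero]
      exact h
    · have hc' := norm_pos_iff.2 hc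
      obtain ⟨X, rfl, hX⟩ := (J.norm_lt_iff p).1 ((lt_div_iff₀' hc').2 h)
      refine (J.norm_lt_iff p).2 ⟨c • X, map_smul _ _ _, ?_⟩
      rw [norm_smul]
      exact (lt_div_iff₀' hc').1 hX

theorem norm_one_le (h : ‖A.unit‖ ≤ 1) (n : ℕ) : ‖(1 : (J.quot p).Mat n)‖ ≤ 1 := by
  have := J.norm_mkMat_le p (1 : (A.tilde p).Mat n)
  rw [map_one] at this
  exact this.trans (A.norm_one_le p h n)

theorem norm_bdiag_lt {m n : ℕ} {x : (J.quot p).Mat m} {y : (J.quot p).Mat n} {δ : ℝ}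
    (hx : ‖x‖ < δ) (hy : ‖y‖ < δ) : ‖(bdiag x y : (J.quot p).Mat (m + n))‖ < δ := by
  obtain ⟨X, rfl, hX⟩ := (J.norm_lt_iff p).1 hx
  obtain ⟨Y, rfl, hY⟩ := (J.norm_lt_iff p).1 hy
  rw [← mkMat_bdiag]
  exact ((J.norm_mkMat_le p _).trans (A.norm_bdiag_le p X Y)).trans_lt (max_lt hX hY)

theorem norm_blk_lt {n : ℕ} {a b c d : (J.quot p).Mat n} {δ : ℝ} (ha : ‖a‖ < δ) (hb : ‖b‖ < δ)
    (hc : ‖c‖ < δ) (hd : ‖d‖ < δ) : ‖(blk a b c d : (J.quot p).Mat (n + n))‖ < 2 * δ := by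
  obtain ⟨a', rfl, ha'⟩ := (J.norm_lt_iff p).1 ha
  obtain ⟨b', rfl, hb'⟩ := (J.norm_lt_iff p).1 hb
  obtain ⟨c', rfl, hc'⟩ := (J.norm_lt_iff p).1 hc
  obtain ⟨d', rfl, hd'⟩ := (J.norm_lt_iff p).1 hd
  rw [← mkMat_blk]
  refine ((J.norm_mkMat_le p _).trans (A.norm_blk_le p a' b' c' d')).trans_lt ?_
  rw [two_mul]
  exact add_lt_add (max_lt ha' hd') (max_lt hb' hc')

theorem quot_normCont_iff {n : ℕ} {γ : unitInterval → (J.quot p).Mat n} :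
    (J.quot p).NormCont n γ ↔ Continuous γ := by
  rw [continuous_iff_continuousAt]
  have h : ∀ t, ContinuousAt γ t ↔ Filter.Tendsto (fun s => ‖γ s - γ t‖) (𝓝 t) (𝓝 0) := fun t =>
    tendsto_iff_norm_sub_tendsto_zero
  simp only [h]
  rfl

variable [CompleteSpace E]

/-- The quotient is used only as a seminormed ring; the Neumann series is summed upstairs in M_n(Ã),
on a lift of 1 - x of norm less than one. -/
theorem quot_isUnit_of_norm_sub_lt {n : ℕ} {x : (J.quot p).Mat n} (h : ‖x - 1‖ < 1) :
    IsUnit x := by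
  rw [norm_sub_rev] at h
  obtain ⟨X, hX, hn⟩ := (J.norm_lt_iff p).1 h
  have : x = J.mkMat p n (1 - X) := by rw [map_sub, map_one, hX, sub_sub_cancel]
  rw [this]
  exact (isUnit_one_sub_of_norm_lt_one hn).map (J.mkMat p n)

theorem quot_isUnit_of_mul {n : ℕ} {u v : (J.quot p).Mat n} (h₁ : ‖u * v - 1‖ < 1)
    (h₂ : ‖v * u - 1‖ < 1) : IsUnit u := by
  obtain ⟨a, ha⟩ := (J.quot_isUnit_of_norm_sub_lt p h₁).exists_right_inv
  obtain ⟨b, hb⟩ := (J.quot_isUnit_of_norm_sub_lt p h₂).exists_left_inv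
  exact isUnit_iff_exists_and_exists.2 ⟨⟨v * a, by rw [← mul_assoc, ha]⟩,
    ⟨b * v, by rw [mul_assoc, hb]⟩⟩

theorem quot_isUnit_of_invPair {ε r N : ℝ} (hε : ε ≤ 1) {n : ℕ} {u v : (J.quot p).Mat n}
    (h : (J.quot p).QInvPair ε r N n u v) : IsUnit u := by
  obtain ⟨-, -, -, -, h₁, h₂⟩ := h
  exact J.quot_isUnit_of_mul p (lt_of_lt_of_le h₁ hε) (lt_of_lt_of_le h₂ hε)

/-- The homomorphism `κ_1`. -/
noncomputable def kappa1 {ε r N : ℝ} (hε : ε < 1 / 20) : (J.quot p).QK1 ε r N →+ J.quotK1 p :=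
  KSystem.lift (S := (J.quot p).qInvSystem ε r N)
    (fun _ u => (J.quot p).invSystem.cls ⟨u.1, by
      obtain ⟨v, h⟩ := u.2
      exact J.quot_isUnit_of_invPair p (by linarith) h⟩)
    (by
      rintro n x y ⟨γ, δ, hγ, -, hm, h0, h1⟩
      exact KSystem.cls_eq_of_htpy _ _ _ ⟨γ, hγ, fun t =>
        J.quot_isUnit_of_invPair p (by linarith) (hm t), h0, h1⟩)
    (fun _ _ _ _ h => KSystem.cls_stab _ _ _ h)
    (fun _ _ _ _ _ h => KSystem.cls_sum _ _ _ _ h)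

theorem kappa1_cls {ε r N : ℝ} (hε : ε < 1 / 20) {n : ℕ}
    (u : {u : (J.quot p).Mat n // (J.quot p).QInv ε r N n u}) (h : IsUnit u.1) :
    J.kappa1 p hε (((J.quot p).qInvSystem ε r N).cls u) = (J.quot p).invSystem.cls ⟨u.1, h⟩ :=
  KSystem.lift_cls (S := (J.quot p).qInvSystem ε r N) _ u

theorem isKappa1_kappa1 {ε r N : ℝ} (hε : ε < 1 / 20) :
    IsKappa1 (J.quot p) ε r N (J.kappa1 p hε) := by
  intro n u
  obtain ⟨v, h⟩ := u.2
  exact ⟨J.quot_isUnit_of_invPair p (by linarith) h, J.kappa1_cls p hε u _⟩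

end ClosedIdeal


/-! ### Rotations of block sums, and invariance of classes under conjugation -/

section Rotation

variable {R : Type u} {n m : ℕ}

/-- The permutation of `Fin (m + n)` given by permutations of the two blocks. -/
def sumPerm {m' n' : ℕ} (σ : Fin m ≃ Fin m') (τ : Fin n ≃ Fin n') : Fin (m + n) ≃ Fin (m' + n') :=
  (finSumFinEquiv.symm.trans (Equiv.sumCongr σ τ)).trans finSumFinEquiv

theorem bdiag_submatrix {R : Type*} [Zero R] {m' n' : ℕ} (σ : Fin m ≃ Fin m') (τ : Fin n ≃ Fin n')
    (x : Matrix (Fin m') (Fin m') R) (y : Matrix (Fin n') (Fin n') R) :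
    (bdiag x y).submatrix (sumPerm σ τ) (sumPerm σ τ) =
      bdiag (x.submatrix σ σ) (y.submatrix τ τ) := by
  ext i j
  simp only [bdiag, Matrix.reindex_apply, Matrix.submatrix_apply, sumPerm, Equiv.trans_apply,
    Equiv.symm_apply_apply]
  rcases finSumFinEquiv.symm i with a | a <;> rcases finSumFinEquiv.symm j with b | b <;> simp

/-- The tensor product of `e` with the projection onto the line of slope `πt/2`. -/
noncomputable def rotIdem [Ring R] [Algebra ℂ R] (e : Matrix (Fin n) (Fin n) R) (t : ℝ) :
    Matrix (Fin (n + n)) (Fin (n + n)) R :=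
  ((Real.cos (Real.pi / 2 * t) ^ 2 : ℝ) : ℂ) • blk e 0 0 0 +
    ((Real.cos (Real.pi / 2 * t) * Real.sin (Real.pi / 2 * t) : ℝ) : ℂ) • blk 0 e e 0 +
      ((Real.sin (Real.pi / 2 * t) ^ 2 : ℝ) : ℂ) • blk 0 0 0 e

variable [Ring R] [Algebra ℂ R]

theorem rotIdem_eq (e : Matrix (Fin n) (Fin n) R) (t : ℝ) :
    rotIdem e t = blk (((Real.cos (Real.pi / 2 * t) ^ 2 : ℝ) : ℂ) • e)
      (((Real.cos (Real.pi / 2 * t) * Real.sin (Real.pi / 2 * t) : ℝ) : ℂ) • e)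
      (((Real.cos (Real.pi / 2 * t) * Real.sin (Real.pi / 2 * t) : ℝ) : ℂ) • e)
      (((Real.sin (Real.pi / 2 * t) ^ 2 : ℝ) : ℂ) • e) := by
  simp only [rotIdem, blk_smul, blk_add, smul_zero, zero_add, add_zero]

theorem rotIdem_zero (e : Matrix (Fin n) (Fin n) R) : rotIdem e 0 = bdiag e 0 := by
  rw [rotIdem_eq, bdiag_eq_blk]
  simp

theorem rotIdem_one (e : Matrix (Fin n) (Fin n) R) : rotIdem e 1 = bdiag 0 e := by
  rw [rotIdem_eq, bdiag_eq_blk]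
  simp

/-- The scalar 2 × 2 matrix involved is a rank-one projection, and tensoring with a fixed projection
is multiplicative. -/
theorem rotIdem_mul (e f : Matrix (Fin n) (Fin n) R) (t : ℝ) :
    rotIdem e t * rotIdem f t = rotIdem (e * f) t := by
  have h := Real.sin_sq_add_cos_sq (Real.pi / 2 * t)
  simp only [rotIdem_eq, blk_mul, smul_mul_smul_comm, ← add_smul]
  set c := Real.cos (Real.pi / 2 * t)
  set s := Real.sin (Real.pi / 2 * t)
  have e1 : c ^ 2 * c ^ 2 + c * s * (c * s) = c ^ 2 := by linear_combination c ^ 2 * h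
  have e2 : c ^ 2 * (c * s) + c * s * s ^ 2 = c * s := by linear_combination c * s * h
  have e3 : c * s * c ^ 2 + s ^ 2 * (c * s) = c * s := by linear_combination c * s * h
  have e4 : c * s * (c * s) + s ^ 2 * s ^ 2 = s ^ 2 := by linear_combination s ^ 2 * h
  rw [← Complex.ofReal_mul, ← Complex.ofReal_mul, ← Complex.ofReal_mul, ← Complex.ofReal_mul,
    ← Complex.ofReal_mul, ← Complex.ofReal_mul, ← Complex.ofReal_mul,
    ← Complex.ofReal_add, ← Complex.ofReal_add, ← Complex.ofReal_add, ← Complex.ofReal_add, e1, e2,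
    e3, e4]

theorem rotIdem_sub (e f : Matrix (Fin n) (Fin n) R) (t : ℝ) :
    rotIdem e t - rotIdem f t = rotIdem (e - f) t := by
  simp only [rotIdem_eq, blk_sub, smul_sub]

end Rotation

namespace OpAlg

variable {E : Type u} [NormedAddCommGroup E] [NormedSpace ℂ E] (p : ℝ≥0∞) [Fact (1 ≤ p)]
  (A : OpAlg E)

theorem continuous_rotIdem {n : ℕ} (e : (A.tilde p).Mat n) :
    Continuous fun t : unitInterval => (rotIdem e (t : ℝ) : (A.tilde p).Mat (n + n)) := by
  unfold rotIdem
  have hc : Continuous fun t : unitInterval => Real.cos (Real.pi / 2 * t) := by fun_prop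
  have hs : Continuous fun t : unitInterval => Real.sin (Real.pi / 2 * t) := by fun_prop
  exact (((Complex.continuous_ofReal.comp (hc.pow 2)).smul continuous_const).add
    ((Complex.continuous_ofReal.comp (hc.mul hs)).smul continuous_const)).add
      ((Complex.continuous_ofReal.comp (hs.pow 2)).smul continuous_const)

theorem norm_rotIdem_le {n : ℕ} (e : (A.tilde p).Mat n) (t : ℝ) :
    ‖(rotIdem e t : (A.tilde p).Mat (n + n))‖ ≤ 2 * ‖e‖ := by
  rw [rotIdem_eq]
  have hc := Real.abs_cos_le_one (Real.pi / 2 * t)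
  have hs := Real.abs_sin_le_one (Real.pi / 2 * t)
  have key : ∀ a : ℝ, |a| ≤ 1 → ‖((a : ℂ)) • e‖ ≤ ‖e‖ := by
    intro a ha
    rw [norm_smul, Complex.norm_real]
    exact mul_le_of_le_one_left (norm_nonneg _) ha
  have h1 := key (Real.cos (Real.pi / 2 * t) ^ 2) (by
    rw [abs_pow]; exact pow_le_one₀ (abs_nonneg _) hc)
  have h2 := key (Real.cos (Real.pi / 2 * t) * Real.sin (Real.pi / 2 * t)) (by
    rw [abs_mul]; exact mul_le_one₀ hc (abs_nonneg _) hs)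
  have h3 := key (Real.sin (Real.pi / 2 * t) ^ 2) (by
    rw [abs_pow]; exact pow_le_one₀ (abs_nonneg _) hs)
  refine (A.norm_blk_le p _ _ _ _).trans ?_
  rw [two_mul]
  exact add_le_add (max_le h1 h3) (max_le h2 h2)

theorem continuous_submatrix {a b : ℕ} (σ τ : Fin a ≃ Fin b) :
    Continuous fun X : (A.tilde p).Mat b => (X.submatrix σ τ : (A.tilde p).Mat a) := by
  let θ : (A.tilde p).Mat b →+ (A.tilde p).Mat a :=
    { toFun := fun X => X.submatrix σ τ
      map_zero' := rfl
      map_add' := fun _ _ => rfl }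
  exact AddMonoidHomClass.continuous_of_bound θ 1 fun X => by
    rw [one_mul]
    exact A.norm_submatrix_le p σ τ X

theorem qIdem_submatrix {a b : ℕ} (σ : Fin a ≃ Fin b) {ε r N : ℝ} {e : (A.tilde p).Mat b}
    (h : (A.tilde p).QIdem ε r N b e) : (A.tilde p).QIdem ε r N a (e.submatrix σ σ) := by
  refine ⟨?_, fun i j => h.2.1 _ _, (A.norm_submatrix_le p σ σ e).trans h.2.2.1, ?_⟩
  · rw [Matrix.submatrix_mul_equiv]
    exact (A.norm_submatrix_le p σ σ (e * e - e)).trans_lt h.1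
  · rw [← Matrix.submatrix_one_equiv σ]
    exact (A.norm_submatrix_le p σ σ (1 - e)).trans h.2.2.2

theorem qIdem_bdiag {m n : ℕ} {ε r N : ℝ} {e : (A.tilde p).Mat m} {f : (A.tilde p).Mat n}
    (he : (A.tilde p).QIdem ε r N m e) (hf : (A.tilde p).QIdem ε r N n f) :
    (A.tilde p).QIdem ε r N (m + n) (bdiag e f) := by
  refine ⟨?_, bdiag_forall (P := fun x => x ∈ (A.tilde p).fil r) (zero_mem _) he.2.1 hf.2.1,
    (A.norm_bdiag_le p e f).trans (max_le he.2.2.1 hf.2.2.1), ?_⟩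
  · rw [bdiag_mul, bdiag_sub]
    exact (A.norm_bdiag_le p _ _).trans_lt (max_lt he.1 hf.1)
  · rw [← bdiag_one, bdiag_sub]
    exact (A.norm_bdiag_le p _ _).trans (max_le he.2.2.2 hf.2.2.2)

theorem qIdem_zero (h1 : ‖A.unit‖ ≤ 1) {ε r N : ℝ} (hε : 0 < ε) (hN : 1 ≤ N) (n : ℕ) :
    (A.tilde p).QIdem ε r N n 0 := by
  have h0 : (A.tilde p).nrm n 0 = 0 := norm_zero (E := (A.tilde p).Mat n)
  refine ⟨?_, fun i j => zero_mem ((A.tilde p).fil r), ?_, ?_⟩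
  · rw [mul_zero, sub_zero, h0]
    exact hε
  · rw [h0]
    linarith
  · rw [sub_zero]
    exact (A.norm_one_le p h1 n).trans hN

/-- Simultaneous permutation of rows and columns does not change the class in `K_0^{ε,r,N}`. -/
theorem qIdem_cls_submatrix (h1 : ‖A.unit‖ ≤ 1) {ε r N : ℝ} (hN : 1 ≤ N) {a b : ℕ}
    (σ : Fin a ≃ Fin b) (e : {e : (A.tilde p).Mat b // (A.tilde p).QIdem ε r N b e})
    (f : {e : (A.tilde p).Mat a // (A.tilde p).QIdem ε r N a e}) (hf : f.1 = e.1.submatrix σ σ) :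
    ((A.tilde p).qIdemSystem ε r N).cls f = ((A.tilde p).qIdemSystem ε r N).cls e := by
  obtain rfl : a = b := by simpa using Fintype.card_congr σ
  have hε : 0 < ε := ((A.tilde p).nrm_nonneg _ _).trans_lt e.2.1
  -- The permutation acts only on the first block, and the rotation moves e into the second one, so
  -- every τ leads to the same end point diag(0, e). The rotation at most doubles norms, which fits
  -- into the slack 4ε and, since 1 + 2N ≤ 4N, into 4N.
  have key : ∀ (τ : Fin a ≃ Fin a)
      (f : {e : (A.tilde p).Mat a // (A.tilde p).QIdem ε r N a e}), f.1 = e.1.submatrix τ τ →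
      ((A.tilde p).qIdemSystem ε r N).cls f = ((A.tilde p).qIdemSystem ε r N).cls
        ⟨bdiag 0 e.1, A.qIdem_bdiag p (A.qIdem_zero p h1 hε hN a) e.2⟩ := by
    intro τ f hf
    rw [← KSystem.cls_stab (S := (A.tilde p).qIdemSystem ε r N) (k := a) f
      ⟨bdiag f.1 0, A.qIdem_bdiag p f.2 (A.qIdem_zero p h1 hε hN a)⟩ rfl]
    refine KSystem.cls_eq_of_htpy _ _ _ ⟨fun t => (rotIdem e.1 t).submatrix
      (sumPerm τ (Equiv.refl _)) (sumPerm τ (Equiv.refl _)), ?_, fun t => ?_, ?_, ?_⟩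
    · exact (A.normCont_iff p).2 ((A.continuous_submatrix p _ _).comp (A.continuous_rotIdem p e.1))
    · refine A.qIdem_submatrix p _ ⟨?_, ?_, ?_, ?_⟩
      · rw [rotIdem_mul, rotIdem_sub]
        refine (A.norm_rotIdem_le p _ _).trans_lt ?_
        have : ‖e.1 * e.1 - e.1‖ < ε := e.2.1
        linarith
      · rw [rotIdem_eq]
        exact blk_forall (P := fun x => x ∈ (A.tilde p).fil r)
          (fun i j => Submodule.smul_mem _ _ (e.2.2.1 i j))
          (fun i j => Submodule.smul_mem _ _ (e.2.2.1 i j))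
          (fun i j => Submodule.smul_mem _ _ (e.2.2.1 i j))
          (fun i j => Submodule.smul_mem _ _ (e.2.2.1 i j))
      · refine (A.norm_rotIdem_le p _ _).trans ?_
        have : ‖e.1‖ ≤ N := e.2.2.2.1
        linarith
      · refine (norm_sub_le (1 : (A.tilde p).Mat (a + a)) _).trans ?_
        have h2 := A.norm_rotIdem_le p e.1 t
        have h3 : ‖e.1‖ ≤ N := e.2.2.2.1
        have h4 := A.norm_one_le p h1 (a + a)
        linarith
    · change (rotIdem e.1 0).submatrix _ _ = bdiag f.1 0
      rw [rotIdem_zero, bdiag_submatrix, hf]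
      rfl
    · change (rotIdem e.1 1).submatrix _ _ = _
      rw [rotIdem_one, bdiag_submatrix]
      rfl
  rw [key σ f hf, key (Equiv.refl _) e rfl]

/-- Conjugate idempotents have the same class in `K_0`. -/
theorem idem_cls_conj {n : ℕ} {G G' : (A.tilde p).Mat n} (h' : G' * G = 1)
    (e f : {e : (A.tilde p).Mat n // e * e = e}) (hf : f.1 = G * e.1 * G') :
    (A.tilde p).idemSystem.cls f = (A.tilde p).idemSystem.cls e := by
  -- The rotation is conjugated by diag(G, 1): at one end this conjugates e, at the other e sits in
  -- the block where the conjugation is trivial. Only G'G = 1 is needed.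
  have key : ∀ (G G' : (A.tilde p).Mat n) (f : {e : (A.tilde p).Mat n // e * e = e}),
      G' * G = 1 → f.1 = G * e.1 * G' → (A.tilde p).idemSystem.cls f =
        (A.tilde p).idemSystem.cls (n := n + n)
          ⟨bdiag 0 e.1, show bdiag _ _ * bdiag _ _ = _ by rw [bdiag_mul, e.2, mul_zero]⟩ := by
    intro G G' f h' hf
    rw [← KSystem.cls_stab (S := (A.tilde p).idemSystem) (k := n) f
      ⟨bdiag f.1 0, show bdiag _ _ * bdiag _ _ = _ by rw [bdiag_mul, f.2, mul_zero]⟩ rfl]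
    refine KSystem.cls_eq_of_htpy _ _ _ ⟨fun t => bdiag G 1 * rotIdem e.1 t * bdiag G' 1,
      ?_, fun t => ?_, ?_, ?_⟩
    · refine (A.normCont_iff p).2 ?_
      exact (continuous_const.mul (A.continuous_rotIdem p e.1)).mul continuous_const
    · have h2 : bdiag G' (1 : (A.tilde p).Mat n) * bdiag G 1 = 1 := by
        rw [bdiag_mul, h', mul_one, bdiag_one]
      change bdiag G 1 * rotIdem e.1 t * bdiag G' 1 * (bdiag G 1 * rotIdem e.1 t * bdiag G' 1) = _
      rw [show ∀ a b c : (A.tilde p).Mat (n + n), a * b * c * (a * b * c) =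
        a * (b * (c * a) * b) * c by intros; simp only [mul_assoc], h2, mul_one, rotIdem_mul, e.2]
    · change bdiag G 1 * rotIdem e.1 0 * bdiag G' 1 = bdiag f.1 0
      rw [rotIdem_zero, bdiag_mul, bdiag_mul, hf, one_mul, zero_mul]
    · change bdiag G 1 * rotIdem e.1 1 * bdiag G' 1 = bdiag 0 e.1
      rw [rotIdem_one, bdiag_mul, bdiag_mul, mul_zero, zero_mul, one_mul, mul_one]
  rw [key G G' f h' hf, key 1 1 e (mul_one _) (by rw [one_mul, mul_one])]

/-- Simultaneous permutation of rows and columns does not change the class in `K_0`. -/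
theorem idem_cls_submatrix {a b : ℕ} (σ : Fin a ≃ Fin b)
    (e : {e : (A.tilde p).Mat b // e * e = e}) (f : {e : (A.tilde p).Mat a // e * e = e})
    (hf : f.1 = e.1.submatrix σ σ) :
    (A.tilde p).idemSystem.cls f = (A.tilde p).idemSystem.cls e := by
  obtain rfl : a = b := by simpa using Fintype.card_congr σ
  refine A.idem_cls_conj p (G := (1 : (A.tilde p).Mat a).submatrix σ id)
    (G' := (1 : (A.tilde p).Mat a).submatrix id σ) ?_ e f ?_
  · rw [← Matrix.submatrix_mul _ _ id σ id σ.bijective, one_mul]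
    rfl
  · rw [hf]
    ext i j
    simp [Matrix.mul_apply, Matrix.one_apply]

end OpAlg


/-! ### Scalar matrices act on `ℓ_p^n(E)` with their norm on `ℓ_p^n` -/

section Scalars

open MeasureTheory

theorem piLp_norm_rpow {p : ℝ≥0∞} [Fact (1 ≤ p)] (hp : p ≠ ∞) {F : Type*} [NormedAddCommGroup F]
    {n : ℕ} (x : PiLp p (fun _ : Fin n => F)) : ‖x‖ ^ p.toReal = ∑ i, ‖x i‖ ^ p.toReal := by
  have hp0 : 0 < p.toReal := p.toReal_pos_iff_ne_top.2 hp
  rw [PiLp.norm_eq_sum hp0, ← Real.rpow_mul (by positivity), one_div, inv_mul_cancel₀ hp0.ne',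
    Real.rpow_one]

theorem piLp_enorm_rpow {p : ℝ≥0∞} [Fact (1 ≤ p)] (hp : p ≠ ∞) {F : Type*} [NormedAddCommGroup F]
    {n : ℕ} (x : PiLp p (fun _ : Fin n => F)) : ‖x‖ₑ ^ p.toReal = ∑ i, ‖x i‖ₑ ^ p.toReal := by
  have hp0 : 0 < p.toReal := p.toReal_pos_iff_ne_top.2 hp
  simp only [← ofReal_norm, ENNReal.ofReal_rpow_of_nonneg (norm_nonneg _) hp0.le]
  rw [piLp_norm_rpow hp, ENNReal.ofReal_sum_of_nonneg fun _ _ => by positivity]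

/-- The norm of a complex matrix as an operator on `ℓ_p^n`. -/
noncomputable def scalarNorm (p : ℝ≥0∞) [Fact (1 ≤ p)] {n : ℕ} (z : Matrix (Fin n) (Fin n) ℂ) : ℝ :=
  ‖matOp p (z.map fun z => z • (1 : ℂ →L[ℂ] ℂ))‖

theorem scalarNorm_nonneg (p : ℝ≥0∞) [Fact (1 ≤ p)] {n : ℕ} (z : Matrix (Fin n) (Fin n) ℂ) :
    0 ≤ scalarNorm p z := norm_nonneg _

/-- The p-th power of the norm of a tuple of functions is the integral of the p-th powers of the
pointwise ℓ_p^n norms, and the matrix bound holds at almost every point. -/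
theorem norm_Lp_scalar_le {p : ℝ≥0∞} [Fact (1 ≤ p)] (hp : p ≠ ∞) {X : Type v} [MeasurableSpace X]
    {μ : Measure X} {n : ℕ} (z : Matrix (Fin n) (Fin n) ℂ)
    (f : PiLp p (fun _ : Fin n => Lp ℂ p μ)) :
    ‖(WithLp.toLp p fun i => ∑ j, z i j • f j : PiLp p (fun _ : Fin n => Lp ℂ p μ))‖ ≤
      scalarNorm p z * ‖f‖ := by
  have hp0 : 0 < p.toReal := p.toReal_pos_iff_ne_top.2 hp
  have hp1 : p ≠ 0 := (zero_lt_one.trans_le Fact.out).ne'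
  have hLp : ∀ g : Lp ℂ p μ, ‖g‖ₑ ^ p.toReal = ∫⁻ a, ‖g a‖ₑ ^ p.toReal ∂μ := fun g => by
    rw [Lp.enorm_def, eLpNorm_eq_eLpNorm' hp1 hp, lintegral_rpow_enorm_eq_rpow_eLpNorm' hp0]
  have hmeas : ∀ g : Lp ℂ p μ, AEMeasurable (fun a => ‖g a‖ₑ ^ p.toReal) μ := fun g =>
    (Lp.aestronglyMeasurable g).enorm.pow_const _
  have hpt : ∀ c : PiLp p (fun _ : Fin n => ℂ), ∑ i, ‖∑ j, z i j * c j‖ₑ ^ p.toReal ≤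
      ‖scalarNorm p z‖ₑ ^ p.toReal * ∑ j, ‖c j‖ₑ ^ p.toReal := by
    intro c
    rw [← piLp_enorm_rpow hp, ← ENNReal.mul_rpow_of_nonneg _ _ hp0.le]
    have h1 := piLp_enorm_rpow hp (matOp p (z.map fun z => z • (1 : ℂ →L[ℂ] ℂ)) c)
    have h2 : ∀ i, matOp p (z.map fun z => z • (1 : ℂ →L[ℂ] ℂ)) c i = ∑ j, z i j * c j := by
      intro i
      rw [matOp_apply]
      rfl
    simp only [h2] at h1
    rw [← h1]
    refine ENNReal.rpow_le_rpow ?_ hp0.le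
    rw [← ofReal_norm, ← ofReal_norm, ← ofReal_norm, ← ENNReal.ofReal_mul (norm_nonneg _),
      Real.norm_of_nonneg (scalarNorm_nonneg p z)]
    exact ENNReal.ofReal_le_ofReal (ContinuousLinearMap.le_opNorm _ _)
  have key : ∑ i, ‖∑ j, z i j • f j‖ₑ ^ p.toReal ≤
      ‖scalarNorm p z‖ₑ ^ p.toReal * ∑ j, ‖f j‖ₑ ^ p.toReal := by
    simp only [hLp]
    rw [← lintegral_finsetSum' _ fun i _ => hmeas _, ← lintegral_finsetSum' _ fun i _ => hmeas _,
      ← lintegral_const_mul' _ _ (ENNReal.rpow_ne_top_of_nonneg hp0.le enorm_ne_top)]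
    refine lintegral_mono_ae ?_
    have h1 : ∀ᵐ a ∂μ, ∀ i, (∑ j, z i j • f j : Lp ℂ p μ) a = ∑ j, (z i j • f j : Lp ℂ p μ) a := by
      refine ae_all_iff.2 fun i => ?_
      filter_upwards [Lp.coeFn_finsetSum Finset.univ fun j => z i j • f j] with a ha
      rw [ha, Finset.sum_apply]
    have h2 : ∀ᵐ a ∂μ, ∀ i j, (z i j • f j : Lp ℂ p μ) a = z i j * f j a := by
      refine ae_all_iff.2 fun i => ae_all_iff.2 fun j => ?_
      filter_upwards [Lp.coeFn_smul (z i j) (f j)] with a ha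
      rw [ha]
      rfl
    filter_upwards [h1, h2] with a h1 h2
    simp only [h1, h2]
    exact hpt (WithLp.toLp p fun j => f j a)
  have h3 := piLp_enorm_rpow hp
    (WithLp.toLp p fun i => ∑ j, z i j • f j : PiLp p (fun _ : Fin n => Lp ℂ p μ))
  rw [← piLp_enorm_rpow hp f, ← ENNReal.mul_rpow_of_nonneg _ _ hp0.le] at key
  have h4 := (ENNReal.rpow_le_rpow_iff hp0).1 (h3.trans_le key)
  rw [← ofReal_norm, ← ofReal_norm, ← ofReal_norm, ← ENNReal.ofReal_mul (norm_nonneg _),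
    Real.norm_of_nonneg (scalarNorm_nonneg p z)] at h4
  exact (ENNReal.ofReal_le_ofReal_iff (mul_nonneg (scalarNorm_nonneg p z) (norm_nonneg _))).1 h4

variable {E : Type u} [NormedAddCommGroup E] [NormedSpace ℂ E]

/-- Scalar matrices commute with quotient maps and with inclusions of subspaces. Choosing
representatives in L_p of norm within δ of the quotient norm transfers the L_p estimate to E, and δ
→ 0 removes the error. -/
theorem norm_matOp_scalar_le {p : ℝ≥0∞} [Fact (1 ≤ p)] (hp : p ≠ ∞) (hE : IsSQpSpace.{u, v} p E)
    {n : ℕ} (z : Matrix (Fin n) (Fin n) ℂ) :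
    ‖matOp p (z.map fun z => z • (1 : E →L[ℂ] E))‖ ≤ scalarNorm p z := by
  obtain ⟨X, _, μ, M, F, -, -, ⟨φ⟩⟩ := hE
  obtain ⟨ψ, hψ⟩ : ∃ ψ : E →ₗ[ℂ] (Lp ℂ p μ ⧸ M), ∀ x, ‖ψ x‖ = ‖x‖ :=
    ⟨F.subtype ∘ₗ φ.toLinearEquiv.toLinearMap, fun x => φ.norm_map x⟩
  refine ContinuousLinearMap.opNorm_le_bound _ (scalarNorm_nonneg p z) fun x => ?_
  have key : ∀ δ : ℝ, 0 < δ → ‖matOp p (z.map fun z => z • (1 : E →L[ℂ] E)) x‖ ≤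
      scalarNorm p z * (‖x‖ + δ * ‖(WithLp.toLp p fun _ => 1 : PiLp p (fun _ : Fin n => ℝ))‖) := by
    intro δ hδ
    choose f hf hfn using fun j => Submodule.Quotient.norm_mk_lt (ψ (x j)) hδ
    have h1 : ‖matOp p (z.map fun z => z • (1 : E →L[ℂ] E)) x‖ ≤
        ‖(WithLp.toLp p fun i => ∑ j, z i j • f j : PiLp p (fun _ : Fin n => Lp ℂ p μ))‖ := by
      refine piLp_norm_mono p _ _ fun i => ?_
      have h2 : matOp p (z.map fun z => z • (1 : E →L[ℂ] E)) x i = ∑ j, z i j • x j := by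
        rw [matOp_apply]
        rfl
      have h3 : ψ (∑ j, z i j • x j) =
          Submodule.Quotient.mk (∑ j, z i j • f j) := by
        rw [map_sum, ← Submodule.mkQ_apply, map_sum]
        refine Finset.sum_congr rfl fun j _ => ?_
        rw [map_smul, map_smul, Submodule.mkQ_apply, hf]
      rw [h2, ← hψ, h3]
      exact Submodule.Quotient.norm_mk_le M _
    have h4 : ‖(WithLp.toLp p f : PiLp p (fun _ : Fin n => Lp ℂ p μ))‖ ≤
        ‖x‖ + δ * ‖(WithLp.toLp p fun _ => 1 : PiLp p (fun _ : Fin n => ℝ))‖ := by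
      have h5 : ‖(WithLp.toLp p f : PiLp p (fun _ : Fin n => Lp ℂ p μ))‖ ≤
          ‖(WithLp.toLp p fun j => ‖x j‖ : PiLp p (fun _ : Fin n => ℝ)) +
            δ • (WithLp.toLp p fun _ => 1 : PiLp p (fun _ : Fin n => ℝ))‖ := by
        refine piLp_norm_mono p _ _ fun j => ?_
        have h6 := (hfn j).le
        rw [hψ] at h6
        refine h6.trans ?_
        simp only [PiLp.add_apply, PiLp.smul_apply, smul_eq_mul, mul_one]
        exact le_abs_self _
      refine h5.trans ((norm_add_le _ _).trans (add_le_add ?_ ?_))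
      · exact piLp_norm_mono p _ _ fun j => by simp
      · rw [norm_smul, Real.norm_of_nonneg hδ.le]
    refine h1.trans ((norm_Lp_scalar_le hp z (WithLp.toLp p f)).trans ?_)
    exact mul_le_mul_of_nonneg_left h4 (scalarNorm_nonneg p z)
  have hlim : Filter.Tendsto (fun δ : ℝ => scalarNorm p z * (‖x‖ + δ *
      ‖(WithLp.toLp p fun _ => 1 : PiLp p (fun _ : Fin n => ℝ))‖)) (𝓝[>] 0)
      (𝓝 (scalarNorm p z * ‖x‖)) := by
    have : Continuous fun δ : ℝ => scalarNorm p z * (‖x‖ + δ *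
      ‖(WithLp.toLp p fun _ => 1 : PiLp p (fun _ : Fin n => ℝ))‖) := by fun_prop
    have h := this.tendsto 0
    simp only [zero_mul, add_zero] at h
    exact h.mono_left nhdsWithin_le_nhds
  exact ge_of_tendsto hlim (Filter.eventually_of_mem self_mem_nhdsWithin key)

end Scalars


/-! ### Lifting with control of norm and propagation -/

namespace OpAlg

variable {E : Type u} [NormedAddCommGroup E] [NormedSpace ℂ E] (p : ℝ≥0∞) [Fact (1 ≤ p)]
  (A : OpAlg E)

/-- The matrices over `Ã` with entries in `A_r + ℂ1`. -/
noncomputable def matFil (n : ℕ) (r : ℝ) : Submodule ℂ ((A.tilde p).Mat n) where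
  carrier := {X | ∀ i j, X i j ∈ (A.tilde p).fil r}
  add_mem' hX hY i j := add_mem (hX i j) (hY i j)
  zero_mem' _ _ := zero_mem _
  smul_mem' c _ hX i j := Submodule.smul_mem _ c (hX i j)

variable {p A}

theorem one_mem_fil (r : ℝ) : (1 : A.Tilde) ∈ (A.tilde p).fil r :=
  ⟨0, zero_mem _, 1, by simp⟩

theorem one_mem_matFil (n : ℕ) (r : ℝ) : (1 : (A.tilde p).Mat n) ∈ A.matFil p n r := by
  intro i j
  rcases eq_or_ne i j with rfl | h
  · rw [Matrix.one_apply_eq]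
    exact one_mem_fil r
  · rw [Matrix.one_apply_ne h]
    exact zero_mem ((A.tilde p).fil r)

theorem matFil_mono {n : ℕ} {r r' : ℝ} (hr : 0 < r) (h : r ≤ r') :
    A.matFil p n r ≤ A.matFil p n r' := fun _ hX i j => (A.tilde p).fil_mono r r' hr h (hX i j)

end OpAlg

namespace IsFilteredSQpAlg

variable {E : Type u} [NormedAddCommGroup E] [NormedSpace ℂ E] {p : ℝ≥0∞} [Fact (1 ≤ p)]
  {A : OpAlg E} (H : IsFilteredSQpAlg.{u, v} p A)
include H

theorem norm_unit_le : ‖A.unit‖ ≤ 1 := by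
  unfold OpAlg.unit
  split_ifs with h
  · exact H.norm_unit _ h.choose_spec
  · exact ContinuousLinearMap.norm_id_le

theorem mul_mem_fil {r s : ℝ} (hr : 0 < r) (hs : 0 < s) {x y : A.Tilde}
    (hx : x ∈ (A.tilde p).fil r) (hy : y ∈ (A.tilde p).fil s) :
    x * y ∈ (A.tilde p).fil (r + s) := by
  obtain ⟨a, ha, z, hx⟩ := hx
  obtain ⟨b, hb, w, hy⟩ := hy
  refine ⟨a * b + w • a + z • b, ?_, z * w, ?_⟩
  · exact add_mem (add_mem (H.fil_mul r s hr hs a ha b hb)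
      (Submodule.smul_mem _ _ (A.fil_mono r _ hr (by linarith) ha)))
      (Submodule.smul_mem _ _ (A.fil_mono s _ hs (by linarith) hb))
  · rw [A.val_mul, hx, hy]
    simp only [add_mul, mul_add, smul_mul_assoc, mul_smul_comm, A.unit_mul (H.fil_le s hs b hb),
      A.mul_unit (H.fil_le r hr a ha), A.unit_mul_unit]
    module

theorem mul_mem_matFil {n : ℕ} {r s : ℝ} (hr : 0 < r) (hs : 0 < s) {X Y : (A.tilde p).Mat n}
    (hX : X ∈ A.matFil p n r) (hY : Y ∈ A.matFil p n s) : X * Y ∈ A.matFil p n (r + s) := by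
  intro i j
  rw [Matrix.mul_apply]
  exact Submodule.sum_mem _ fun k _ => H.mul_mem_fil hr hs (hX i k) (hY k j)

end IsFilteredSQpAlg

namespace ClosedIdeal

variable {E : Type u} [NormedAddCommGroup E] [NormedSpace ℂ E] (p : ℝ≥0∞) [Fact (1 ≤ p)]
  {A : OpAlg E} (J : ClosedIdeal A)

/-- The matrices over `Ã` with entries in `J`. -/
noncomputable def matIdeal (n : ℕ) : Submodule ℂ ((A.tilde p).Mat n) where
  carrier := {X | ∀ i j, A.val (X i j) ∈ J.alg}
  add_mem' hX hY i j := add_mem (hX i j) (hY i j)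
  zero_mem' _ _ := zero_mem J.alg
  smul_mem' c _ hX i j := SMulMemClass.smul_mem c (hX i j)

/-- The matrices over `Ã` with entries in `J_r`. -/
noncomputable def matFil (n : ℕ) (r : ℝ) : Submodule ℂ ((A.tilde p).Mat n) where
  carrier := {X | ∀ i j, A.val (X i j) ∈ J.opAlg.fil r}
  add_mem' hX hY i j := add_mem (hX i j) (hY i j)
  zero_mem' _ _ := zero_mem (J.opAlg.fil r)
  smul_mem' c _ hX i j := (J.opAlg.fil r).smul_mem c (hX i j)

theorem matFil_le_matIdeal (n : ℕ) (r : ℝ) : J.matFil p n r ≤ J.matIdeal p n :=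
  fun _ hX i j => (hX i j).2

theorem matFil_mono {n : ℕ} {r r' : ℝ} (hr : 0 < r) (h : r ≤ r') :
    J.matFil p n r ≤ J.matFil p n r' := fun _ hX i j => J.opAlg.fil_mono r r' hr h (hX i j)

theorem mem_matIdeal_iff {n : ℕ} {X : (A.tilde p).Mat n} :
    X ∈ J.matIdeal p n ↔ J.mkMat p n X = 0 := (J.mkMat_eq_zero_iff p X).symm

variable {p J}

theorem IsCompletelyFiltered.exists_lt {C : ℝ} (hC : 1 ≤ C) (hJ : J.IsCompletelyFiltered p C)
    {n : ℕ} {r δ : ℝ} (hr : 0 < r) {a y : Matrix (Fin n) (Fin n) (E →L[ℂ] E)}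
    (ha : ∀ i j, a i j ∈ A.fil r) (hy : ∀ i j, y i j ∈ J.alg) (h : ‖matOp p (a + y)‖ < δ) :
    ∃ y' : Matrix (Fin n) (Fin n) (E →L[ℂ] E), (∀ i j, y' i j ∈ J.opAlg.fil r) ∧
      ‖matOp p (a + y')‖ < C * δ := by
  have h1 := hJ n r hr a ha
  have h2 : sInf {t : ℝ | ∃ y : Matrix (Fin n) (Fin n) (E →L[ℂ] E),
      (∀ i j, y i j ∈ J.alg) ∧ t = ‖matOp p (a + y)‖} ≤ ‖matOp p (a + y)‖ :=
    csInf_le ⟨0, by rintro _ ⟨y, -, rfl⟩; exact norm_nonneg _⟩ ⟨y, hy, rfl⟩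
  have h3 := h1.trans_lt (mul_lt_mul_of_pos_left (h2.trans_lt h) (by linarith : 0 < C))
  have h0 : {t : ℝ | ∃ y : Matrix (Fin n) (Fin n) (E →L[ℂ] E),
      (∀ i j, y i j ∈ J.opAlg.fil r) ∧ t = ‖matOp p (a + y)‖}.Nonempty :=
    ⟨_, 0, fun _ _ => zero_mem (J.opAlg.fil r), rfl⟩
  obtain ⟨_, ⟨y', hy', rfl⟩, h4⟩ := exists_lt_of_csInf_lt h0 h3
  exact ⟨y', hy', h4⟩

theorem exists_matFil_of_val {n : ℕ} {r : ℝ} (y : Matrix (Fin n) (Fin n) (E →L[ℂ] E))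
    (hy : ∀ i j, y i j ∈ J.opAlg.fil r) :
    ∃ Y ∈ J.matFil p n r, (Y : Matrix (Fin n) (Fin n) A.Tilde).map A.val = y := by
  have h : ∀ i j, y i j ∈ A.tildeAlg := fun i j => ⟨y i j, J.le _ (hy i j).2, 0, by simp⟩
  refine ⟨Matrix.of fun i j => show A.Tilde from Subtype.mk (y i j) (h i j),
    fun i j => hy i j, ?_⟩
  ext1 i j
  rfl

/-- A matrix over `Ã_r` that is small modulo `J` is close to a matrix over `J_r`. -/
theorem IsCompletelyFiltered.exists_correction [CompleteSpace E] (hp : p ≠ ∞) {C : ℝ} (hC : 1 ≤ C)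
    (H : IsFilteredSQpAlg.{u, v} p A) (hJ : J.IsCompletelyFiltered p C) {n : ℕ} {r δ : ℝ}
    (hr : 0 < r) {X : (A.tilde p).Mat n} (hX : X ∈ A.matFil p n r) (h : ‖J.mkMat p n X‖ < δ) :
    ∃ Y ∈ J.matFil p n r, ‖X - Y‖ < (2 * C + 1) * δ := by
  have hδ : 0 < δ := (norm_nonneg _).trans_lt h
  obtain ⟨X', hX', hδ'⟩ := (J.norm_lt_iff p).1 h
  have hd : ∀ i j, A.val ((X' - X) i j) ∈ J.alg :=
    (J.mkMat_eq_zero_iff p (X' - X)).1 (by rw [map_sub, hX', sub_self])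
  -- If A is unital, its identity lies in A_r, so entries of X are already in A_r and the hypothesis
  -- applies with constant C.
  by_cases hA : A.IsUnital
  · have hu : A.unit ∈ A.fil r := by
      unfold OpAlg.unit
      rw [dif_pos hA]
      exact H.unit_mem _ hA.choose_spec r hr
    have ha : ∀ i j, (Matrix.map X A.val) i j ∈ A.fil r := by
      intro i j
      obtain ⟨a, ha, z, hx⟩ := hX i j
      change A.val (X i j) ∈ A.fil r
      rw [hx]
      exact add_mem ha (Submodule.smul_mem _ _ hu)
    have h1 : Matrix.map X A.val + Matrix.map (X' - X) A.val = Matrix.map X' A.val := by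
      ext1 i j
      change A.val (X i j) + (A.val (X' i j) - A.val (X i j)) = A.val (X' i j)
      abel
    obtain ⟨y, hy, hlt⟩ := hJ.exists_lt hC hr (y := Matrix.map (X' - X) A.val) ha hd (δ := δ) (by rw [h1]; exact hδ')
    obtain ⟨Y, hY, rfl⟩ := exists_matFil_of_val (p := p) y hy
    refine ⟨-Y, neg_mem hY, ?_⟩
    have h2 : ‖X - -Y‖ = ‖matOp p (Matrix.map X A.val + Matrix.map Y A.val)‖ := by
      rw [sub_neg_eq_add]
      rfl
    rw [h2]
    refine hlt.trans_le ?_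
    gcongr
    linarith
  -- If A is nonunital, the hypothesis applies only to the part of X over A_r. The scalar part z
  -- equals that of the short lift X', so it has norm below δ: removing it leaves a lift of norm
  -- below 2δ, and restoring it after the correction adds δ, whence 2Cδ + δ.
  · choose a ha z hx using hX
    rw [A.unit_of_not hA] at hx
    have hz : (Matrix.map X (A.character hA)) = Matrix.of z := by
      ext i j
      exact A.coeff_eq hA (H.fil_le r hr _ (ha i j)) (hx i j)
    have hz' : (Matrix.map X' (A.character hA)) = Matrix.of z := by
      rw [← hz]
      ext i j
      have h0 : A.character hA (X' i j - X i j) = 0 :=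
        A.character_eq_zero hA (J.le _ (hd i j))
      exact sub_eq_zero.1 ((map_sub (A.character hA) (X' i j) (X i j)).symm.trans h0)
    have hzn : ‖matOp p ((Matrix.of z).map fun z => z • (1 : E →L[ℂ] E))‖ ≤ ‖X'‖ := by
      refine (norm_matOp_scalar_le hp H.space _).trans ?_
      rw [← hz']
      exact A.norm_character_le p hA n X'
    have h1 : Matrix.of a + Matrix.map (X' - X) A.val =
        Matrix.map X' A.val + (-1 : ℂ) • (Matrix.of z).map fun z => z • (1 : E →L[ℂ] E) := by
      ext1 i j
      change a i j + (A.val (X' i j) - A.val (X i j)) = A.val (X' i j) + (-1 : ℂ) • (z i j • 1)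
      rw [hx]
      module
    have h2 : ‖matOp p (Matrix.of a + Matrix.map (X' - X) A.val)‖ < 2 * δ := by
      rw [h1, matOp_add, matOp_smul]
      refine (norm_add_le _ _).trans_lt ?_
      rw [norm_smul, norm_neg, norm_one, one_mul]
      have h3 : ‖matOp p (Matrix.map X' A.val)‖ < δ := hδ'
      have h4 : ‖X'‖ < δ := hδ'
      linarith
    obtain ⟨y, hy, hlt⟩ := hJ.exists_lt hC hr (a := Matrix.of a)
      (y := Matrix.map (X' - X) A.val) ha hd h2
    obtain ⟨Y, hY, rfl⟩ := exists_matFil_of_val (p := p) y hy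
    refine ⟨-Y, neg_mem hY, ?_⟩
    have h5 : ‖X - -Y‖ = ‖matOp p ((Matrix.of a + Matrix.map Y A.val) +
        (Matrix.of z).map fun z => z • (1 : E →L[ℂ] E))‖ := by
      rw [sub_neg_eq_add]
      change ‖matOp p (Matrix.map (X + Y) A.val)‖ = _
      congr 2
      ext1 i j
      change A.val (X i j) + A.val (Y i j) = a i j + A.val (Y i j) + z i j • 1
      rw [hx]
      abel
    rw [h5, matOp_add]
    refine (norm_add_le _ _).trans_lt ?_
    have h4 : ‖X'‖ < δ := hδ'
    linarith

/-- An entrywise lift with the right propagation exists but has no norm bound; subtracting a matrix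
over J_r close to it keeps the propagation and the class and makes it short. -/
theorem IsCompletelyFiltered.exists_lift [CompleteSpace E] (hp : p ≠ ∞) {C : ℝ} (hC : 1 ≤ C)
    (H : IsFilteredSQpAlg.{u, v} p A) (hJ : J.IsCompletelyFiltered p C) {n : ℕ} {r δ : ℝ}
    (hr : 0 < r) {x : (J.quot p).Mat n} (hx : ∀ i j, x i j ∈ (J.quot p).fil r) (h : ‖x‖ < δ) :
    ∃ X ∈ A.matFil p n r, J.mkMat p n X = x ∧ ‖X‖ < (2 * C + 1) * δ := by
  have h0 : ∀ i j, ∃ X ∈ (A.tilde p).fil r, Ideal.Quotient.mk J.tildeIdeal X = x i j :=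
    fun i j => hx i j
  choose X hX hXx using h0
  obtain ⟨X₀, hX₀, hX'⟩ : ∃ X₀ ∈ A.matFil p n r, J.mkMat p n X₀ = x :=
    ⟨Matrix.of X, hX, by ext i j; exact hXx i j⟩
  obtain ⟨Y, hY, hlt⟩ := hJ.exists_correction hp hC H hr hX₀ (by rw [hX']; exact h)
  have hY' : Y ∈ A.matFil p n r := fun i j => ⟨A.val (Y i j), (hY i j).1, 0, by simp⟩
  refine ⟨X₀ - Y, Submodule.sub_mem _ hX₀ hY', ?_, hlt⟩
  rw [map_sub, hX', (J.mem_matIdeal_iff p).1 (J.matFil_le_matIdeal p n r hY), sub_zero]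

end ClosedIdeal


/-! ### The idempotent attached to a pair of lifts -/

section RelIdem

variable {R : Type u} [Ring R] {n m : ℕ}

/-- For lifts `U`, `V` of mutually inverse matrices, the difference
`w diag(1, 0) w⁻¹ - diag(1, 0)`, where `w` is the lift `liftUnit U V` of `diag(u, u⁻¹)`. -/
def relIdem (U V : Matrix (Fin n) (Fin n) R) : Matrix (Fin (n + n)) (Fin (n + n)) R :=
  blk (-((1 - U * V) * (1 - U * V))) ((U + U - U * V * U) * (1 - V * U)) ((1 - V * U) * V)
    ((1 - V * U) * (1 - V * U))

/-- An invertible lift of `diag(u, u⁻¹)`. -/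
def liftUnit (U V : Matrix (Fin n) (Fin n) R) : Matrix (Fin (n + n)) (Fin (n + n)) R :=
  blk (U + U - U * V * U) (U * V - 1) (1 - V * U) V

/-- The inverse of `liftUnit U V`. -/
def liftUnitInv (U V : Matrix (Fin n) (Fin n) R) : Matrix (Fin (n + n)) (Fin (n + n)) R :=
  blk V (1 - V * U) (U * V - 1) (U + U - U * V * U)

/-- No relation between U and V is needed, since `liftUnit U V` is the product of the elementary
matrices (1, U; 0, 1), (1, 0; -V, 1), (1, U; 0, 1) and the rotation (0, -1; 1, 0). -/
theorem liftUnit_mul_inv (U V : Matrix (Fin n) (Fin n) R) :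
    liftUnit U V * liftUnitInv U V = 1 := by
  rw [liftUnit, liftUnitInv, blk_mul, ← blk_one]
  congr 1 <;> noncomm_ring

theorem liftUnitInv_mul (U V : Matrix (Fin n) (Fin n) R) :
    liftUnitInv U V * liftUnit U V = 1 := by
  rw [liftUnit, liftUnitInv, blk_mul, ← blk_one]
  congr 1 <;> noncomm_ring

theorem cornerProj_eq_blk : cornerProj R n = blk 1 0 0 0 := rfl

theorem liftUnit_mul_cornerProj_mul (U V : Matrix (Fin n) (Fin n) R) :
    liftUnit U V * cornerProj R n * liftUnitInv U V = cornerProj R n + relIdem U V := by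
  rw [liftUnit, liftUnitInv, relIdem, cornerProj_eq_blk, blk_mul, blk_mul, blk_add]
  congr 1 <;> noncomm_ring

theorem cornerProj_add_relIdem_mul_self (U V : Matrix (Fin n) (Fin n) R) :
    (cornerProj R n + relIdem U V) * (cornerProj R n + relIdem U V) =
      cornerProj R n + relIdem U V := by
  rw [← liftUnit_mul_cornerProj_mul]
  calc _ = liftUnit U V * (cornerProj R n * (liftUnitInv U V * liftUnit U V) * cornerProj R n) *
        liftUnitInv U V := by simp only [mul_assoc]
    _ = _ := by rw [liftUnitInv_mul, mul_one, cornerProj_mul_self]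

theorem relIdem_one_one : relIdem (1 : Matrix (Fin n) (Fin n) R) 1 = 0 := by
  simp only [relIdem, mul_one, sub_self, mul_zero, neg_zero]
  exact bdiag_zero

/-- The exchange of the two middle blocks. -/
def midSwap (n m : ℕ) : Fin ((n + m) + (n + m)) ≃ Fin ((n + n) + (m + m)) :=
  ((finSumFinEquiv.symm.trans (Equiv.sumCongr finSumFinEquiv.symm finSumFinEquiv.symm)).trans
    (Equiv.sumSumSumComm _ _ _ _)).trans
      ((Equiv.sumCongr finSumFinEquiv finSumFinEquiv).trans finSumFinEquiv)

theorem blk_bdiag (a b c d : Matrix (Fin n) (Fin n) R) (a' b' c' d' : Matrix (Fin m) (Fin m) R) :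
    blk (bdiag a a') (bdiag b b') (bdiag c c') (bdiag d d') =
      (bdiag (blk a b c d) (blk a' b' c' d')).submatrix (midSwap n m) (midSwap n m) := by
  have e1 : ∀ x, Equiv.sumSumSumComm (Fin n) (Fin m) (Fin n) (Fin m) (.inl (.inl x)) =
    .inl (.inl x) := fun _ => rfl
  have e2 : ∀ x, Equiv.sumSumSumComm (Fin n) (Fin m) (Fin n) (Fin m) (.inl (.inr x)) =
    .inr (.inl x) := fun _ => rfl
  have e3 : ∀ x, Equiv.sumSumSumComm (Fin n) (Fin m) (Fin n) (Fin m) (.inr (.inl x)) =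
    .inl (.inr x) := fun _ => rfl
  have e4 : ∀ x, Equiv.sumSumSumComm (Fin n) (Fin m) (Fin n) (Fin m) (.inr (.inr x)) =
    .inr (.inr x) := fun _ => rfl
  ext i j
  obtain ⟨i, rfl⟩ := finSumFinEquiv.surjective i
  obtain ⟨j, rfl⟩ := finSumFinEquiv.surjective j
  rcases i with i | i <;> rcases j with j | j <;>
    obtain ⟨i, rfl⟩ := finSumFinEquiv.surjective i <;>
    obtain ⟨j, rfl⟩ := finSumFinEquiv.surjective j <;>
    rcases i with i | i <;> rcases j with j | j <;>
    simp only [blk, bdiag, midSwap, Matrix.reindex_apply, Matrix.submatrix_apply,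
      Equiv.trans_apply, Equiv.symm_apply_apply, Equiv.sumCongr_apply, Sum.map_inl, Sum.map_inr,
      e1, e2, e3, e4, Matrix.fromBlocks_apply₁₁, Matrix.fromBlocks_apply₁₂,
      Matrix.fromBlocks_apply₂₁, Matrix.fromBlocks_apply₂₂, Matrix.zero_apply]

theorem relIdem_bdiag (U V : Matrix (Fin n) (Fin n) R) (U' V' : Matrix (Fin m) (Fin m) R) :
    relIdem (bdiag U U') (bdiag V V') =
      (bdiag (relIdem U V) (relIdem U' V')).submatrix (midSwap n m) (midSwap n m) := by
  have h : ∀ (a : Matrix (Fin n) (Fin n) R) (b : Matrix (Fin m) (Fin m) R),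
      -(bdiag a b) = bdiag (-a) (-b) := by
    intro a b
    rw [← zero_sub, ← bdiag_zero, bdiag_sub, zero_sub, zero_sub]
  simp only [relIdem, ← blk_bdiag, bdiag_mul, bdiag_add, bdiag_sub, h, ← bdiag_one]

theorem cornerProj_add_eq :
    cornerProj R (n + m) =
      (bdiag (cornerProj R n) (cornerProj R m)).submatrix (midSwap n m) (midSwap n m) := by
  simp only [cornerProj_eq_blk, ← blk_bdiag, bdiag_one, bdiag_zero]

theorem relIdem_map {R' : Type v} [Ring R'] (f : R →+* R') (U V : Matrix (Fin n) (Fin n) R) :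
    (relIdem U V).map f = relIdem (U.map f) (V.map f) := by
  have h : ∀ X : Matrix (Fin n) (Fin n) R, X.map f = f.mapMatrix X := fun _ => rfl
  rw [relIdem, relIdem, blk_map]
  simp only [h, map_neg, map_mul, map_sub, map_add, map_one]

/-- Each block has a factor 1 - UV or 1 - VU. Applied in the quotient, this places `relIdem` of
lifts of an inverse pair over the ideal. -/
theorem relIdem_of_mul_eq_one {U V : Matrix (Fin n) (Fin n) R} (h : U * V = 1) (h' : V * U = 1) :
    relIdem U V = 0 := by
  simp only [relIdem, h, h', sub_self, mul_zero, zero_mul, neg_zero]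
  exact bdiag_zero

end RelIdem

/-! ### Approximate selections along paths -/

/-- A path can be followed approximately by a continuous choice in a convex set, with prescribed
end points, if this is possible at each point. -/
theorem exists_path_of_convex {X Z : Type*} [SeminormedAddCommGroup X] [NormedSpace ℝ X]
    [SeminormedAddCommGroup Z] [NormedSpace ℝ Z] (L : X →ₗ[ℝ] Z) {K : Set X} (hK : Convex ℝ K)
    {f : unitInterval → Z} (hf : Continuous f) {D : ℝ} (h : ∀ t, ∃ x ∈ K, ‖f t - L x‖ < D)
    {x₀ x₁ : X} (h₀ : x₀ ∈ K) (h₀' : ‖f 0 - L x₀‖ < D) (h₁ : x₁ ∈ K) (h₁' : ‖f 1 - L x₁‖ < D) :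
    ∃ γ : unitInterval → X, Continuous γ ∧ (∀ t, γ t ∈ K) ∧ (∀ t, ‖f t - L (γ t)‖ < D) ∧
      γ 0 = x₀ ∧ γ 1 = x₁ := by
  -- The end point conditions are part of the convex sets, so that gluing cannot move the end
  -- points.
  set T : unitInterval → Set X := fun t =>
    {x | (x ∈ K ∧ L x ∈ Metric.ball (f t) D) ∧ (t = 0 → x = x₀) ∧ (t = 1 → x = x₁)} with hT
  have hconv : ∀ t, Convex ℝ (T t) := by
    intro t x hx y hy a b ha hb hab
    refine ⟨⟨hK hx.1.1 hy.1.1 ha hb hab, ?_⟩, fun h0 => ?_, fun h1 => ?_⟩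
    · have := convex_ball (f t) D hx.1.2 hy.1.2 ha hb hab
      rwa [map_add, map_smul, map_smul]
    · rw [hx.2.1 h0, hy.2.1 h0, ← add_smul, hab, one_smul]
    · rw [hx.2.2 h1, hy.2.2 h1, ← add_smul, hab, one_smul]
  have hev : ∀ (t : unitInterval) (x : X), ‖f t - L x‖ < D →
      ∀ᶠ s in 𝓝 t, L x ∈ Metric.ball (f s) D := by
    intro t x hx
    have hc : Continuous fun s => ‖f s - L x‖ := (hf.sub continuous_const).norm
    filter_upwards [hc.continuousAt.eventually (gt_mem_nhds hx)] with s hs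
    rwa [Metric.mem_ball, dist_comm, dist_eq_norm]
  -- A constant choice stays admissible nearby because the distance condition is strict. At an end
  -- point the constant is the prescribed one; elsewhere the neighbourhood avoids both ends and the
  -- extra conditions are vacuous.
  have hloc : ∀ t : unitInterval, ∃ c, ∀ᶠ s in 𝓝 t, c ∈ T s := by
    intro t
    by_cases t0 : t = 0
    · subst t0
      refine ⟨x₀, ?_⟩
      filter_upwards [hev 0 x₀ h₀', isOpen_ne.mem_nhds (zero_ne_one (α := unitInterval))]
        with s hs hs1
      exact ⟨⟨h₀, hs⟩, fun _ => rfl, fun h => absurd h hs1⟩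
    by_cases t1 : t = 1
    · subst t1
      refine ⟨x₁, ?_⟩
      filter_upwards [hev 1 x₁ h₁', isOpen_ne.mem_nhds (one_ne_zero (α := unitInterval))]
        with s hs hs1
      exact ⟨⟨h₁, hs⟩, fun h => absurd h hs1, fun _ => rfl⟩
    obtain ⟨x, hx, hx'⟩ := h t
    refine ⟨x, ?_⟩
    filter_upwards [hev t x hx', isOpen_ne.mem_nhds t0, isOpen_ne.mem_nhds t1] with s hs hs0 hs1
    exact ⟨⟨hx, hs⟩, fun h => absurd h hs0, fun h => absurd h hs1⟩
  obtain ⟨g, hg⟩ := exists_continuous_forall_mem_convex_of_local_const hconv hloc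
  refine ⟨g, g.continuous, fun t => (hg t).1.1, fun t => ?_, (hg 0).2.1 rfl, (hg 1).2.2 rfl⟩
  have := (hg t).1.2
  rwa [Metric.mem_ball, dist_comm, dist_eq_norm] at this


/-! ### Passing between `J̃` and `Ã` -/

namespace ClosedIdeal

variable {E : Type u} [NormedAddCommGroup E] [NormedSpace ℂ E] (p : ℝ≥0∞) [Fact (1 ≤ p)]
  {A : OpAlg E} (J : ClosedIdeal A)

theorem mem_tildeAlg_of_mem {a : E →L[ℂ] E} (ha : a ∈ J.alg) : a ∈ J.opAlg.tildeAlg :=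
  ⟨a, ha, 0, by simp⟩

/-- Matrices over the ideal, viewed over `J̃`. -/
noncomputable def toTilde (n : ℕ) : J.matIdeal p n →ₗᵢ[ℂ] (J.opAlg.tilde p).Mat n where
  toFun Y := Matrix.of fun i j =>
    show J.opAlg.Tilde from Subtype.mk (A.val (Y.1 i j)) (J.mem_tildeAlg_of_mem (Y.2 i j))
  map_add' _ _ := rfl
  map_smul' _ _ := rfl
  norm_map' _ := rfl

variable {p}

theorem val_toTilde {n : ℕ} (Y : J.matIdeal p n) (i j : Fin n) :
    J.opAlg.val (J.toTilde p n Y i j) = A.val (Y.1 i j) := rfl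

/-- The matrix `diag(1, 0) + y` over `J̃`. -/
noncomputable def addCorner {n : ℕ} (Y : J.matIdeal p (n + n)) : (J.opAlg.tilde p).Mat (n + n) :=
  cornerProj (J.opAlg.tilde p).carrier n + J.toTilde p (n + n) Y

theorem opAlg_unit (hJ : ¬ J.opAlg.IsUnital) : J.opAlg.unit = 1 := J.opAlg.unit_of_not hJ

theorem val_mul_unit_mem {x : J.opAlg.Tilde} (hJ : ¬ J.opAlg.IsUnital) :
    ∃ a ∈ J.alg, ∃ z : ℂ, J.opAlg.val x = a + z • 1 ∧
      J.opAlg.val x * A.unit = a + z • A.unit := by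
  obtain ⟨a, ha, h⟩ := J.opAlg.coeff_spec x
  rw [J.opAlg_unit hJ] at h
  refine ⟨a, ha, _, h, ?_⟩
  rw [h, add_mul, A.mul_unit (J.le a ha), smul_mul_assoc, one_mul]

/-- The unital homomorphism `J̃ → Ã` that extends the inclusion of a nonunital ideal. -/
noncomputable def tildeHom (hJ : ¬ J.opAlg.IsUnital) : J.opAlg.Tilde →+* A.Tilde where
  -- The unit of J̃ is the identity operator, whereas that of Ã may be a proper idempotent;
  -- multiplying by `A.unit` corrects this and fixes J.
  toFun x := Subtype.mk (J.opAlg.val x * A.unit) <| by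
    obtain ⟨a, ha, z, -, h⟩ := J.val_mul_unit_mem (x := x) hJ
    exact ⟨a, J.le a ha, z, h⟩
  map_one' := by
    apply A.val_injective
    change J.opAlg.unit * A.unit = A.unit
    rw [J.opAlg_unit hJ, one_mul]
  map_zero' := A.val_injective (zero_mul _)
  map_add' x y := A.val_injective (add_mul _ _ _)
  map_mul' x y := by
    apply A.val_injective
    change J.opAlg.val x * J.opAlg.val y * A.unit =
      J.opAlg.val x * A.unit * (J.opAlg.val y * A.unit)
    obtain ⟨b, hb, w, -, h⟩ := J.val_mul_unit_mem (x := y) hJ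
    rw [mul_assoc, mul_assoc, h]
    congr 1
    rw [mul_add, A.unit_mul (J.le b hb), mul_smul_comm, A.unit_mul_unit]

theorem val_tildeHom (hJ : ¬ J.opAlg.IsUnital) (x : J.opAlg.Tilde) :
    A.val (J.tildeHom hJ x) = J.opAlg.val x * A.unit := rfl

/-- A kernel element a + z1 with z ≠ 0 would put the unit of Ã into J and make J unital. -/
theorem tildeHom_injective (hJ : ¬ J.opAlg.IsUnital) : Function.Injective (J.tildeHom hJ) := by
  rw [injective_iff_map_eq_zero]
  intro x hx
  obtain ⟨a, ha, z, h, h'⟩ := J.val_mul_unit_mem (x := x) hJ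
  have h0 : a + z • A.unit = 0 := by
    rw [← h', ← J.val_tildeHom hJ, hx, A.val_zero]
  rcases eq_or_ne z 0 with rfl | hz
  · apply J.opAlg.val_injective
    rw [h, J.opAlg.val_zero, ← h0, zero_smul, zero_smul]
  · refine absurd ⟨A.unit, ?_, fun b hb => ⟨A.unit_mul (J.le b hb), A.mul_unit (J.le b hb)⟩⟩ hJ
    have : A.unit = (-z⁻¹) • a := by
      rw [eq_neg_of_add_eq_zero_left h0, smul_neg, neg_smul, neg_neg, smul_smul,
        inv_mul_cancel₀ hz, one_smul]
    rw [this]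
    exact SMulMemClass.smul_mem _ ha

variable (p) in
/-- The unital homomorphism `M_n(J̃) → M_n(Ã)`. -/
noncomputable def matHom (hJ : ¬ J.opAlg.IsUnital) (n : ℕ) :
    (J.opAlg.tilde p).Mat n →+* (A.tilde p).Mat n := (J.tildeHom hJ).mapMatrix

theorem matHom_injective (hJ : ¬ J.opAlg.IsUnital) (n : ℕ) :
    Function.Injective (J.matHom p hJ n) := by
  intro X Y h
  ext i j
  exact J.tildeHom_injective hJ (congrFun (congrFun h i) j)

theorem matHom_toTilde (hJ : ¬ J.opAlg.IsUnital) {n : ℕ} (Y : J.matIdeal p n) :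
    J.matHom p hJ n (J.toTilde p n Y) = Y := by
  ext i j
  apply A.val_injective
  exact A.mul_unit (J.le _ (Y.2 i j))

theorem matHom_addCorner (hJ : ¬ J.opAlg.IsUnital) {n : ℕ} (Y : J.matIdeal p (n + n)) :
    J.matHom p hJ (n + n) (J.addCorner Y) = cornerProj (A.tilde p).carrier n + Y := by
  refine (map_add (J.matHom p hJ (n + n)) _ _).trans ?_
  rw [matHom_toTilde]
  congr 1
  exact cornerProj_map _ (map_zero _) (map_one _)

theorem mkMat_cornerProj (n : ℕ) :
    J.mkMat p (n + n) (cornerProj (A.tilde p).carrier n) = cornerProj (J.quot p).carrier n :=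
  cornerProj_map _ (map_zero _) (map_one _)

theorem addCorner_defect_mem {n : ℕ} (Y : J.matIdeal p (n + n)) :
    ((cornerProj (A.tilde p).carrier n + Y : (A.tilde p).Mat (n + n)) * (cornerProj (A.tilde p).carrier n + Y) -
      (cornerProj (A.tilde p).carrier n + Y)) ∈ J.matIdeal p (n + n) := by
  rw [mem_matIdeal_iff, map_sub, map_mul, map_add, (J.mem_matIdeal_iff p).1 Y.2, add_zero,
    mkMat_cornerProj]
  exact sub_eq_zero.2 cornerProj_mul_self

theorem addCorner_mul_self_sub (hJ : ¬ J.opAlg.IsUnital) {n : ℕ} (Y : J.matIdeal p (n + n)) :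
    J.addCorner Y * J.addCorner Y - J.addCorner Y =
      J.toTilde p (n + n) ⟨_, J.addCorner_defect_mem Y⟩ := by
  apply J.matHom_injective hJ (p := p)
  rw [matHom_toTilde, map_sub, map_mul, matHom_addCorner]

/-- The defect lies over the ideal, where the norms inherited from J̃ and Ã coincide; `matHom`
identifies the two defects. Estimates can thus be made in Ã, next to the exact idempotent built from
`relIdem`. -/
theorem norm_addCorner_mul_self_sub (hJ : ¬ J.opAlg.IsUnital) {n : ℕ}
    (Y : J.matIdeal p (n + n)) :
    ‖J.addCorner Y * J.addCorner Y - J.addCorner Y‖ =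
      ‖(cornerProj (A.tilde p).carrier n + Y : (A.tilde p).Mat (n + n)) * (cornerProj (A.tilde p).carrier n + Y) -
      (cornerProj (A.tilde p).carrier n + Y)‖ := by
  rw [J.addCorner_mul_self_sub hJ, LinearIsometry.norm_map]
  rfl

theorem continuous_addCorner {n : ℕ} : Continuous (J.addCorner (p := p) (n := n)) :=
  continuous_const.add (J.toTilde p (n + n)).continuous

/-- Exactness of `diag(1, 0) + y` over `J̃` may be checked over `Ã`. -/
theorem addCorner_mul_self (hJ : ¬ J.opAlg.IsUnital) {n : ℕ} {Y : J.matIdeal p (n + n)}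
    (h : (cornerProj (A.tilde p).carrier n + Y : (A.tilde p).Mat (n + n)) * (cornerProj (A.tilde p).carrier n + Y) =
      cornerProj (A.tilde p).carrier n + Y) : J.addCorner Y * J.addCorner Y = J.addCorner Y := by
  apply J.matHom_injective hJ (p := p)
  rw [map_mul, matHom_addCorner, h]

end ClosedIdeal

/-! ### Estimates for `relIdem` -/

namespace OpAlg

variable {E : Type u} [NormedAddCommGroup E] [NormedSpace ℂ E] (p : ℝ≥0∞) [Fact (1 ≤ p)]
  (A : OpAlg E)

theorem continuous_blk {T : Type*} [TopologicalSpace T] {n : ℕ} {a b c d : T → (A.tilde p).Mat n}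
    (ha : Continuous a) (hb : Continuous b) (hc : Continuous c) (hd : Continuous d) :
    Continuous fun t => (blk (a t) (b t) (c t) (d t) : (A.tilde p).Mat (n + n)) := by
  let θ : (A.tilde p).Mat n × (A.tilde p).Mat n × (A.tilde p).Mat n × (A.tilde p).Mat n →+
      (A.tilde p).Mat (n + n) :=
    { toFun := fun x => blk x.1 x.2.1 x.2.2.1 x.2.2.2
      map_zero' := bdiag_zero
      map_add' := fun x y => (blk_add _ _ _ _ _ _ _ _).symm }
  have hθ : Continuous θ := AddMonoidHomClass.continuous_of_bound θ 2 fun x => by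
    refine (A.norm_blk_le p x.1 x.2.1 x.2.2.1 x.2.2.2).trans ?_
    have h1 : ‖x.1‖ ≤ ‖x‖ := norm_fst_le x
    have h2 : ‖x.2‖ ≤ ‖x‖ := norm_snd_le x
    have h3 : ‖x.2.1‖ ≤ ‖x.2‖ := norm_fst_le x.2
    have h4 : ‖x.2.2‖ ≤ ‖x.2‖ := norm_snd_le x.2
    have h5 : ‖x.2.2.1‖ ≤ ‖x.2.2‖ := norm_fst_le x.2.2
    have h6 : ‖x.2.2.2‖ ≤ ‖x.2.2‖ := norm_snd_le x.2.2
    rw [two_mul]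
    exact add_le_add (max_le h1 (h6.trans (h4.trans h2)))
      (max_le (h3.trans h2) (h5.trans (h4.trans h2)))
  exact hθ.comp (ha.prodMk (hb.prodMk (hc.prodMk hd)))

theorem continuous_relIdem {T : Type*} [TopologicalSpace T] {n : ℕ} {U V : T → (A.tilde p).Mat n}
    (hU : Continuous U) (hV : Continuous V) :
    Continuous fun t => (relIdem (U t) (V t) : (A.tilde p).Mat (n + n)) := by
  unfold relIdem
  apply A.continuous_blk p <;> fun_prop

theorem norm_cornerProj_le (h : ‖A.unit‖ ≤ 1) (n : ℕ) :
    ‖(cornerProj (A.tilde p).carrier n : (A.tilde p).Mat (n + n))‖ ≤ 1 :=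
  (A.norm_bdiag_le p (1 : (A.tilde p).Mat n) (0 : (A.tilde p).Mat n)).trans
    (max_le (A.norm_one_le p h n) (by rw [norm_zero]; exact zero_le_one))

theorem norm_one_sub_cornerProj_le (h : ‖A.unit‖ ≤ 1) (n : ℕ) :
    ‖(1 - cornerProj (A.tilde p).carrier n : (A.tilde p).Mat (n + n))‖ ≤ 1 := by
  have : (1 - cornerProj (A.tilde p).carrier n : (A.tilde p).Mat (n + n)) =
      bdiag (0 : (A.tilde p).Mat n) (1 : (A.tilde p).Mat n) := by
    rw [← bdiag_one]
    refine (bdiag_sub _ _ _ _).trans ?_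
    rw [sub_self, sub_zero]
  rw [this]
  exact (A.norm_bdiag_le p _ _).trans
    (max_le (by rw [norm_zero]; exact zero_le_one) (A.norm_one_le p h n))

end OpAlg

section Seminormed

variable {S : Type*} [SeminormedRing S] {M δ : ℝ} {U V : S}

theorem norm_two_sub_le (hM : 1 ≤ M) (hU : ‖U‖ ≤ M) (hV : ‖V‖ ≤ M) :
    ‖U + U - U * V * U‖ ≤ 3 * M ^ 3 := by
  have h1 : ‖U * V * U‖ ≤ M * M * M :=
    (norm_mul_le _ _).trans (mul_le_mul ((norm_mul_le _ _).trans
      (mul_le_mul hU hV (norm_nonneg _) (by linarith))) hU (norm_nonneg _) (by positivity))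
  have h2 := norm_sub_le (U + U) (U * V * U)
  have h3 := norm_add_le U U
  have h4 : M ≤ M ^ 3 := le_self_pow₀ hM (by norm_num)
  nlinarith

theorem norm_one_sub_mul_le (h1 : ‖(1 : S)‖ ≤ 1) (hM : 1 ≤ M) (hU : ‖U‖ ≤ M) (hV : ‖V‖ ≤ M) :
    ‖1 - U * V‖ ≤ 2 * M ^ 2 := by
  have h2 : ‖U * V‖ ≤ M * M :=
    (norm_mul_le _ _).trans (mul_le_mul hU hV (norm_nonneg _) (by linarith))
  have h3 := norm_sub_le 1 (U * V)
  nlinarith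

end Seminormed

namespace OpAlg

variable {E : Type u} [NormedAddCommGroup E] [NormedSpace ℂ E] (p : ℝ≥0∞) [Fact (1 ≤ p)]
  (A : OpAlg E)

theorem norm_relIdem_le (h : ‖A.unit‖ ≤ 1) {n : ℕ} {M : ℝ} (hM : 1 ≤ M) {U V : (A.tilde p).Mat n}
    (hU : ‖U‖ ≤ M) (hV : ‖V‖ ≤ M) :
    ‖(relIdem U V : (A.tilde p).Mat (n + n))‖ ≤ 10 * M ^ 5 := by
  have h1 := A.norm_one_le p h n
  have hb := norm_one_sub_mul_le h1 hM hV hU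
  have ha := norm_one_sub_mul_le h1 hM hU hV
  have hc := norm_two_sub_le hM hU hV
  have e1 : ‖-((1 - U * V) * (1 - U * V))‖ ≤ 2 * M ^ 2 * (2 * M ^ 2) := by
    rw [norm_neg]
    exact (norm_mul_le _ _).trans (mul_le_mul ha ha (norm_nonneg _) (by positivity))
  have e2 : ‖(1 - V * U) * (1 - V * U)‖ ≤ 2 * M ^ 2 * (2 * M ^ 2) :=
    (norm_mul_le _ _).trans (mul_le_mul hb hb (norm_nonneg _) (by positivity))
  have e3 : ‖(U + U - U * V * U) * (1 - V * U)‖ ≤ 3 * M ^ 3 * (2 * M ^ 2) :=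
    (norm_mul_le _ _).trans (mul_le_mul hc hb (norm_nonneg _) (by positivity))
  have e4 : ‖(1 - V * U) * V‖ ≤ 2 * M ^ 2 * M :=
    (norm_mul_le _ _).trans (mul_le_mul hb hV (norm_nonneg _) (by positivity))
  have h4 : M ^ 4 ≤ M ^ 5 := pow_le_pow_right₀ hM (by norm_num)
  have h3 : M ^ 3 ≤ M ^ 5 := pow_le_pow_right₀ hM (by norm_num)
  refine (A.norm_blk_le p _ _ _ _).trans ?_
  calc _ ≤ 4 * M ^ 5 + 6 * M ^ 5 := add_le_add
        (max_le (e1.trans (by nlinarith)) (e2.trans (by nlinarith)))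
        (max_le (e3.trans (by nlinarith)) (e4.trans (by nlinarith)))
    _ = _ := by ring

end OpAlg

namespace ClosedIdeal

variable {E : Type u} [NormedAddCommGroup E] [NormedSpace ℂ E] (p : ℝ≥0∞) [Fact (1 ≤ p)]
  {A : OpAlg E} (J : ClosedIdeal A)

theorem mkMat_relIdem {n : ℕ} (U V : (A.tilde p).Mat n) :
    J.mkMat p (n + n) (relIdem U V) = relIdem (J.mkMat p n U) (J.mkMat p n V) :=
  relIdem_map (Ideal.Quotient.mk J.tildeIdeal) U V

/-- Every block contains a factor of norm below δ, the remaining factor contributes at most 3M³, and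
assembling four blocks costs a factor 2. -/
theorem norm_mkMat_relIdem_lt {n : ℕ} {M δ : ℝ} (hM : 1 ≤ M) (hδ : δ ≤ 1) {u v : (J.quot p).Mat n}
    (hu : ‖u‖ ≤ M) (hv : ‖v‖ ≤ M) (h : ‖u * v - 1‖ < δ) (h' : ‖v * u - 1‖ < δ) :
    ‖(relIdem u v : (J.quot p).Mat (n + n))‖ < 6 * M ^ 3 * δ := by
  have h0 : 0 < δ := (norm_nonneg _).trans_lt h
  rw [norm_sub_rev] at h h'
  have hc := norm_two_sub_le hM hu hv
  have hM3 : 1 ≤ M ^ 3 := one_le_pow₀ hM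
  have hM3' : M ≤ M ^ 3 := le_self_pow₀ hM (by norm_num)
  have e1 : ‖-((1 - u * v) * (1 - u * v))‖ < 3 * M ^ 3 * δ := by
    rw [norm_neg]
    refine (norm_mul_le _ _).trans_lt ?_
    nlinarith [norm_nonneg (1 - u * v)]
  have e2 : ‖(1 - v * u) * (1 - v * u)‖ < 3 * M ^ 3 * δ := by
    refine (norm_mul_le _ _).trans_lt ?_
    nlinarith [norm_nonneg (1 - v * u)]
  have e3 : ‖(u + u - u * v * u) * (1 - v * u)‖ < 3 * M ^ 3 * δ := by
    refine (norm_mul_le _ _).trans_lt ?_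
    refine (mul_le_mul_of_nonneg_right hc (norm_nonneg _)).trans_lt ?_
    exact mul_lt_mul_of_pos_left h' (by positivity)
  have e4 : ‖(1 - v * u) * v‖ < 3 * M ^ 3 * δ := by
    refine (norm_mul_le _ _).trans_lt ?_
    refine (mul_le_mul_of_nonneg_left hv (norm_nonneg _)).trans_lt ?_
    nlinarith [mul_lt_mul_of_pos_right h' (by linarith : 0 < M)]
  refine (J.norm_blk_lt p e1 e3 e4 e2).trans_le ?_
  linarith

end ClosedIdeal


/-! ### Homomorphisms from functional relations, and convexity -/

namespace KSystem

variable {R : Type u} [Zero R] {S : KSystem R} {H : Type w} [AddCommGroup H]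

/-- A relation between matrices and elements of a group that is functional and respects homotopies
and block sums induces a homomorphism. -/
theorem exists_hom_of_rel
    (P : ∀ n : ℕ, {x : Matrix (Fin n) (Fin n) R // S.mem n x} → H → Prop)
    (hex : ∀ n x, ∃ a, P n x a) (huniq : ∀ n x a b, P n x a → P n x b → a = b)
    (hhtpy : ∀ n x y, S.htpy n x.1 y.1 → ∃ a, P n x a ∧ P n y a)
    (hfill : ∀ k, S.mem k (S.fill k)) (hfill' : ∀ k, P k ⟨S.fill k, hfill k⟩ 0)
    (hsum : ∀ n m x y (z : {z : Matrix (Fin (n + m)) (Fin (n + m)) R // S.mem (n + m) z}) a b,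
      z.1 = bdiag x.1 y.1 → P n x a → P m y b → P (n + m) z (a + b)) :
    ∃ f : S.Group →+ H, ∀ n x a, P n x a → f (S.cls x) = a := by
  choose g hg using hex
  refine ⟨lift (S := S) g (fun n x y h => ?_) (fun n k x z h => ?_) (fun n m x y z h => ?_),
    fun n x a h => (lift_cls (S := S) g x).trans (huniq n x _ _ (hg n x) h)⟩
  · obtain ⟨a, hx, hy⟩ := hhtpy n x y h
    rw [huniq n x _ _ (hg n x) hx, huniq n y _ _ (hg n y) hy]
  · have := hsum n k x ⟨S.fill k, hfill k⟩ z _ _ h (hg n x) (hfill' k)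
    rw [add_zero] at this
    exact huniq _ _ _ _ (hg _ z) this
  · exact huniq _ _ _ _ (hg _ z) (hsum n m x y z _ _ h (hg n x) (hg m y))

end KSystem

theorem exists_path_in_convex {X : Type*} [SeminormedAddCommGroup X] [NormedSpace ℝ X] {K : Set X}
    (hK : Convex ℝ K) {x₀ x₁ : X} (h₀ : x₀ ∈ K) (h₁ : x₁ ∈ K) :
    ∃ γ : unitInterval → X, Continuous γ ∧ (∀ t, γ t ∈ K) ∧ γ 0 = x₀ ∧ γ 1 = x₁ := by
  obtain ⟨γ, h1, h2, -, h3, h4⟩ := exists_path_of_convex (0 : X →ₗ[ℝ] ℝ) hK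
    (f := fun _ => 0) continuous_const (D := 1) (fun _ => ⟨x₀, h₀, by simp⟩) h₀ (by simp) h₁
    (by simp)
  exact ⟨γ, h1, h2, h3, h4⟩

section Convexity

variable {X Z : Type*} [SeminormedAddCommGroup X] [NormedSpace ℂ X] [SeminormedAddCommGroup Z]
  [NormedSpace ℂ Z]

theorem convex_submodule_norm_le (S : Submodule ℂ X) (M : ℝ) :
    Convex ℝ {x | x ∈ S ∧ ‖x‖ ≤ M} := by
  refine Convex.inter (s := {x | x ∈ S}) (S.restrictScalars ℝ).convex ?_
  have := convex_closedBall (0 : X) M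
  simp only [Metric.closedBall, dist_zero_right] at this
  exact this

theorem convex_fiber (L : X →ₗ[ℂ] Z) (z : Z) : Convex ℝ {x | L x = z} :=
  (convex_singleton z).linear_preimage (L.restrictScalars ℝ)

theorem convex_norm_sub_lt (L : X →ₗ[ℂ] Z) (z : Z) (δ : ℝ) : Convex ℝ {x | ‖L x - z‖ < δ} := by
  have := (convex_ball z δ).linear_preimage (L.restrictScalars ℝ)
  simp only [Metric.ball, dist_eq_norm] at this
  exact this

end Convexity

/-- An element close to an idempotent is almost idempotent. -/
theorem norm_mul_self_sub_lt {S : Type*} [SeminormedRing S] {P X : S} (hP : P * P = P) {c D : ℝ}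
    (hc : 1 ≤ c) (hD : D ≤ 1) (hPc : ‖P‖ ≤ 11 * c) (h : ‖P - X‖ < D) : ‖X * X - X‖ < 24 * c * D := by
  -- Expanding around the idempotent P leaves only terms with a factor P - X; their coefficients add
  -- up to at most 1 + 22c + 1 ≤ 24c.
  have h1 : X * X - X = (P - X) * (P - X) - P * (P - X) - (P - X) * P + (P - X) := by
    have : (P - X) * (P - X) - P * (P - X) - (P - X) * P + (P - X) =
        X * X - X + (P - P * P) := by noncomm_ring
    rw [this, hP, sub_self, add_zero]
  have h2 := norm_add_le ((P - X) * (P - X) - P * (P - X) - (P - X) * P) (P - X)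
  have h3 := norm_sub_le ((P - X) * (P - X) - P * (P - X)) ((P - X) * P)
  have h4 := norm_sub_le ((P - X) * (P - X)) (P * (P - X))
  have h5 := norm_mul_le (P - X) (P - X)
  have h6 := norm_mul_le P (P - X)
  have h7 := norm_mul_le (P - X) P
  have h8 := norm_nonneg (P - X)
  rw [h1]
  have h9 : ‖P‖ * ‖P - X‖ ≤ 11 * c * ‖P - X‖ := mul_le_mul_of_nonneg_right hPc h8
  have h10 : ‖P - X‖ * ‖P - X‖ ≤ 1 * ‖P - X‖ := mul_le_mul_of_nonneg_right (by linarith) h8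
  nlinarith

/-! ### Quasi-idempotents over J̃ from approximants of `relIdem` -/

namespace ClosedIdeal

variable {E : Type u} [NormedAddCommGroup E] [NormedSpace ℂ E] {p : ℝ≥0∞} [Fact (1 ≤ p)]
  {A : OpAlg E} (J : ClosedIdeal A)

theorem norm_addCorner_defect_lt (hA : ‖A.unit‖ ≤ 1) (hJ : ¬ J.opAlg.IsUnital) {n : ℕ} {M D : ℝ}
    (hM : 1 ≤ M) (hD : D ≤ 1) {U V : (A.tilde p).Mat n} (hU : ‖U‖ ≤ M) (hV : ‖V‖ ≤ M)
    {Y : J.matIdeal p (n + n)} (h : ‖relIdem U V - Y.1‖ < D) :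
    ‖J.addCorner Y * J.addCorner Y - J.addCorner Y‖ < 24 * M ^ 5 * D := by
  rw [J.norm_addCorner_mul_self_sub hJ]
  have h1 := A.norm_relIdem_le p hA hM hU hV
  have h2 := A.norm_cornerProj_le p hA n
  have hM5 : 1 ≤ M ^ 5 := one_le_pow₀ hM
  refine norm_mul_self_sub_lt (P := cornerProj (A.tilde p).carrier n + relIdem U V)
    (cornerProj_add_relIdem_mul_self U V) hM5 hD ((norm_add_le _ _).trans (by linarith)) ?_
  rwa [add_sub_add_left_eq_sub]

theorem norm_opAlg_unit_le (hJ : ¬ J.opAlg.IsUnital) : ‖J.opAlg.unit‖ ≤ 1 := by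
  rw [J.opAlg_unit hJ]
  exact ContinuousLinearMap.norm_id_le

theorem norm_ideal_le (hA : ‖A.unit‖ ≤ 1) {n : ℕ} {M D : ℝ}
    (hM : 1 ≤ M) (hD : D ≤ 1) {U V : (A.tilde p).Mat n} (hU : ‖U‖ ≤ M) (hV : ‖V‖ ≤ M)
    {Y : J.matIdeal p (n + n)} (h : ‖relIdem U V - Y.1‖ < D) :
    ‖J.toTilde p (n + n) Y‖ ≤ 11 * M ^ 5 := by
  rw [LinearIsometry.norm_map]
  have h1 := A.norm_relIdem_le p hA hM hU hV
  have hM5 : 1 ≤ M ^ 5 := one_le_pow₀ hM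
  have h2 := norm_sub_le (relIdem U V) (relIdem U V - Y.1)
  rw [sub_sub_cancel] at h2
  have h3 : ‖Y‖ = ‖Y.1‖ := rfl
  linarith

theorem cornerProj_mem_fil {n : ℕ} (r : ℝ) (i j : Fin (n + n)) :
    cornerProj (A.tilde p).carrier n i j ∈ (A.tilde p).fil r :=
  bdiag_forall (P := fun x => x ∈ (A.tilde p).fil r) (zero_mem _)
    (OpAlg.one_mem_matFil n r) (fun _ _ => zero_mem _) i j

theorem addCorner_mem_fil {n : ℕ} {r : ℝ} {Y : J.matIdeal p (n + n)}
    (hY : Y.1 ∈ J.matFil p (n + n) r) (i j : Fin (n + n)) :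
    J.addCorner Y i j ∈ (J.opAlg.tilde p).fil r :=
  add_mem (cornerProj_mem_fil r i j) ⟨A.val (Y.1 i j), hY i j, 0, by
    rw [zero_smul, add_zero]; exact J.val_toTilde Y i j⟩

theorem qIdem_addCorner (hA : ‖A.unit‖ ≤ 1) (hJ : ¬ J.opAlg.IsUnital) {n : ℕ} {M D δ r L : ℝ}
    (hM : 1 ≤ M) (hD : D ≤ 1) (hδ : 24 * M ^ 5 * D ≤ δ) (hL : 12 * M ^ 5 ≤ L)
    {U V : (A.tilde p).Mat n} (hU : ‖U‖ ≤ M) (hV : ‖V‖ ≤ M)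
    {Y : J.matIdeal p (n + n)} (h : ‖relIdem U V - Y.1‖ < D)
    (hY : Y.1 ∈ J.matFil p (n + n) r) :
    (J.opAlg.tilde p).QIdem δ r L (n + n) (J.addCorner Y) := by
  have h1 := J.norm_ideal_le hA hM hD hU hV h
  have h2 := J.norm_opAlg_unit_le hJ
  have hM5 : 1 ≤ M ^ 5 := one_le_pow₀ hM
  refine ⟨(J.norm_addCorner_defect_lt hA hJ hM hD hU hV h).trans_le hδ, J.addCorner_mem_fil hY,
    ?_, ?_⟩
  · refine (norm_add_le (cornerProj (J.opAlg.tilde p).carrier n) (J.toTilde p (n + n) Y)).trans ?_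
    have h3 := J.opAlg.norm_cornerProj_le p h2 n
    linarith
  · have h4 : (1 - J.addCorner Y) =
      (1 - cornerProj (J.opAlg.tilde p).carrier n) - J.toTilde p (n + n) Y := sub_add_eq_sub_sub _ _ _
    have h3 := J.opAlg.norm_one_sub_cornerProj_le p h2 n
    rw [h4]
    refine (norm_sub_le (1 - cornerProj (J.opAlg.tilde p).carrier n)
      (J.toTilde p (n + n) Y)).trans ?_
    linarith

theorem qIdem_cornerProj (hJ : ¬ J.opAlg.IsUnital) (n : ℕ) {δ r L : ℝ} (hδ : 0 < δ) (hL : 1 ≤ L) :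
    (J.opAlg.tilde p).QIdem δ r L (n + n) (cornerProj (J.opAlg.tilde p).carrier n) := by
  have h2 := J.norm_opAlg_unit_le hJ
  refine ⟨?_, cornerProj_mem_fil r, (J.opAlg.norm_cornerProj_le p h2 n).trans hL,
    (J.opAlg.norm_one_sub_cornerProj_le p h2 n).trans hL⟩
  have h0 : (J.opAlg.tilde p).nrm (n + n) 0 = 0 := norm_zero (E := (J.opAlg.tilde p).Mat (n + n))
  rw [cornerProj_mul_self, sub_self, h0]
  exact hδ

/-- Along a path of pairs of lifts, the matrices over the ideal that approximate `relIdem` can be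
chosen continuously, with prescribed end points. -/
theorem exists_path_relIdem {n : ℕ} (𝒴 : Submodule ℂ ((A.tilde p).Mat (n + n)))
    {U V : unitInterval → (A.tilde p).Mat n} (hU : Continuous U) (hV : Continuous V) {D : ℝ}
    (h : ∀ t, ∃ Y : J.matIdeal p (n + n), Y.1 ∈ 𝒴 ∧ ‖relIdem (U t) (V t) - Y.1‖ < D)
    {Y₀ Y₁ : J.matIdeal p (n + n)} (h₀ : Y₀.1 ∈ 𝒴) (h₁ : Y₁.1 ∈ 𝒴)
    (h₀' : ‖relIdem (U 0) (V 0) - Y₀.1‖ < D) (h₁' : ‖relIdem (U 1) (V 1) - Y₁.1‖ < D) :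
    ∃ γ : unitInterval → J.matIdeal p (n + n), Continuous γ ∧ (∀ t, (γ t).1 ∈ 𝒴) ∧
      (∀ t, ‖relIdem (U t) (V t) - (γ t).1‖ < D) ∧ γ 0 = Y₀ ∧ γ 1 = Y₁ :=
  exists_path_of_convex ((J.matIdeal p (n + n)).subtype.restrictScalars ℝ)
    (K := {Y | Y.1 ∈ 𝒴})
    (fun _ hx _ hy a b _ _ _ => 𝒴.add_mem (𝒴.smul_mem (a : ℂ) hx) (𝒴.smul_mem (b : ℂ) hy))
    (A.continuous_relIdem p hU hV) h h₀ h₀' h₁ h₁'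

/-! ### Pairs of lifts of quasi-inverse matrices -/

variable (p) in
/-- `U` and `V` are lifts in `𝒰` and of norm at most `M` of `δ`-inverse matrices. -/
structure IsLiftPair (δ : ℝ) {n : ℕ} (𝒰 : Submodule ℂ ((A.tilde p).Mat n)) (M : ℝ)
    (U V : (A.tilde p).Mat n) : Prop where
  mem_left : U ∈ 𝒰
  mem_right : V ∈ 𝒰
  norm_left : ‖U‖ ≤ M
  norm_right : ‖V‖ ≤ M
  mul_right : ‖J.mkMat p n U * J.mkMat p n V - 1‖ < δ
  mul_left : ‖J.mkMat p n V * J.mkMat p n U - 1‖ < δ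

variable {J}

theorem IsLiftPair.mono {δ δ' s s' M M' : ℝ} {n : ℕ} {U V : (A.tilde p).Mat n}
    (h : J.IsLiftPair p δ (A.matFil p n s) M U V) (hs : 0 < s) (hδ : δ ≤ δ') (hss : s ≤ s') (hM : M ≤ M') :
    J.IsLiftPair p δ' (A.matFil p n s') M' U V :=
  ⟨OpAlg.matFil_mono hs hss h.1, OpAlg.matFil_mono hs hss h.2, h.3.trans hM, h.4.trans hM,
    h.5.trans_le hδ, h.6.trans_le hδ⟩

/-- The blocks are polynomials of degree at most five in U and V; the degree five is attained by (2U
- UVU)(1 - VU). -/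
theorem IsLiftPair.relIdem_mem (H : IsFilteredSQpAlg.{u, v} p A) {δ s M : ℝ} {n : ℕ}
    {U V : (A.tilde p).Mat n} (h : J.IsLiftPair p δ (A.matFil p n s) M U V) (hs : 0 < s) :
    relIdem U V ∈ A.matFil p (n + n) (5 * s) := by
  have hm : ∀ {a b : ℝ} {X Y : (A.tilde p).Mat n}, 0 < a → 0 < b → X ∈ A.matFil p n a →
      Y ∈ A.matFil p n b → X * Y ∈ A.matFil p n (a + b) := fun ha hb hX hY =>
    H.mul_mem_matFil ha hb hX hY
  have h1 : ∀ {X Y : (A.tilde p).Mat n}, X ∈ A.matFil p n s → Y ∈ A.matFil p n s →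
      1 - X * Y ∈ A.matFil p n (s + s) := fun hX hY =>
    Submodule.sub_mem _ (OpAlg.one_mem_matFil n _) (hm hs hs hX hY)
  have hUV := h1 h.1 h.2
  have hVU := h1 h.2 h.1
  have h2 : U + U - U * V * U ∈ A.matFil p n (s + s + s) := by
    have hU : U ∈ A.matFil p n (s + s + s) := OpAlg.matFil_mono hs (by linarith) h.1
    exact Submodule.sub_mem _ (Submodule.add_mem _ hU hU) (hm (by linarith) hs (hm hs hs h.1 h.2) h.1)
  have e1 : -((1 - U * V) * (1 - U * V)) ∈ A.matFil p n (5 * s) :=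
    Submodule.neg_mem _ (OpAlg.matFil_mono (by linarith) (by linarith)
      (hm (by linarith) (by linarith) hUV hUV))
  have e2 : (1 - V * U) * (1 - V * U) ∈ A.matFil p n (5 * s) :=
    OpAlg.matFil_mono (by linarith) (by linarith) (hm (by linarith) (by linarith) hVU hVU)
  have e3 : (U + U - U * V * U) * (1 - V * U) ∈ A.matFil p n (5 * s) :=
    OpAlg.matFil_mono (by linarith) (by linarith) (hm (by linarith) (by linarith) h2 hVU)
  have e4 : (1 - V * U) * V ∈ A.matFil p n (5 * s) :=
    OpAlg.matFil_mono (by linarith) (by linarith) (hm (by linarith) hs hVU h.2)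
  exact blk_forall (P := fun x => x ∈ (A.tilde p).fil (5 * s)) e1 e3 e4 e2

theorem IsLiftPair.norm_mkMat_relIdem_lt {δ M : ℝ} {n : ℕ} {𝒰 : Submodule ℂ ((A.tilde p).Mat n)}
    {U V : (A.tilde p).Mat n}
    (h : J.IsLiftPair p δ 𝒰 M U V) (hM : 1 ≤ M) (hδ : δ ≤ 1) :
    ‖J.mkMat p (n + n) (relIdem U V)‖ < 6 * M ^ 3 * δ := by
  rw [J.mkMat_relIdem p]
  exact J.norm_mkMat_relIdem_lt p hM hδ ((J.norm_mkMat_le p U).trans h.3)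
    ((J.norm_mkMat_le p V).trans h.4) h.5 h.6

theorem IsLiftPair.exists_correction [CompleteSpace E] (hp : p ≠ ∞) {C : ℝ} (hC : 1 ≤ C)
    (H : IsFilteredSQpAlg.{u, v} p A) (hJ : J.IsCompletelyFiltered p C) {δ s M : ℝ} {n : ℕ}
    {U V : (A.tilde p).Mat n} (h : J.IsLiftPair p δ (A.matFil p n s) M U V) (hs : 0 < s) (hM : 1 ≤ M)
    (hδ : δ ≤ 1) :
    ∃ Y : J.matIdeal p (n + n), Y.1 ∈ J.matFil p (n + n) (5 * s) ∧
      ‖relIdem U V - Y.1‖ < (2 * C + 1) * (6 * M ^ 3 * δ) := by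
  obtain ⟨Y, hY, hlt⟩ := hJ.exists_correction hp hC H (by linarith) (h.relIdem_mem H hs)
    (h.norm_mkMat_relIdem_lt hM hδ)
  exact ⟨⟨Y, J.matFil_le_matIdeal p _ _ hY⟩, hY, hlt⟩

theorem exists_ideal_of_norm_mkMat_lt {n : ℕ} {X : (A.tilde p).Mat n} {D : ℝ}
    (h : ‖J.mkMat p n X‖ < D) : ∃ Y : J.matIdeal p n, ‖X - Y.1‖ < D := by
  obtain ⟨X', hX', hD⟩ := (J.norm_lt_iff p).1 h
  refine ⟨⟨X - X', ?_⟩, by rwa [sub_sub_cancel]⟩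
  rw [mem_matIdeal_iff, map_sub, hX', sub_self]

/-- Two lifts of the same matrix are connected by a path of lifts. -/
theorem IsLiftPair.exists_path {δ M : ℝ} {n : ℕ}
    {𝒰 : Submodule ℂ ((A.tilde p).Mat n)} {U₀ V₀ U₁ V₁ : (A.tilde p).Mat n}
    (h₀ : J.IsLiftPair p δ 𝒰 M U₀ V₀) (h₁ : J.IsLiftPair p δ 𝒰 M U₁ V₁)
    (h : J.mkMat p n U₀ = J.mkMat p n U₁) :
    ∃ U V : unitInterval → (A.tilde p).Mat n, Continuous U ∧ Continuous V ∧
      (∀ t, J.IsLiftPair p δ 𝒰 M (U t) (V t)) ∧ U 0 = U₀ ∧ V 0 = V₀ ∧ U 1 = U₁ ∧ V 1 = V₁ := by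
  have hfil := convex_submodule_norm_le 𝒰 M
  -- The condition on the pair (U, V) is not jointly convex. Moving U inside the fibre over the
  -- fixed u makes the condition on V independent of U, and then it is convex.
  set u := J.mkMat p n U₁ with hu
  have hL := convex_fiber (J.mkMat p n).toLinearMap u
  have hR := (convex_norm_sub_lt ((LinearMap.mulLeft ℂ u).comp (J.mkMat p n).toLinearMap) 1 δ).inter
    (convex_norm_sub_lt ((LinearMap.mulRight ℂ u).comp (J.mkMat p n).toLinearMap) 1 δ)
  obtain ⟨U, hU, hU', U0, U1⟩ := exists_path_in_convex (hfil.inter hL) (x₀ := U₀) (x₁ := U₁)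
    ⟨⟨h₀.1, h₀.3⟩, h⟩ ⟨⟨h₁.1, h₁.3⟩, rfl⟩
  have e5 := h₀.5
  have e6 := h₀.6
  rw [h] at e5 e6
  obtain ⟨V, hV, hV', V0, V1⟩ := exists_path_in_convex (hfil.inter hR) (x₀ := V₀) (x₁ := V₁)
    ⟨⟨h₀.2, h₀.4⟩, e5, e6⟩ ⟨⟨h₁.2, h₁.4⟩, h₁.5, h₁.6⟩
  refine ⟨U, V, hU, hV, fun t => ⟨(hU' t).1.1, (hV' t).1.1, (hU' t).1.2, (hV' t).1.2, ?_, ?_⟩,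
    U0, V0, U1, V1⟩
  · rw [show J.mkMat p n (U t) = u from (hU' t).2]
    exact (hV' t).2.1
  · rw [show J.mkMat p n (U t) = u from (hU' t).2]
    exact (hV' t).2.2

end ClosedIdeal


/-! ### The control pair -/

/-- The bound for the norms of the lifts. -/
noncomputable def liftBound (C N : ℝ) : ℝ := (2 * C + 1) * (4 * N + 1)

/-- The constant `λ_N`. -/
noncomputable def lamBound (C N : ℝ) : ℝ := 720 * (2 * C + 1) * liftBound C N ^ 8

theorem one_le_liftBound {C N : ℝ} (hC : 1 ≤ C) (hN : 1 ≤ N) : 1 ≤ liftBound C N := by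
  unfold liftBound
  nlinarith

theorem liftBound_mono {C N N' : ℝ} (hC : 1 ≤ C) (h : N ≤ N') :
    liftBound C N ≤ liftBound C N' := by
  unfold liftBound
  gcongr

theorem twelve_mul_le_lamBound {C N : ℝ} (hC : 1 ≤ C) (hN : 1 ≤ N) :
    12 * liftBound C N ^ 5 ≤ lamBound C N := by
  have h := one_le_liftBound hC hN
  have h1 : liftBound C N ^ 5 ≤ liftBound C N ^ 8 := pow_le_pow_right₀ h (by norm_num)
  have h2 : 0 < liftBound C N ^ 8 := by positivity
  unfold lamBound
  nlinarith

theorem one_le_lamBound {C N : ℝ} (hC : 1 ≤ C) (hN : 1 ≤ N) : 1 ≤ lamBound C N := by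
  have h1 : 1 ≤ liftBound C N ^ 5 := one_le_pow₀ (one_le_liftBound hC hN)
  linarith [twelve_mul_le_lamBound hC hN]

theorem lamBound_mono {C N N' : ℝ} (hC : 1 ≤ C) (hN : 1 ≤ N) (h : N ≤ N') :
    lamBound C N ≤ lamBound C N' := by
  have h1 := one_le_liftBound hC hN
  have h2 := liftBound_mono hC h
  unfold lamBound
  gcongr

/-- The control pair of the boundary map. -/
noncomputable def boundaryControl (C : ℝ) (hC : 1 ≤ C) : ControlPair where
  lam := lamBound C
  h := fun _ _ => 10
  one_le_lam _ hN := one_le_lamBound hC hN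
  lam_mono _ _ hN h := lamBound_mono hC hN h
  one_le_h _ _ _ _ _ := by norm_num
  h_anti _ _ _ _ _ _ _ := le_rfl

/-- The distance from `relIdem` to the ideal. -/
noncomputable def idealDist (C N ε : ℝ) : ℝ := (2 * C + 1) * (6 * liftBound C N ^ 3 * (5 * ε))

theorem idealDist_mono {C N N' ε ε' : ℝ} (hC : 1 ≤ C) (hN : 1 ≤ N) (h : N ≤ N') (hε : 0 ≤ ε)
    (h' : ε ≤ ε') : idealDist C N ε ≤ idealDist C N' ε' := by
  have h1 := one_le_liftBound hC hN
  have h2 := liftBound_mono hC h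
  have h3 : 0 ≤ liftBound C N' := by linarith
  unfold idealDist
  gcongr

/-- This identity is what dictates λ_N: the defect estimate contributes 24M⁵, the distance to the
ideal 6M³ · 5ε, and 24 · 6 · 5 = 720. -/
theorem mul_idealDist (C N ε : ℝ) :
    24 * liftBound C N ^ 5 * idealDist C N ε = lamBound C N * ε := by
  unfold idealDist lamBound
  ring

/-- The admissible parameters. -/
structure IsAdmissible (C ε r N : ℝ) : Prop where
  one_le_C : 1 ≤ C
  pos : 0 < ε
  lt : ε < 1 / (20 * lamBound C N)
  r_pos : 0 < r
  one_le : 1 ≤ N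

namespace IsAdmissible

variable {C ε r N : ℝ} (h : IsAdmissible C ε r N)
include h

theorem lam_mul_lt : lamBound C N * ε < 1 / 20 := by
  have h1 := one_le_lamBound h.one_le_C h.one_le
  have h2 := (lt_div_iff₀ (by linarith : (0 : ℝ) < 20 * lamBound C N)).1 h.lt
  linarith

theorem lam_mul_pos : 0 < lamBound C N * ε :=
  mul_pos (by linarith [one_le_lamBound h.one_le_C h.one_le]) h.pos

theorem lt_one_div : ε < 1 / 20 := by
  have h1 := one_le_lamBound h.one_le_C h.one_le
  nlinarith [h.lam_mul_lt, h.pos]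

theorem idealDist_le : idealDist C N ε ≤ 1 := by
  have h1 : 1 ≤ liftBound C N ^ 5 := one_le_pow₀ (one_le_liftBound h.one_le_C h.one_le)
  have h2 := mul_idealDist C N ε
  have h3 := h.lam_mul_lt
  by_contra! h4
  nlinarith

end IsAdmissible

/-! ### The boundary map in quantitative `K`-theory -/

section Submatrix

variable {R : Type u} [Ring R] {m n k : ℕ}

theorem bdiag_submatrix_add (σ : Fin k ≃ Fin (m + n)) (a a' : Matrix (Fin m) (Fin m) R)
    (d d' : Matrix (Fin n) (Fin n) R) :
    (bdiag a d).submatrix σ σ + (bdiag a' d').submatrix σ σ =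
      (bdiag (a + a') (d + d')).submatrix σ σ := by
  rw [← bdiag_add]
  rfl

theorem bdiag_submatrix_sub (σ : Fin k ≃ Fin (m + n)) (a a' : Matrix (Fin m) (Fin m) R)
    (d d' : Matrix (Fin n) (Fin n) R) :
    (bdiag a d).submatrix σ σ - (bdiag a' d').submatrix σ σ =
      (bdiag (a - a') (d - d')).submatrix σ σ := by
  rw [← bdiag_sub]
  rfl

end Submatrix

theorem bdiag_mem_matFil {E : Type u} [NormedAddCommGroup E] [NormedSpace ℂ E] {p : ℝ≥0∞}
    [Fact (1 ≤ p)] {A : OpAlg E} {m n : ℕ} {r : ℝ} {X : (A.tilde p).Mat m} {Y : (A.tilde p).Mat n}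
    (hX : X ∈ A.matFil p m r) (hY : Y ∈ A.matFil p n r) :
    (bdiag X Y : (A.tilde p).Mat (m + n)) ∈ A.matFil p (m + n) r :=
  bdiag_forall (P := fun x => x ∈ (A.tilde p).fil r) (zero_mem _) hX hY

namespace ClosedIdeal

variable {E : Type u} [NormedAddCommGroup E] [NormedSpace ℂ E] {p : ℝ≥0∞} [Fact (1 ≤ p)]
  {A : OpAlg E} {J : ClosedIdeal A}

theorem IsLiftPair.bdiag {δ s M : ℝ} {m n : ℕ} {U V : (A.tilde p).Mat m}
    {U' V' : (A.tilde p).Mat n} (h : J.IsLiftPair p δ (A.matFil p _ s) M U V) (h' : J.IsLiftPair p δ (A.matFil p _ s) M U' V') :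
    J.IsLiftPair p δ (A.matFil p _ s) M (bdiag U U' : (A.tilde p).Mat (m + n)) (bdiag V V') := by
  refine ⟨bdiag_mem_matFil h.1 h'.1, bdiag_mem_matFil h.2 h'.2,
    (A.norm_bdiag_le p _ _).trans (max_le h.3 h'.3),
    (A.norm_bdiag_le p _ _).trans (max_le h.4 h'.4), ?_, ?_⟩
  · rw [mkMat_bdiag, mkMat_bdiag, bdiag_mul, ← bdiag_one, bdiag_sub]
    exact J.norm_bdiag_lt p h.5 h'.5
  · rw [mkMat_bdiag, mkMat_bdiag, bdiag_mul, ← bdiag_one, bdiag_sub]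
    exact J.norm_bdiag_lt p h.6 h'.6

variable (J) in
/-- Block sum of matrices over the ideal, with the two middle blocks exchanged. -/
noncomputable def idealSum {m n : ℕ} (Y : J.matIdeal p (m + m)) (Z : J.matIdeal p (n + n)) :
    J.matIdeal p ((m + n) + (m + n)) :=
  ⟨(QuantK.bdiag Y.1 Z.1).submatrix (midSwap m n) (midSwap m n), fun i j =>
    bdiag_forall (R := (A.tilde p).carrier) (P := fun x => A.val x ∈ J.alg) (zero_mem J.alg)
      Y.2 Z.2 (midSwap m n i) (midSwap m n j)⟩

theorem addCorner_idealSum {m n : ℕ} (Y : J.matIdeal p (m + m)) (Z : J.matIdeal p (n + n)) :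
    J.addCorner (J.idealSum Y Z) = (QuantK.bdiag (J.addCorner Y) (J.addCorner Z)).submatrix
      (midSwap m n) (midSwap m n) := by
  have h : J.toTilde p _ (J.idealSum Y Z) =
      (QuantK.bdiag (J.toTilde p _ Y) (J.toTilde p _ Z)).submatrix (midSwap m n) (midSwap m n) := by
    ext i j
    apply J.opAlg.val_injective
    have h1 : (QuantK.bdiag (J.toTilde p _ Y) (J.toTilde p _ Z)).map J.opAlg.val =
        QuantK.bdiag ((J.toTilde p _ Y).map J.opAlg.val) ((J.toTilde p _ Z).map J.opAlg.val) :=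
      bdiag_map _ J.opAlg.val_zero _ _
    have h2 : (QuantK.bdiag Y.1 Z.1).map A.val = QuantK.bdiag (Y.1.map A.val) (Z.1.map A.val) :=
      bdiag_map (R := (A.tilde p).carrier) _ A.val_zero _ _
    exact (congrFun (congrFun h2 (midSwap m n i)) (midSwap m n j)).trans
      (congrFun (congrFun h1 (midSwap m n i)) (midSwap m n j)).symm
  change cornerProj _ (m + n) + J.toTilde p _ (J.idealSum Y Z) = _
  rw [h, cornerProj_add_eq]
  exact bdiag_submatrix_add (midSwap m n) _ _ _ _

theorem norm_relIdem_sub_idealSum_lt {m n : ℕ} {D : ℝ} {U V : (A.tilde p).Mat m}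
    {U' V' : (A.tilde p).Mat n} {Y : J.matIdeal p (m + m)} {Z : J.matIdeal p (n + n)}
    (h : ‖relIdem U V - Y.1‖ < D) (h' : ‖relIdem U' V' - Z.1‖ < D) :
    ‖relIdem (QuantK.bdiag U U') (QuantK.bdiag V V') - (J.idealSum Y Z).1‖ < D := by
  have e : relIdem (QuantK.bdiag U U') (QuantK.bdiag V V') - (J.idealSum Y Z).1 =
      (QuantK.bdiag (relIdem U V - Y.1) (relIdem U' V' - Z.1)).submatrix (midSwap m n)
        (midSwap m n) := by
    rw [relIdem_bdiag]
    exact bdiag_submatrix_sub (midSwap m n) _ _ _ _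
  rw [e]
  exact ((A.norm_submatrix_le p _ _ _).trans (A.norm_bdiag_le p _ _)).trans_lt (max_lt h h')

variable (J) in
/-- The value of the quantitative boundary map on a quasi-invertible `u` is
`[diag(1, 0) + y] - [diag(1, 0)]`, where `y` is a matrix over the ideal that approximates
`relIdem U V` for lifts `U`, `V` of `u` and a quasi-inverse of `u`. -/
def IsQuantBoundary (C ε r N : ℝ) {n : ℕ} (u : (J.quot p).Mat n)
    (a : (J.opAlg.tilde p).QK0 (lamBound C N * ε) (10 * r) (lamBound C N)) : Prop :=
  ∃ (U V : (A.tilde p).Mat n) (Y : J.matIdeal p (n + n)),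
    J.IsLiftPair p (5 * ε) (A.matFil p n (2 * r)) (liftBound C N) U V ∧ J.mkMat p n U = u ∧
    Y.1 ∈ J.matFil p (n + n) (10 * r) ∧ ‖relIdem U V - Y.1‖ < idealDist C N ε ∧
    ∃ e q : {e : (J.opAlg.tilde p).Mat (n + n) //
      (J.opAlg.tilde p).QIdem (lamBound C N * ε) (10 * r) (lamBound C N) (n + n) e},
      e.1 = J.addCorner Y ∧ q.1 = cornerProj (J.opAlg.tilde p).carrier n ∧
      a = ((J.opAlg.tilde p).qIdemSystem _ _ _).cls e - ((J.opAlg.tilde p).qIdemSystem _ _ _).cls q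

variable {C ε r N : ℝ}

theorem qIdem_addCorner_of_admissible (H : IsFilteredSQpAlg.{u, v} p A)
    (hJ : ¬ J.opAlg.IsUnital) (h : IsAdmissible C ε r N) {n : ℕ} {U V : (A.tilde p).Mat n}
    (hUV : J.IsLiftPair p (5 * ε) (A.matFil p n (2 * r)) (liftBound C N) U V) {Y : J.matIdeal p (n + n)}
    (hY : Y.1 ∈ J.matFil p (n + n) (10 * r)) (hD : ‖relIdem U V - Y.1‖ < idealDist C N ε) :
    (J.opAlg.tilde p).QIdem (lamBound C N * ε) (10 * r) (lamBound C N) (n + n) (J.addCorner Y) :=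
  J.qIdem_addCorner H.norm_unit_le hJ (one_le_liftBound h.one_le_C h.one_le) h.idealDist_le
    (mul_idealDist C N ε).le (twelve_mul_le_lamBound h.one_le_C h.one_le) hUV.3 hUV.4 hD hY

theorem exists_isQuantBoundary (H : IsFilteredSQpAlg.{u, v} p A)
    (hJ : ¬ J.opAlg.IsUnital) (h : IsAdmissible C ε r N) {n : ℕ} {U V : (A.tilde p).Mat n}
    (hUV : J.IsLiftPair p (5 * ε) (A.matFil p n (2 * r)) (liftBound C N) U V) {Y : J.matIdeal p (n + n)}
    (hY : Y.1 ∈ J.matFil p (n + n) (10 * r)) (hD : ‖relIdem U V - Y.1‖ < idealDist C N ε) :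
    J.IsQuantBoundary C ε r N (J.mkMat p n U)
      (((J.opAlg.tilde p).qIdemSystem _ _ _).cls
        ⟨J.addCorner Y, qIdem_addCorner_of_admissible H hJ h hUV hY hD⟩ -
      ((J.opAlg.tilde p).qIdemSystem _ _ _).cls
        ⟨_, J.qIdem_cornerProj hJ n h.lam_mul_pos (one_le_lamBound h.one_le_C h.one_le)⟩) :=
  ⟨U, V, Y, hUV, rfl, hY, hD, _, _, rfl, rfl, rfl⟩

/-- Each of the two replacements costs at most ε/2, so a pair of defect 4ε becomes a pair of defect
5ε. This is why lift pairs are required at level 5ε although homotopies live at 4ε. -/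
theorem norm_mul_sub_one_lt {S : Type*} [SeminormedRing S] {u v u' v' : S} {ε M : ℝ} (hε : 0 < ε)
    (hu : ‖u‖ ≤ M) (hv' : ‖v'‖ ≤ M) (h : ‖u * v - 1‖ < 4 * ε) (hM : 1 ≤ M)
    (hu' : ‖u - u'‖ < ε / (2 * M)) (hv : ‖v - v'‖ < ε / (2 * M)) : ‖u' * v' - 1‖ < 5 * ε := by
  have e : u' * v' - 1 = (u * v - 1) - u * (v - v') - (u - u') * v' := by noncomm_ring
  have h1 := norm_sub_le ((u * v - 1) - u * (v - v')) ((u - u') * v')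
  have h2 := norm_sub_le (u * v - 1) (u * (v - v'))
  have h3 : ‖u * (v - v')‖ ≤ M * (ε / (2 * M)) :=
    (norm_mul_le _ _).trans (mul_le_mul hu hv.le (norm_nonneg _) (by linarith))
  have h4 : ‖(u - u') * v'‖ ≤ ε / (2 * M) * M :=
    (norm_mul_le _ _).trans (mul_le_mul hu'.le hv' (norm_nonneg _) (by positivity))
  have h5 : M * (ε / (2 * M)) = ε / 2 := by field_simp
  rw [mul_comm, h5] at h4
  rw [h5] at h3
  rw [e]
  linarith

/-- A path of quasi-inverse pairs lifts, up to a small error, to a path of pairs of lifts, exactly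
at the end points. -/
theorem exists_liftPath {n : ℕ} {𝒰 : Submodule ℂ ((A.tilde p).Mat n)} {M : ℝ} (hM : 1 ≤ M)
    (hε : 0 < ε) {γ δ : unitInterval → (J.quot p).Mat n} (hγ : Continuous γ) (hδ : Continuous δ)
    (hγU : ∀ t, ∃ U ∈ 𝒰, ‖U‖ ≤ M ∧ J.mkMat p n U = γ t)
    (hδV : ∀ t, ∃ V ∈ 𝒰, ‖V‖ ≤ M ∧ J.mkMat p n V = δ t)
    (h₁ : ∀ t, ‖γ t * δ t - 1‖ < 4 * ε) (h₂ : ∀ t, ‖δ t * γ t - 1‖ < 4 * ε) :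
    ∃ U V : unitInterval → (A.tilde p).Mat n, Continuous U ∧ Continuous V ∧
      (∀ t, J.IsLiftPair p (5 * ε) 𝒰 M (U t) (V t)) ∧ J.mkMat p n (U 0) = γ 0 ∧
      J.mkMat p n (U 1) = γ 1 ∧ J.mkMat p n (V 0) = δ 0 ∧ J.mkMat p n (V 1) = δ 1 := by
  have hη : 0 < ε / (2 * M) := by positivity
  have hK := convex_submodule_norm_le 𝒰 M
  have hz : ∀ {x y : (J.quot p).Mat n}, x = y → ‖y - x‖ < ε / (2 * M) := by
    rintro x y rfl
    rwa [sub_self, norm_zero]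
  have key : ∀ {γ : unitInterval → (J.quot p).Mat n}, Continuous γ →
      (∀ t, ∃ U ∈ 𝒰, ‖U‖ ≤ M ∧ J.mkMat p n U = γ t) →
      ∃ U : unitInterval → (A.tilde p).Mat n, Continuous U ∧ (∀ t, U t ∈ 𝒰 ∧ ‖U t‖ ≤ M) ∧
        (∀ t, ‖γ t - J.mkMat p n (U t)‖ < ε / (2 * M)) ∧ J.mkMat p n (U 0) = γ 0 ∧
        J.mkMat p n (U 1) = γ 1 := by
    intro γ hγ h
    obtain ⟨U₀, hU₀, hn₀, hu₀⟩ := h 0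
    obtain ⟨U₁, hU₁, hn₁, hu₁⟩ := h 1
    obtain ⟨U, hU, hUK, hUd, rfl, rfl⟩ := exists_path_of_convex
      ((J.mkMat p n).toLinearMap.restrictScalars ℝ) hK hγ (D := ε / (2 * M))
      (fun t => by
        obtain ⟨U, hU, hn, hu⟩ := h t
        exact ⟨U, ⟨hU, hn⟩, hz hu⟩)
      (x₀ := U₀) (x₁ := U₁) ⟨hU₀, hn₀⟩ (hz hu₀) ⟨hU₁, hn₁⟩ (hz hu₁)
    exact ⟨U, hU, hUK, hUd, hu₀, hu₁⟩
  have hb : ∀ {γ : unitInterval → (J.quot p).Mat n},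
      (∀ t, ∃ U ∈ 𝒰, ‖U‖ ≤ M ∧ J.mkMat p n U = γ t) → ∀ t, ‖γ t‖ ≤ M := by
    intro γ h t
    obtain ⟨U, -, hn, hu⟩ := h t
    rw [← hu]
    exact (J.norm_mkMat_le p U).trans hn
  obtain ⟨U, hU, hUK, hUd, hu₀, hu₁⟩ := key hγ hγU
  obtain ⟨V, hV, hVK, hVd, hv₀, hv₁⟩ := key hδ hδV
  exact ⟨U, V, hU, hV, fun t => ⟨(hUK t).1, (hVK t).1, (hUK t).2, (hVK t).2,
    norm_mul_sub_one_lt hε (hb hγU t) ((J.norm_mkMat_le p _).trans (hVK t).2) (h₁ t) hM (hUd t)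
      (hVd t),
    norm_mul_sub_one_lt hε (hb hδV t) ((J.norm_mkMat_le p _).trans (hUK t).2) (h₂ t) hM (hVd t)
      (hUd t)⟩, hu₀, hu₁, hv₀, hv₁⟩

variable [CompleteSpace E]

theorem IsLiftPair.exists_correction_of_admissible (hp : p ≠ ∞) (H : IsFilteredSQpAlg.{u, v} p A)
    (hJC : J.IsCompletelyFiltered p C) (h : IsAdmissible C ε r N) {n : ℕ}
    {U V : (A.tilde p).Mat n} (hUV : J.IsLiftPair p (5 * ε) (A.matFil p n (2 * r)) (liftBound C N) U V) :
    ∃ Y : J.matIdeal p (n + n), Y.1 ∈ J.matFil p (n + n) (10 * r) ∧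
      ‖relIdem U V - Y.1‖ < idealDist C N ε := by
  have h1 := h.lt_one_div
  obtain ⟨Y, hY, hD⟩ := hUV.exists_correction hp h.one_le_C H hJC (by linarith [h.r_pos])
    (one_le_liftBound h.one_le_C h.one_le) (by linarith)
  refine ⟨Y, ?_, hD⟩
  rwa [show 5 * (2 * r) = 10 * r by ring] at hY

/-- The value of the boundary map is constant along paths of pairs of lifts. -/
theorem IsQuantBoundary.eq_of_path (hp : p ≠ ∞) (H : IsFilteredSQpAlg.{u, v} p A)
    (hJC : J.IsCompletelyFiltered p C) (hJ : ¬ J.opAlg.IsUnital) (h : IsAdmissible C ε r N) {n : ℕ}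
    {U V : unitInterval → (A.tilde p).Mat n} (hU : Continuous U) (hV : Continuous V)
    (hUV : ∀ t, J.IsLiftPair p (5 * ε) (A.matFil p n (2 * r)) (liftBound C N) (U t) (V t))
    {Y₀ Y₁ : J.matIdeal p (n + n)} (h₀ : Y₀.1 ∈ J.matFil p (n + n) (10 * r))
    (h₁ : Y₁.1 ∈ J.matFil p (n + n) (10 * r))
    (h₀' : ‖relIdem (U 0) (V 0) - Y₀.1‖ < idealDist C N ε)
    (h₁' : ‖relIdem (U 1) (V 1) - Y₁.1‖ < idealDist C N ε)
    (e₀ e₁ : {e : (J.opAlg.tilde p).Mat (n + n) //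
      (J.opAlg.tilde p).QIdem (lamBound C N * ε) (10 * r) (lamBound C N) (n + n) e})
    (he₀ : e₀.1 = J.addCorner Y₀) (he₁ : e₁.1 = J.addCorner Y₁) :
    ((J.opAlg.tilde p).qIdemSystem _ _ _).cls e₀ = ((J.opAlg.tilde p).qIdemSystem _ _ _).cls e₁ := by
  obtain ⟨γ, hγ, hm, hd, g0, g1⟩ := J.exists_path_relIdem (J.matFil p (n + n) (10 * r)) hU hV
    (fun t => (hUV t).exists_correction_of_admissible hp H hJC h) h₀ h₁ h₀' h₁'
  have hl := one_le_lamBound h.one_le_C h.one_le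
  refine KSystem.cls_eq_of_htpy _ _ _ ⟨fun t => J.addCorner (γ t), ?_, fun t => ?_, ?_, ?_⟩
  · exact (J.opAlg.normCont_iff p).2 (J.continuous_addCorner.comp hγ)
  · exact (qIdem_addCorner_of_admissible H hJ h (hUV t) (hm t) (hd t)).mono
      (by linarith [h.lam_mul_pos]) (by linarith [h.r_pos]) le_rfl (by linarith)
  · change J.addCorner (γ 0) = _
    rw [g0, he₀]
  · change J.addCorner (γ 1) = _
    rw [g1, he₁]

/-- Two pairs of lifts of the same u are joined by a path of lift pairs, along which the
approximants over the ideal can be chosen continuously between the two given ones. -/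
theorem IsQuantBoundary.unique (hp : p ≠ ∞) (H : IsFilteredSQpAlg.{u, v} p A)
    (hJC : J.IsCompletelyFiltered p C) (hJ : ¬ J.opAlg.IsUnital) (h : IsAdmissible C ε r N) {n : ℕ}
    {u : (J.quot p).Mat n} {a b} (ha : J.IsQuantBoundary C ε r N u a)
    (hb : J.IsQuantBoundary C ε r N u b) : a = b := by
  obtain ⟨U₀, V₀, Y₀, hL₀, hu₀, h₀, h₀', e₀, q₀, he₀, hq₀, rfl⟩ := ha
  obtain ⟨U₁, V₁, Y₁, hL₁, hu₁, h₁, h₁', e₁, q₁, he₁, hq₁, rfl⟩ := hb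
  obtain ⟨U, V, hU, hV, hUV, rfl, rfl, rfl, rfl⟩ := hL₀.exists_path hL₁ (hu₀.trans hu₁.symm)
  rw [IsQuantBoundary.eq_of_path hp H hJC hJ h hU hV hUV h₀ h₁ h₀' h₁' e₀ e₁ he₀ he₁,
    Subtype.ext (hq₀.trans hq₁.symm)]

/-- The parameters (5ε, 2r, 4N) are loose enough to cover both the generators and every point of a
homotopy. -/
theorem exists_liftPair (hp : p ≠ ∞) (H : IsFilteredSQpAlg.{u, v} p A)
    (hJC : J.IsCompletelyFiltered p C) (h : IsAdmissible C ε r N) {n : ℕ} {u v : (J.quot p).Mat n}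
    (huv : (J.quot p).QInvPair (5 * ε) (2 * r) (4 * N) n u v) :
    ∃ U V, J.IsLiftPair p (5 * ε) (A.matFil p n (2 * r)) (liftBound C N) U V ∧ J.mkMat p n U = u ∧
      J.mkMat p n V = v := by
  have hr : 0 < 2 * r := by linarith [h.r_pos]
  -- The added 1 turns the bound 4N into a strict one, as lifting requires; this explains 4N + 1 in
  -- `liftBound`.
  have hu : ‖u‖ < 4 * N + 1 := lt_of_le_of_lt huv.2.2.1 (by linarith)
  have hv : ‖v‖ < 4 * N + 1 := lt_of_le_of_lt huv.2.2.2.1 (by linarith)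
  obtain ⟨U, hU, rfl, hUn⟩ := hJC.exists_lift hp h.one_le_C H hr huv.1 hu
  obtain ⟨V, hV, rfl, hVn⟩ := hJC.exists_lift hp h.one_le_C H hr huv.2.1 hv
  exact ⟨U, V, ⟨hU, hV, hUn.le, hVn.le, huv.2.2.2.2.1, huv.2.2.2.2.2⟩, rfl, rfl⟩

theorem exists_isQuantBoundary_of_pair (hp : p ≠ ∞) (H : IsFilteredSQpAlg.{u, v} p A)
    (hJC : J.IsCompletelyFiltered p C) (hJ : ¬ J.opAlg.IsUnital) (h : IsAdmissible C ε r N) {n : ℕ}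
    {u v : (J.quot p).Mat n} (huv : (J.quot p).QInvPair (5 * ε) (2 * r) (4 * N) n u v) :
    ∃ a, J.IsQuantBoundary C ε r N u a := by
  obtain ⟨U, V, hUV, rfl, rfl⟩ := exists_liftPair hp H hJC h huv
  obtain ⟨Y, hY, hD⟩ := hUV.exists_correction_of_admissible hp H hJC h
  exact ⟨_, exists_isQuantBoundary H hJ h hUV hY hD⟩

/-- The path of quasi-inverse pairs is followed by lifts up to a small error but exactly at its
ends, so the single class attached to the path of lifts is a value for both u and v. -/
theorem exists_isQuantBoundary_of_htpy (hp : p ≠ ∞) (H : IsFilteredSQpAlg.{u, v} p A)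
    (hJC : J.IsCompletelyFiltered p C) (hJ : ¬ J.opAlg.IsUnital) (h : IsAdmissible C ε r N) {n : ℕ}
    {u v : (J.quot p).Mat n} (huv : (J.quot p).QInvHtpy (4 * ε) (2 * r) (4 * N) n u v) :
    ∃ a, J.IsQuantBoundary C ε r N u a ∧ J.IsQuantBoundary C ε r N v a := by
  obtain ⟨γ, δ, hγ, hδ, hm, rfl, rfl⟩ := huv
  have hlift : ∀ t, ∃ U V, J.IsLiftPair p (5 * ε) (A.matFil p n (2 * r)) (liftBound C N) U V ∧
      J.mkMat p n U = γ t ∧ J.mkMat p n V = δ t := fun t => exists_liftPair hp H hJC h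
    ((hm t).mono (by linarith [h.pos]) (by linarith [h.r_pos]) le_rfl le_rfl)
  obtain ⟨U, V, hU, hV, hUV, hu₀, hu₁, -, -⟩ := exists_liftPath
    (one_le_liftBound h.one_le_C h.one_le) h.pos ((J.quot_normCont_iff p).1 hγ)
    ((J.quot_normCont_iff p).1 hδ)
    (fun t => by
      obtain ⟨U, V, hL, hu, -⟩ := hlift t
      exact ⟨U, hL.1, hL.3, hu⟩)
    (fun t => by
      obtain ⟨U, V, hL, -, hv⟩ := hlift t
      exact ⟨V, hL.2, hL.4, hv⟩)
    (fun t => (hm t).2.2.2.2.1) (fun t => (hm t).2.2.2.2.2)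
  obtain ⟨Y₀, hY₀, hD₀⟩ := (hUV 0).exists_correction_of_admissible hp H hJC h
  obtain ⟨Y₁, hY₁, hD₁⟩ := (hUV 1).exists_correction_of_admissible hp H hJC h
  have q₀ := exists_isQuantBoundary H hJ h (hUV 0) hY₀ hD₀
  have q₁ := exists_isQuantBoundary H hJ h (hUV 1) hY₁ hD₁
  rw [hu₀] at q₀
  rw [hu₁] at q₁
  refine ⟨_, q₀, ?_⟩
  exact (congrArg (J.IsQuantBoundary C ε r N (γ 1)) (congrArg (· - _)
    (IsQuantBoundary.eq_of_path hp H hJC hJ h hU hV hUV hY₀ hY₁ hD₀ hD₁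
      ⟨_, qIdem_addCorner_of_admissible H hJ h (hUV 0) hY₀ hD₀⟩
      ⟨_, qIdem_addCorner_of_admissible H hJ h (hUV 1) hY₁ hD₁⟩ rfl rfl))).mpr q₁

end ClosedIdeal


/-! ### Additivity, relaxation of control, and the controlled morphism -/

namespace ClosedIdeal

variable {E : Type u} [NormedAddCommGroup E] [NormedSpace ℂ E] {p : ℝ≥0∞} [Fact (1 ≤ p)]
  {A : OpAlg E} {J : ClosedIdeal A} {C ε r N : ℝ}

theorem idealSum_mem_matFil {m n : ℕ} {Y : J.matIdeal p (m + m)} {Z : J.matIdeal p (n + n)}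
    (hY : Y.1 ∈ J.matFil p (m + m) r) (hZ : Z.1 ∈ J.matFil p (n + n) r) :
    (J.idealSum Y Z).1 ∈ J.matFil p ((m + n) + (m + n)) r := fun i j =>
  bdiag_forall (R := (A.tilde p).carrier) (P := fun x => A.val x ∈ J.opAlg.fil r)
    (zero_mem (J.opAlg.fil r)) hY hZ (midSwap m n i) (midSwap m n j)

/-- Both `relIdem` and diag(1,0) take block sums to block sums up to the exchange of the two middle
blocks, which does not affect classes. -/
theorem IsQuantBoundary.add (H : IsFilteredSQpAlg.{u, v} p A)
    (hJ : ¬ J.opAlg.IsUnital) (h : IsAdmissible C ε r N) {m n : ℕ} {x : (J.quot p).Mat m}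
    {y : (J.quot p).Mat n} {a b} (ha : J.IsQuantBoundary C ε r N x a)
    (hb : J.IsQuantBoundary C ε r N y b) :
    J.IsQuantBoundary C ε r N (bdiag x y) (a + b) := by
  obtain ⟨U, V, Y, hL, rfl, hY, hD, e, q, he, hq, rfl⟩ := ha
  obtain ⟨U', V', Y', hL', rfl, hY', hD', e', q', he', hq', rfl⟩ := hb
  have h1 := J.norm_opAlg_unit_le hJ
  have hl := one_le_lamBound h.one_le_C h.one_le
  have hm := idealSum_mem_matFil hY hY'
  have hd := norm_relIdem_sub_idealSum_lt hD hD'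
  refine ⟨bdiag U U', bdiag V V', J.idealSum Y Y', hL.bdiag hL', J.mkMat_bdiag p U U', hm, hd,
    ⟨_, qIdem_addCorner_of_admissible H hJ h (hL.bdiag hL') hm hd⟩,
    ⟨_, J.qIdem_cornerProj hJ (m + n) h.lam_mul_pos hl⟩, rfl, rfl, ?_⟩
  have key : ∀ (f : {e : (J.opAlg.tilde p).Mat (m + m) //
        (J.opAlg.tilde p).QIdem (lamBound C N * ε) (10 * r) (lamBound C N) (m + m) e})
      (f' : {e : (J.opAlg.tilde p).Mat (n + n) //
        (J.opAlg.tilde p).QIdem (lamBound C N * ε) (10 * r) (lamBound C N) (n + n) e})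
      (g : {e : (J.opAlg.tilde p).Mat ((m + n) + (m + n)) //
        (J.opAlg.tilde p).QIdem (lamBound C N * ε) (10 * r) (lamBound C N) _ e}),
      g.1 = (bdiag f.1 f'.1).submatrix (midSwap m n) (midSwap m n) →
      ((J.opAlg.tilde p).qIdemSystem _ _ _).cls g =
        ((J.opAlg.tilde p).qIdemSystem _ _ _).cls f +
          ((J.opAlg.tilde p).qIdemSystem _ _ _).cls f' := by
    intro f f' g hg
    rw [J.opAlg.qIdem_cls_submatrix p h1 hl (midSwap m n)
      ⟨_, J.opAlg.qIdem_bdiag p f.2 f'.2⟩ g hg]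
    exact KSystem.cls_sum _ _ _ _ rfl
  rw [key e e' _ (by rw [he, he']; exact addCorner_idealSum Y Y'),
    key q q' _ (by rw [hq, hq']; exact cornerProj_add_eq)]
  abel

theorem isLiftPair_one (hA : ‖A.unit‖ ≤ 1) {δ s M : ℝ} (hδ : 0 < δ) (hM : 1 ≤ M) (n : ℕ) :
    J.IsLiftPair p δ (A.matFil p n s) M (1 : (A.tilde p).Mat n) 1 := by
  have h1 := (A.norm_one_le p hA n).trans hM
  have h2 : ‖J.mkMat p n 1 * J.mkMat p n 1 - 1‖ < δ := by
    rw [map_one, mul_one, sub_self, norm_zero]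
    exact hδ
  exact ⟨OpAlg.one_mem_matFil n s, OpAlg.one_mem_matFil n s, h1, h1, h2, h2⟩

theorem isQuantBoundary_one (H : IsFilteredSQpAlg.{u, v} p A)
    (hJ : ¬ J.opAlg.IsUnital) (h : IsAdmissible C ε r N) (n : ℕ) :
    J.IsQuantBoundary C ε r N (1 : (J.quot p).Mat n) 0 := by
  have hε := h.pos
  have hL : J.IsLiftPair p (5 * ε) (A.matFil p n (2 * r)) (liftBound C N) (1 : (A.tilde p).Mat n) 1 :=
    isLiftPair_one H.norm_unit_le (by linarith) (one_le_liftBound h.one_le_C h.one_le) n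
  have hl := one_le_lamBound h.one_le_C h.one_le
  have hD : 0 < idealDist C N ε := by
    have h1 := one_le_liftBound h.one_le_C h.one_le
    have h2 := h.one_le_C
    unfold idealDist
    positivity
  refine ⟨1, 1, 0, hL, map_one _, Submodule.zero_mem _, ?_,
    ⟨_, J.qIdem_cornerProj hJ n h.lam_mul_pos hl⟩, ⟨_, J.qIdem_cornerProj hJ n h.lam_mul_pos hl⟩,
    ?_, rfl, (sub_self _).symm⟩
  · rw [relIdem_one_one]
    change ‖(0 : (A.tilde p).Mat (n + n)) - 0‖ < _
    rwa [sub_self, norm_zero]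
  · change _ = cornerProj _ n + J.toTilde p (n + n) 0
    rw [map_zero, add_zero]

/-- The same lifts and the same matrix over the ideal remain valid, because `liftBound`, `idealDist`
and the filtrations are monotone. -/
theorem IsQuantBoundary.relax {ε' r' N' : ℝ} (h : IsAdmissible C ε r N)
    (hε : ε ≤ ε') (hr : r ≤ r') (hN : N ≤ N') {n : ℕ} {u : (J.quot p).Mat n} {a}
    (ha : J.IsQuantBoundary C ε r N u a) (h₁ : lamBound C N * ε ≤ lamBound C N' * ε')
    (h₂ : 0 < 10 * r) (h₃ : 10 * r ≤ 10 * r') (h₄ : lamBound C N ≤ lamBound C N') :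
    J.IsQuantBoundary C ε' r' N' u ((J.opAlg.tilde p).relaxQK0 h₁ h₂ h₃ h₄ a) := by
  obtain ⟨U, V, Y, hL, rfl, hY, hD, e, q, he, hq, rfl⟩ := ha
  refine ⟨U, V, Y, hL.mono (by linarith) (by linarith) (by linarith)
    (liftBound_mono h.one_le_C hN), rfl, J.matFil_mono p h₂ h₃ hY,
    hD.trans_le (idealDist_mono h.one_le_C h.one_le hN h.pos.le hε),
    ⟨e.1, e.2.mono h₁ h₂ h₃ h₄⟩, ⟨q.1, q.2.mono h₁ h₂ h₃ h₄⟩, he, hq, ?_⟩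
  rw [map_sub]
  unfold MatrixAlg.relaxQK0
  exact congrArg₂ (· - ·) (KSystem.map_cls (S := (J.opAlg.tilde p).qIdemSystem _ _ _) _ _ _ _ _ e)
    (KSystem.map_cls (S := (J.opAlg.tilde p).qIdemSystem _ _ _) _ _ _ _ _ q)

variable [CompleteSpace E]

/-- The boundary map on `K_1^{ε,r,N}(Ã/J)`. -/
theorem exists_quantBoundary (hp : p ≠ ∞) (H : IsFilteredSQpAlg.{u, v} p A)
    (hJC : J.IsCompletelyFiltered p C) (hJ : ¬ J.opAlg.IsUnital) (h : IsAdmissible C ε r N) :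
    ∃ f : (J.quot p).QK1 ε r N →+
        (J.opAlg.tilde p).QK0 (lamBound C N * ε) (10 * r) (lamBound C N),
      ∀ (n : ℕ) (u : {u : (J.quot p).Mat n // (J.quot p).QInv ε r N n u}) a,
        J.IsQuantBoundary C ε r N u.1 a → f (((J.quot p).qInvSystem ε r N).cls u) = a := by
  have hε := h.pos
  have hN := h.one_le
  have hr := h.r_pos
  have h1 : ∀ n, (J.quot p).QInv ε r N n (1 : (J.quot p).Mat n) := by
    intro n
    have hu : ‖(1 : (J.quot p).Mat n)‖ ≤ N := (J.norm_one_le p H.norm_unit_le n).trans hN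
    have hd : ‖(1 : (J.quot p).Mat n) * 1 - 1‖ < ε := by
      rwa [mul_one, sub_self, norm_zero]
    have hm : ∀ i j, (1 : (J.quot p).Mat n) i j ∈ (J.quot p).fil r := fun i j =>
      ⟨(1 : (A.tilde p).Mat n) i j, OpAlg.one_mem_matFil n r i j,
        congrFun (congrFun (map_one (J.mkMat p n)) i) j⟩
    exact ⟨1, hm, hm, hu, hu, hd, hd⟩
  refine KSystem.exists_hom_of_rel (S := (J.quot p).qInvSystem ε r N)
    (fun n u a => J.IsQuantBoundary C ε r N u.1 a) ?_ ?_ ?_ h1 ?_ ?_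
  · rintro n ⟨u, v, huv⟩
    exact exists_isQuantBoundary_of_pair hp H hJC hJ h
      (huv.mono (by linarith) hr (by linarith) (by linarith))
  · exact fun n u a b ha hb => ha.unique hp H hJC hJ h hb
  · exact fun n x y hxy => exists_isQuantBoundary_of_htpy hp H hJC hJ h hxy
  · exact fun k => isQuantBoundary_one H hJ h k
  · intro n m x y z a b hz ha hb
    rw [hz]
    exact ha.add H hJ h hb

theorem character_addCorner (hJ : ¬ J.opAlg.IsUnital) {n : ℕ} (Y : J.matIdeal p (n + n)) :
    (J.opAlg.characterHom p hJ).mat (n + n) (J.addCorner Y) =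
      (J.opAlg.characterHom p hJ).mat (n + n) (cornerProj (J.opAlg.tilde p).carrier n) := by
  unfold addCorner
  rw [map_add]
  refine add_eq_left.2 ?_
  ext i j
  exact J.opAlg.character_eq_zero hJ (Y.2 i j)

/-- Matrices over the ideal have no scalar part, so the two quasi-idempotents have the same image
over ℂ and their difference dies there. -/
theorem IsQuantBoundary.mem_QK0 (hJ : ¬ J.opAlg.IsUnital) {n : ℕ} {u : (J.quot p).Mat n} {a}
    (ha : J.IsQuantBoundary C ε r N u a) :
    a ∈ J.opAlg.QK0 p (lamBound C N * ε) (10 * r) (lamBound C N) := by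
  obtain ⟨U, V, Y, -, -, -, -, e, q, he, hq, rfl⟩ := ha
  unfold OpAlg.QK0
  rw [dif_neg hJ, AddMonoidHom.mem_ker, map_sub, sub_eq_zero]
  unfold MatrixAlg.Hom.mapQK0
  refine (KSystem.map_cls (S := (J.opAlg.tilde p).qIdemSystem _ _ _) _ _ _ _ _ e).trans
    (Eq.trans ?_ (KSystem.map_cls (S := (J.opAlg.tilde p).qIdemSystem _ _ _) _ _ _ _ _ q).symm)
  congr 2
  rw [he, hq]
  exact character_addCorner hJ Y

theorem mem_of_forall_cls {R : Type u} [Zero R] (S : KSystem R) {H : Type w} [AddCommGroup H]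
    (f : S.Group →+ H) (K : AddSubgroup H)
    (h : ∀ (n : ℕ) (x : {x : Matrix (Fin n) (Fin n) R // S.mem n x}), f (S.cls x) ∈ K)
    (x : S.Group) : f x ∈ K := by
  have h1 : (QuotientAddGroup.mk' K).comp f = 0 := KSystem.hom_ext S fun n x =>
    (QuotientAddGroup.eq_zero_iff _).2 (h n x)
  exact (QuotientAddGroup.eq_zero_iff _).1 (DFunLike.congr_fun h1 x)

/-- The controlled boundary morphism. -/
theorem exists_controlledBoundary (hC : 1 ≤ C) (hp : p ≠ ∞) (H : IsFilteredSQpAlg.{u, v} p A)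
    (hJC : J.IsCompletelyFiltered p C) (hJ : ¬ J.opAlg.IsUnital) :
    ∃ (D : ControlledMorphism (boundaryControl C hC) (J.familyQuotK1 p) (J.opAlg.familyK0 p))
      (f : ∀ ε r N : ℝ, (J.quot p).QK1 ε r N →+
        (J.opAlg.tilde p).QK0 (lamBound C N * ε) (10 * r) (lamBound C N)),
      (∀ ε r N, IsAdmissible C ε r N →
        ∀ (n : ℕ) (u : {u : (J.quot p).Mat n // (J.quot p).QInv ε r N n u}) a,
          J.IsQuantBoundary C ε r N u.1 a → f ε r N (((J.quot p).qInvSystem ε r N).cls u) = a) ∧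
      ∀ (ε r N : ℝ) (x : J.quotQK1 p ε r N),
        (D.map ε r N x : J.opAlg.QK0 p _ _ _).1 = f ε r N x.1 := by
  classical
  have hex : ∀ ε r N : ℝ, ∃ f : (J.quot p).QK1 ε r N →+
      (J.opAlg.tilde p).QK0 (lamBound C N * ε) (10 * r) (lamBound C N),
      (IsAdmissible C ε r N → ∀ (n : ℕ) (u : {u : (J.quot p).Mat n // (J.quot p).QInv ε r N n u}) a,
        J.IsQuantBoundary C ε r N u.1 a → f (((J.quot p).qInvSystem ε r N).cls u) = a) ∧
      (∀ x, f x ∈ J.opAlg.QK0 p (lamBound C N * ε) (10 * r) (lamBound C N)) := by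
    intro ε r N
    by_cases h : IsAdmissible C ε r N
    · obtain ⟨f, hf⟩ := exists_quantBoundary hp H hJC hJ h
      refine ⟨f, fun _ => hf, mem_of_forall_cls _ f _ ?_⟩
      rintro n ⟨u, v, huv⟩
      have hε := h.pos
      have hN := h.one_le
      have hr := h.r_pos
      obtain ⟨a, ha⟩ := exists_isQuantBoundary_of_pair hp H hJC hJ h
        (huv.mono (by linarith) hr (by linarith) (by linarith))
      exact (congrArg (· ∈ J.opAlg.QK0 p _ _ _) (hf n ⟨u, v, huv⟩ a ha)).mpr (ha.mem_QK0 hJ)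
    -- Outside the admissible range the value is irrelevant; zero is a default that lies in every
    -- subgroup.
    · exact ⟨0, fun h' => absurd h' h, fun _ => zero_mem _⟩
  choose f hf hfm using hex
  refine ⟨⟨fun ε r N => ((f ε r N).comp (J.quotQK1 p ε r N).subtype).codRestrict
    (J.opAlg.QK0 p (lamBound C N * ε) (10 * r) (lamBound C N)) fun x => hfm ε r N x.1, ?_⟩, f,
    fun ε r N => hf ε r N, fun ε r N x => rfl⟩
  intro ε ε' r r' N N' hε₀ hε hε' hr₀ hr hh hN₁ hN x
  have had' : IsAdmissible C ε' r' N' :=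
    ⟨hC, hε₀.trans_le hε, hε', hr₀.trans_le hr, hN₁.trans hN⟩
  have hl := lamBound_mono hC hN₁ hN
  have hlt : ε' < 1 / (20 * lamBound C N') := hε'
  have had : IsAdmissible C ε r N := ⟨hC, hε₀, (hε.trans_lt hlt).trans_le (by
    have := one_le_lamBound hC hN₁
    exact one_div_le_one_div_of_le (by linarith) (by linarith)), hr₀, hN₁⟩
  have key : (f ε' r' N').comp ((J.quot p).relaxQK1 hε hr₀ hr hN) =
      ((J.opAlg.tilde p).relaxQK0 ((boundaryControl C hC).lam_mul_le hε₀ hε hN₁ hN)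
        ((boundaryControl C hC).h_mul_pos hε₀ hε hN₁ hN hε' hr₀) hh
        ((boundaryControl C hC).lam_mono N N' hN₁ hN)).comp (f ε r N) := by
    refine KSystem.hom_ext _ ?_
    rintro n ⟨u, v, huv⟩
    obtain ⟨a, ha⟩ := exists_isQuantBoundary_of_pair hp H hJC hJ had
      (huv.mono (by linarith) hr₀ (by linarith) (by linarith))
    have e1 := hf ε r N had n ⟨u, v, huv⟩ a ha
    have e2 := ha.relax had hε hr hN ((boundaryControl C hC).lam_mul_le hε₀ hε hN₁ hN)
        ((boundaryControl C hC).h_mul_pos hε₀ hε hN₁ hN hε' hr₀) hh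
        ((boundaryControl C hC).lam_mono N N' hN₁ hN)
    refine (Eq.trans (congrArg (f ε' r' N') ?_)
      (hf ε' r' N' had' n ⟨u, v, huv.mono hε hr₀ hr hN⟩ _ e2)).trans
      (congrArg ((J.opAlg.tilde p).relaxQK0 _ _ _ _) e1.symm)
    exact KSystem.map_cls (S := (J.quot p).qInvSystem ε r N) _ _ _ _ _ _
  exact Subtype.ext (DFunLike.congr_fun key x.1)

end ClosedIdeal


/-! ### The boundary map in ordinary `K`-theory -/

/-- In a seminormed ring, the inverses along a continuous path depend continuously. -/
theorem continuous_of_mul_eq_one {T S : Type*} [TopologicalSpace T] [SeminormedRing S]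
    {u v : T → S} (hu : Continuous u) (h : ∀ t, u t * v t = 1) (h' : ∀ t, v t * u t = 1) :
    Continuous v := by
  rw [continuous_iff_continuousAt]
  intro t
  have h1 : Filter.Tendsto (fun s => ‖u s - u t‖) (𝓝 t) (𝓝 0) :=
    tendsto_iff_norm_sub_tendsto_zero.1 hu.continuousAt
  have h2 : ∀ᶠ s in 𝓝 t, ‖v t‖ * ‖u s - u t‖ < 1 / 2 := by
    have := h1.const_mul ‖v t‖
    rw [mul_zero] at this
    exact this.eventually (gt_mem_nhds (by norm_num))
  refine tendsto_iff_norm_sub_tendsto_zero.2 ?_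
  have h3 : Filter.Tendsto (fun s => 2 * ‖v t‖ ^ 2 * ‖u s - u t‖) (𝓝 t) (𝓝 0) := by
    have := h1.const_mul (2 * ‖v t‖ ^ 2)
    rwa [mul_zero] at this
  refine squeeze_zero' (Filter.Eventually.of_forall fun _ => norm_nonneg _) ?_ h3
  filter_upwards [h2] with s hs
  have e : v s - v t = -(v s * (u s - u t) * v t) := by
    rw [mul_sub, sub_mul, h', one_mul, mul_assoc, h, mul_one]
    abel
  have h4 : ‖v s - v t‖ ≤ ‖v s‖ * (‖v t‖ * ‖u s - u t‖) := by
    rw [e, norm_neg]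
    refine (norm_mul_le _ _).trans ((mul_le_mul_of_nonneg_right (norm_mul_le _ _)
      (norm_nonneg _)).trans (le_of_eq (by ring)))
  have h5 : ‖v s‖ ≤ ‖v t‖ + ‖v s - v t‖ := by
    have := norm_add_le (v t) (v s - v t)
    rwa [add_sub_cancel] at this
  have h6 : ‖v s‖ ≤ 2 * ‖v t‖ := by nlinarith [norm_nonneg (v s)]
  calc _ ≤ ‖v s‖ * (‖v t‖ * ‖u s - u t‖) := h4
    _ ≤ 2 * ‖v t‖ * (‖v t‖ * ‖u s - u t‖) := by gcongr
    _ = _ := by ring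

namespace ClosedIdeal

variable {E : Type u} [NormedAddCommGroup E] [NormedSpace ℂ E] {p : ℝ≥0∞} [Fact (1 ≤ p)]
  {A : OpAlg E} (J : ClosedIdeal A)

/-- The value of the boundary map on an invertible `u` is `[diag(1, 0) + y] - [diag(1, 0)]`, where
`y = relIdem U V` for lifts `U`, `V` of `u` and its inverse. -/
def IsExactBoundary {n : ℕ} (u : (J.quot p).Mat n) (a : (J.opAlg.tilde p).K0) : Prop :=
  ∃ (U V : (A.tilde p).Mat n) (Y : J.matIdeal p (n + n)),
    J.mkMat p n U * J.mkMat p n V = 1 ∧ J.mkMat p n V * J.mkMat p n U = 1 ∧ J.mkMat p n U = u ∧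
    Y.1 = relIdem U V ∧
    ∃ e q : {e : (J.opAlg.tilde p).Mat (n + n) // e * e = e},
      e.1 = J.addCorner Y ∧ q.1 = cornerProj (J.opAlg.tilde p).carrier n ∧
      a = (J.opAlg.tilde p).idemSystem.cls e - (J.opAlg.tilde p).idemSystem.cls q

variable {J}

theorem relIdem_mem_matIdeal {n : ℕ} {U V : (A.tilde p).Mat n}
    (h : J.mkMat p n U * J.mkMat p n V = 1) (h' : J.mkMat p n V * J.mkMat p n U = 1) :
    relIdem U V ∈ J.matIdeal p (n + n) := by
  rw [mem_matIdeal_iff, mkMat_relIdem]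
  exact relIdem_of_mul_eq_one h h'

theorem addCorner_relIdem_mul_self (hJ : ¬ J.opAlg.IsUnital) {n : ℕ} {U V : (A.tilde p).Mat n}
    {Y : J.matIdeal p (n + n)} (hY : Y.1 = relIdem U V) :
    J.addCorner Y * J.addCorner Y = J.addCorner Y := by
  refine J.addCorner_mul_self hJ ?_
  rw [hY]
  exact cornerProj_add_relIdem_mul_self U V

theorem exists_isExactBoundary_of_lifts (hJ : ¬ J.opAlg.IsUnital) {n : ℕ} {U V : (A.tilde p).Mat n}
    (h : J.mkMat p n U * J.mkMat p n V = 1) (h' : J.mkMat p n V * J.mkMat p n U = 1) :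
    J.IsExactBoundary (J.mkMat p n U) ((J.opAlg.tilde p).idemSystem.cls
      ⟨_, addCorner_relIdem_mul_self hJ (Y := ⟨_, relIdem_mem_matIdeal h h'⟩) rfl⟩ -
        (J.opAlg.tilde p).idemSystem.cls
          ⟨cornerProj (J.opAlg.tilde p).carrier n, cornerProj_mul_self⟩) :=
  ⟨U, V, ⟨_, relIdem_mem_matIdeal h h'⟩, h, h', rfl, rfl, _, _, rfl, rfl, rfl⟩

theorem IsExactBoundary.add (hJ : ¬ J.opAlg.IsUnital) {m n : ℕ} {x : (J.quot p).Mat m}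
    {y : (J.quot p).Mat n} {a b} (ha : J.IsExactBoundary x a) (hb : J.IsExactBoundary y b) :
    J.IsExactBoundary (bdiag x y) (a + b) := by
  obtain ⟨U, V, Y, hr, hl, rfl, hY, e, q, he, hq, rfl⟩ := ha
  obtain ⟨U', V', Y', hr', hl', rfl, hY', e', q', he', hq', rfl⟩ := hb
  have hs : (J.idealSum Y Y').1 = relIdem (bdiag U U') (bdiag V V') := by
    rw [relIdem_bdiag, ← hY, ← hY']
    rfl
  refine ⟨bdiag U U', bdiag V V', J.idealSum Y Y', ?_, ?_, J.mkMat_bdiag p U U', hs,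
    ⟨_, addCorner_relIdem_mul_self hJ hs⟩, ⟨_, cornerProj_mul_self⟩, rfl, rfl, ?_⟩
  · rw [mkMat_bdiag, mkMat_bdiag, bdiag_mul, hr, hr', bdiag_one]
  · rw [mkMat_bdiag, mkMat_bdiag, bdiag_mul, hl, hl', bdiag_one]
  have key : ∀ (f : {e : (J.opAlg.tilde p).Mat (m + m) // e * e = e})
      (f' : {e : (J.opAlg.tilde p).Mat (n + n) // e * e = e})
      (g : {e : (J.opAlg.tilde p).Mat ((m + n) + (m + n)) // e * e = e}),
      g.1 = (bdiag f.1 f'.1).submatrix (midSwap m n) (midSwap m n) →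
      (J.opAlg.tilde p).idemSystem.cls g =
        (J.opAlg.tilde p).idemSystem.cls f + (J.opAlg.tilde p).idemSystem.cls f' := by
    intro f f' g hg
    have hff : bdiag f.1 f'.1 * bdiag f.1 f'.1 = bdiag f.1 f'.1 := by rw [bdiag_mul, f.2, f'.2]
    rw [J.opAlg.idem_cls_submatrix p (midSwap m n) ⟨_, hff⟩ g hg]
    exact KSystem.cls_sum _ _ _ _ rfl
  rw [key e e' _ (by rw [he, he']; exact addCorner_idealSum Y Y'),
    key q q' _ (by rw [hq, hq']; exact cornerProj_add_eq)]
  abel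

theorem isExactBoundary_one (n : ℕ) : J.IsExactBoundary (1 : (J.quot p).Mat n) 0 := by
  refine ⟨1, 1, 0, by simp, by simp, map_one _, ?_, ⟨_, cornerProj_mul_self⟩,
    ⟨_, cornerProj_mul_self⟩, ?_, rfl, (sub_self _).symm⟩
  · rw [relIdem_one_one]
    rfl
  · change _ = cornerProj _ n + J.toTilde p (n + n) 0
    rw [map_zero, add_zero]

theorem exists_isExactBoundary (hJ : ¬ J.opAlg.IsUnital) {n : ℕ} {u : (J.quot p).Mat n}
    (hu : IsUnit u) : ∃ a, J.IsExactBoundary u a := by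
  obtain ⟨v, h, h'⟩ := isUnit_iff_exists.1 hu
  obtain ⟨U, rfl⟩ := J.mkMat_surjective p n u
  obtain ⟨V, rfl⟩ := J.mkMat_surjective p n v
  exact ⟨_, exists_isExactBoundary_of_lifts hJ h h'⟩

variable [CompleteSpace E]

/-- Without propagation constraints, approximants over the ideal are chosen continuously along the
path, and the spectral idempotents of the resulting quasi-idempotents form a homotopy. The end
points may be exact or approximate, which serves both the definition of the ordinary boundary and
the comparison. -/
theorem idem_cls_eq_of_liftPath (hA : ‖A.unit‖ ≤ 1) (hJ : ¬ J.opAlg.IsUnital) {n : ℕ}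
    {δ M D : ℝ} (hM : 1 ≤ M) (hδ : δ ≤ 1) (hδD : 6 * M ^ 3 * δ ≤ D) (hD : D ≤ 1)
    (hMD : 24 * M ^ 5 * D < 1 / 4) {𝒰 : Submodule ℂ ((A.tilde p).Mat n)}
    {U V : unitInterval → (A.tilde p).Mat n} (hU : Continuous U) (hV : Continuous V)
    (hUV : ∀ t, J.IsLiftPair p δ 𝒰 M (U t) (V t)) {Y₀ Y₁ : J.matIdeal p (n + n)}
    (h₀ : ‖relIdem (U 0) (V 0) - Y₀.1‖ < D) (h₁ : ‖relIdem (U 1) (V 1) - Y₁.1‖ < D)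
    (e₀ e₁ : {e : (J.opAlg.tilde p).Mat (n + n) // e * e = e})
    (he₀ : e₀.1 = spectralIdem (J.addCorner Y₀)) (he₁ : e₁.1 = spectralIdem (J.addCorner Y₁)) :
    (J.opAlg.tilde p).idemSystem.cls e₀ = (J.opAlg.tilde p).idemSystem.cls e₁ := by
  obtain ⟨γ, hγ, -, hd, rfl, rfl⟩ := J.exists_path_relIdem ⊤ hU hV
    (fun t => by
      obtain ⟨Y, hY⟩ := exists_ideal_of_norm_mkMat_lt
        (((hUV t).norm_mkMat_relIdem_lt hM hδ).trans_le hδD)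
      exact ⟨Y, trivial, hY⟩) (Y₀ := Y₀) (Y₁ := Y₁) trivial trivial h₀ h₁
  exact J.opAlg.idem_cls_eq_of_path p (γ := fun t => J.addCorner (γ t))
    (J.continuous_addCorner.comp hγ) hMD
    (fun t => (J.norm_addCorner_defect_lt hA hJ hM hD (hUV t).3 (hUV t).4 (hd t)).le) e₀ e₁ he₀ he₁

/-- The tolerance 1/(1000M⁸) is chosen so that the defect bound 24M⁵ · 6M³/(1000M⁸) = 144/1000 stays
below 1/4. At the ends the idempotents are exact and hence equal to their spectral idempotents. -/
theorem IsExactBoundary.eq_of_liftPath (hA : ‖A.unit‖ ≤ 1) (hJ : ¬ J.opAlg.IsUnital) {n : ℕ}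
    {M : ℝ} (hM : 1 ≤ M) {𝒰 : Submodule ℂ ((A.tilde p).Mat n)}
    {U V : unitInterval → (A.tilde p).Mat n} (hU : Continuous U) (hV : Continuous V)
    (hUV : ∀ t, J.IsLiftPair p (1 / (1000 * M ^ 8)) 𝒰 M (U t) (V t)) {Y₀ Y₁ : J.matIdeal p (n + n)}
    (h₀ : Y₀.1 = relIdem (U 0) (V 0)) (h₁ : Y₁.1 = relIdem (U 1) (V 1))
    (e₀ e₁ : {e : (J.opAlg.tilde p).Mat (n + n) // e * e = e})
    (he₀ : e₀.1 = J.addCorner Y₀) (he₁ : e₁.1 = J.addCorner Y₁) :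
    (J.opAlg.tilde p).idemSystem.cls e₀ = (J.opAlg.tilde p).idemSystem.cls e₁ := by
  have hM8 : 1 ≤ M ^ 8 := one_le_pow₀ hM
  have hM3 : M ^ 3 ≤ M ^ 8 := pow_le_pow_right₀ hM (by norm_num)
  have hD : 0 < 6 * M ^ 3 * (1 / (1000 * M ^ 8)) := by positivity
  refine idem_cls_eq_of_liftPath hA hJ hM ?_ le_rfl ?_ ?_ hU hV hUV (Y₀ := Y₀) (Y₁ := Y₁)
    ?_ ?_ e₀ e₁ ?_ ?_
  · rw [div_le_one (by positivity)]
    linarith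
  · rw [mul_one_div, div_le_one (by positivity)]
    linarith
  · have : 24 * M ^ 5 * (6 * M ^ 3 * (1 / (1000 * M ^ 8))) = 144 / 1000 := by
      field_simp
      norm_num
    rw [this]
    norm_num
  · rwa [h₀, sub_self, norm_zero]
  · rwa [h₁, sub_self, norm_zero]
  · rw [← he₀, spectralIdem_of_idem e₀.2]
  · rw [← he₁, spectralIdem_of_idem e₁.2]

theorem IsExactBoundary.unique (hA : ‖A.unit‖ ≤ 1) (hJ : ¬ J.opAlg.IsUnital) {n : ℕ}
    {u : (J.quot p).Mat n} {a b} (ha : J.IsExactBoundary u a) (hb : J.IsExactBoundary u b) :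
    a = b := by
  obtain ⟨U₀, V₀, Y₀, hr₀, hl₀, hu₀, h₀, e₀, q₀, he₀, hq₀, rfl⟩ := ha
  obtain ⟨U₁, V₁, Y₁, hr₁, hl₁, hu₁, h₁, e₁, q₁, he₁, hq₁, rfl⟩ := hb
  -- No uniform bound on lifts is available or needed here: M only has to dominate the four given
  -- ones, and ⊤ replaces the filtration.
  set M := 1 + ‖U₀‖ + ‖V₀‖ + ‖U₁‖ + ‖V₁‖ with hM
  have a1 := norm_nonneg U₀
  have a2 := norm_nonneg V₀
  have a3 := norm_nonneg U₁
  have a4 := norm_nonneg V₁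
  have hM1 : 1 ≤ M := by linarith
  have hδ : 0 < 1 / (1000 * M ^ 8) := by positivity
  have hz : ∀ {x : (J.quot p).Mat n}, x = 1 → ‖x - 1‖ < 1 / (1000 * M ^ 8) := by
    rintro x rfl
    rwa [sub_self, norm_zero]
  have hL₀ : J.IsLiftPair p (1 / (1000 * M ^ 8)) ⊤ M U₀ V₀ :=
    ⟨trivial, trivial, by linarith, by linarith, hz hr₀, hz hl₀⟩
  have hL₁ : J.IsLiftPair p (1 / (1000 * M ^ 8)) ⊤ M U₁ V₁ :=
    ⟨trivial, trivial, by linarith, by linarith, hz hr₁, hz hl₁⟩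
  obtain ⟨U, V, hU, hV, hUV, rfl, rfl, rfl, rfl⟩ := hL₀.exists_path hL₁ (hu₀.trans hu₁.symm)
  rw [IsExactBoundary.eq_of_liftPath hA hJ hM1 hU hV hUV h₀ h₁ e₀ e₁ he₀ he₁,
    Subtype.ext (hq₀.trans hq₁.symm)]

theorem exists_isExactBoundary_of_htpy (hA : ‖A.unit‖ ≤ 1) (hJ : ¬ J.opAlg.IsUnital) {n : ℕ}
    {u v : (J.quot p).Mat n} (h : (J.quot p).invSystem.htpy n u v) :
    ∃ a, J.IsExactBoundary u a ∧ J.IsExactBoundary v a := by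
  obtain ⟨γ, hγ, hm, rfl, rfl⟩ := h
  rw [quot_normCont_iff] at hγ
  choose δ hδ₁ hδ₂ using fun t => isUnit_iff_exists.1 (hm t)
  have hδ : Continuous δ := continuous_of_mul_eq_one hγ hδ₁ hδ₂
  obtain ⟨K₁, hK₁⟩ := isCompact_univ.exists_bound_of_continuousOn hγ.continuousOn
  obtain ⟨K₂, hK₂⟩ := isCompact_univ.exists_bound_of_continuousOn hδ.continuousOn
  set M := max 1 (max K₁ K₂ + 1) with hM
  have hM1 : 1 ≤ M := le_max_left _ _
  have hMK : max K₁ K₂ < M := (lt_add_one _).trans_le (le_max_right _ _)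
  have hγM : ∀ t, ∃ U ∈ (⊤ : Submodule ℂ ((A.tilde p).Mat n)), ‖U‖ ≤ M ∧
      J.mkMat p n U = γ t := fun t => by
    obtain ⟨U, hU, hn⟩ := (J.norm_lt_iff p).1
      (((hK₁ t trivial).trans (le_max_left _ _)).trans_lt hMK)
    exact ⟨U, trivial, hn.le, hU⟩
  have hδM : ∀ t, ∃ V ∈ (⊤ : Submodule ℂ ((A.tilde p).Mat n)), ‖V‖ ≤ M ∧
      J.mkMat p n V = δ t := fun t => by
    obtain ⟨U, hU, hn⟩ := (J.norm_lt_iff p).1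
      (((hK₂ t trivial).trans (le_max_right _ _)).trans_lt hMK)
    exact ⟨U, trivial, hn.le, hU⟩
  -- Path lifting yields pairs at level five times the tolerance, so 5000 leads to the level
  -- 1/(1000M⁸) wanted above.
  have hε : 0 < 1 / (5000 * M ^ 8) := by positivity
  obtain ⟨U, V, hU, hV, hUV, hu₀, hu₁, hv₀, hv₁⟩ := exists_liftPath hM1 hε hγ hδ hγM hδM
    (fun t => by rw [hδ₁, sub_self, norm_zero]; linarith)
    (fun t => by rw [hδ₂, sub_self, norm_zero]; linarith)
  have he : 5 * (1 / (5000 * M ^ 8)) = 1 / (1000 * M ^ 8) := by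
    field_simp
    norm_num
  rw [he] at hUV
  have r₀ : J.mkMat p n (U 0) * J.mkMat p n (V 0) = 1 := by rw [hu₀, hv₀, hδ₁]
  have l₀ : J.mkMat p n (V 0) * J.mkMat p n (U 0) = 1 := by rw [hu₀, hv₀, hδ₂]
  have r₁ : J.mkMat p n (U 1) * J.mkMat p n (V 1) = 1 := by rw [hu₁, hv₁, hδ₁]
  have l₁ : J.mkMat p n (V 1) * J.mkMat p n (U 1) = 1 := by rw [hu₁, hv₁, hδ₂]
  have q₀ := exists_isExactBoundary_of_lifts hJ r₀ l₀
  have q₁ := exists_isExactBoundary_of_lifts hJ r₁ l₁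
  rw [hu₀] at q₀
  rw [hu₁] at q₁
  refine ⟨_, q₀, ?_⟩
  exact (congrArg (J.IsExactBoundary (γ 1)) (congrArg (· - _)
    (IsExactBoundary.eq_of_liftPath hA hJ hM1 hU hV hUV rfl rfl _ _ rfl rfl))).mpr q₁

theorem IsExactBoundary.mem_K0 (hJ : ¬ J.opAlg.IsUnital) {n : ℕ} {u : (J.quot p).Mat n} {a}
    (ha : J.IsExactBoundary u a) : a ∈ J.opAlg.K0 p := by
  obtain ⟨U, V, Y, -, -, -, -, e, q, he, hq, rfl⟩ := ha
  unfold OpAlg.K0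
  rw [dif_neg hJ, AddMonoidHom.mem_ker, map_sub, sub_eq_zero]
  unfold MatrixAlg.Hom.mapK0
  refine (KSystem.map_cls (S := (J.opAlg.tilde p).idemSystem) _ _ _ _ _ e).trans
    (Eq.trans ?_ (KSystem.map_cls (S := (J.opAlg.tilde p).idemSystem) _ _ _ _ _ q).symm)
  congr 2
  rw [he, hq]
  exact character_addCorner hJ Y

theorem exists_boundary (hA : ‖A.unit‖ ≤ 1) (hJ : ¬ J.opAlg.IsUnital) :
    ∃ d : J.quotK1 p →+ J.opAlg.K0 p,
      ∀ (n : ℕ) (u : {u : (J.quot p).Mat n // IsUnit u}) a, J.IsExactBoundary u.1 a →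
        (d ((J.quot p).invSystem.cls u) : (J.opAlg.tilde p).K0) = a := by
  obtain ⟨f, hf⟩ := KSystem.exists_hom_of_rel (S := (J.quot p).invSystem)
    (fun n u a => J.IsExactBoundary u.1 a) (fun n x => exists_isExactBoundary hJ x.2)
    (fun n x a b ha hb => ha.unique hA hJ hb)
    (fun n x y hxy => exists_isExactBoundary_of_htpy hA hJ hxy) (fun k => isUnit_one)
    (fun k => isExactBoundary_one k) (fun n m x y z a b hz ha hb => by
      rw [hz]
      exact ha.add hJ hb)
  refine ⟨f.codRestrict _ (mem_of_forall_cls _ f _ fun n u => ?_), hf⟩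
  obtain ⟨a, ha⟩ := exists_isExactBoundary hJ u.2
  rw [hf n u a ha]
  exact ha.mem_K0 hJ

end ClosedIdeal


/-! ### The boundary class computed from an arbitrary invertible lift -/

namespace ClosedIdeal

variable {E : Type u} [NormedAddCommGroup E] [NormedSpace ℂ E] {p : ℝ≥0∞} [Fact (1 ≤ p)]
  {A : OpAlg E} {J : ClosedIdeal A}

theorem mkMat_liftUnitInv {n : ℕ} {U V : (A.tilde p).Mat n}
    (h : J.mkMat p n U * J.mkMat p n V = 1) (h' : J.mkMat p n V * J.mkMat p n U = 1) :
    J.mkMat p (n + n) (liftUnitInv U V) = bdiag (J.mkMat p n V) (J.mkMat p n U) := by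
  rw [liftUnitInv, mkMat_blk, bdiag_eq_blk]
  simp only [map_sub, map_add, map_mul, map_one, h, h', sub_self, one_mul, add_sub_cancel_right]

/-- If `w` and `w'` are mutually inverse and `w` lifts `diag(u, u')`, then `w'` lifts
`diag(u', u)`. -/
theorem mkMat_inv {n : ℕ} {u u' : (J.quot p).Mat n} {w w' : (A.tilde p).Mat (n + n)}
    (h : u * u' = 1) (h' : u' * u = 1) (hw' : w' * w = 1)
    (hw : J.mkMat p (n + n) w = bdiag u u') : J.mkMat p (n + n) w' = bdiag u' u := by
  refine left_inv_eq_right_inv (a := J.mkMat p (n + n) w) ?_ ?_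
  · rw [← map_mul, hw', map_one]
  · rw [hw, bdiag_mul, h, h', bdiag_one]

theorem conj_sub_mem {n : ℕ} {u u' : (J.quot p).Mat n} {w w' : (A.tilde p).Mat (n + n)}
    (h : u * u' = 1) (h' : u' * u = 1) (hw' : w' * w = 1)
    (hw : J.mkMat p (n + n) w = bdiag u u') :
    w * cornerProj (A.tilde p).carrier n * w' - cornerProj (A.tilde p).carrier n ∈
      J.matIdeal p (n + n) := by
  rw [mem_matIdeal_iff, map_sub, map_mul, map_mul, mkMat_cornerProj, hw, mkMat_inv h h' hw' hw,
    cornerProj, bdiag_mul, bdiag_mul, mul_one, mul_zero, zero_mul, h, sub_self]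

theorem val_addCorner_sub {n : ℕ} (Y : J.matIdeal p (n + n)) (i j : Fin (n + n)) :
    J.opAlg.val ((J.addCorner Y - cornerProj (J.opAlg.tilde p).carrier n) i j) =
      A.val (Y.1 i j) := by
  have : J.addCorner Y - cornerProj (J.opAlg.tilde p).carrier n = J.toTilde p (n + n) Y :=
    add_sub_cancel_left _ _
  rw [this, val_toTilde]

/-- For nonunital ideals, the class computed by `relIdem` is the class computed by any invertible
lift of `diag(u, u')`. -/
theorem exists_idem_of_isExactBoundary [CompleteSpace E] (hJ : ¬ J.opAlg.IsUnital)
    (d : J.quotK1 p →+ J.opAlg.K0 p)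
    (hd : ∀ (n : ℕ) (u : {u : (J.quot p).Mat n // IsUnit u}) a, J.IsExactBoundary u.1 a →
        (d ((J.quot p).invSystem.cls u) : (J.opAlg.tilde p).K0) = a)
    {n : ℕ} (u : {u : (J.quot p).Mat n // IsUnit u}) {u' : (J.quot p).Mat n}
    {w w' : (A.tilde p).Mat (n + n)} (h : u.1 * u' = 1) (h' : u' * u.1 = 1) (hw₂ : w' * w = 1)
    (hw : J.mkMat p (n + n) w = bdiag u.1 u') :
    ∃ e q : {e : (J.opAlg.tilde p).Mat (n + n) // e * e = e},
      q.1 = cornerProj (J.opAlg.tilde p).carrier n ∧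
      (∀ i j, J.opAlg.val ((e.1 - q.1) i j) =
        A.val ((w * cornerProj (A.tilde p).carrier n * w' -
          cornerProj (A.tilde p).carrier n) i j)) ∧
      (d ((J.quot p).invSystem.cls u) : (J.opAlg.tilde p).K0) =
        (J.opAlg.tilde p).idemSystem.cls e - (J.opAlg.tilde p).idemSystem.cls q := by
  obtain ⟨U, hU⟩ := J.mkMat_surjective p n u.1
  obtain ⟨V, hV⟩ := J.mkMat_surjective p n u'
  have r : J.mkMat p n U * J.mkMat p n V = 1 := by rw [hU, hV, h]
  have l : J.mkMat p n V * J.mkMat p n U = 1 := by rw [hU, hV, h']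
  set Y : J.matIdeal p (n + n) := ⟨_, relIdem_mem_matIdeal r l⟩
  have hY : Y.1 = relIdem U V := rfl
  set Z : J.matIdeal p (n + n) := ⟨_, conj_sub_mem h h' hw₂ hw⟩
  have hZ : cornerProj (A.tilde p).carrier n + Z.1 = w * cornerProj (A.tilde p).carrier n * w' :=
    add_sub_cancel _ _
  -- G carries the Whitehead lift to w. Both lift diag(u, u'), so G and G' are congruent to 1 modulo
  -- J and come from matrices S, S' over J̃, where they conjugate one idempotent to the other.
  set G : (A.tilde p).Mat (n + n) := w * liftUnitInv U V with hG
  set G' : (A.tilde p).Mat (n + n) := liftUnit U V * w' with hG'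
  have hGG : G' * G = 1 := by
    rw [hG, hG', mul_assoc, ← mul_assoc w', hw₂, one_mul, liftUnit_mul_inv]
  have mG : J.mkMat p (n + n) G = 1 := by
    rw [hG, map_mul, hw, mkMat_liftUnitInv r l, hU, hV, bdiag_mul, h, h', bdiag_one]
  have mG' : J.mkMat p (n + n) G' = 1 := by
    have := congrArg (J.mkMat p (n + n)) hGG
    rwa [map_mul, mG, mul_one, map_one] at this
  have key : ∀ G : (A.tilde p).Mat (n + n), J.mkMat p (n + n) G = 1 →
      ∃ S, J.matHom p hJ (n + n) S = G := by
    intro G hG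
    have hm : G - 1 ∈ J.matIdeal p (n + n) := by
      rw [mem_matIdeal_iff, map_sub, hG, map_one, sub_self]
    refine ⟨1 + J.toTilde p (n + n) ⟨G - 1, hm⟩, ?_⟩
    rw [map_add, map_one, matHom_toTilde]
    exact add_sub_cancel _ _
  obtain ⟨S, hS⟩ := key G mG
  obtain ⟨S', hS'⟩ := key G' mG'
  have hSS : S' * S = 1 := by
    apply J.matHom_injective hJ (p := p)
    rw [map_mul, hS, hS', hGG, map_one]
  have hc : J.addCorner Z = S * J.addCorner Y * S' := by
    apply J.matHom_injective hJ (p := p)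
    rw [map_mul, map_mul, matHom_addCorner, matHom_addCorner, hS, hS', hZ, hY,
      ← liftUnit_mul_cornerProj_mul, hG, hG']
    calc _ = w * (liftUnitInv U V * liftUnit U V) * cornerProj (A.tilde p).carrier n *
          (liftUnitInv U V * liftUnit U V) * w' := by
          rw [liftUnitInv_mul, mul_one, mul_one]
      _ = _ := by simp only [mul_assoc]
  have hYY := addCorner_relIdem_mul_self hJ hY
  have hZZ : J.addCorner Z * J.addCorner Z = J.addCorner Z := by
    rw [hc]
    calc _ = S * (J.addCorner Y * (S' * S) * J.addCorner Y) * S' := by simp only [mul_assoc]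
      _ = _ := by rw [hSS, mul_one, hYY]
  refine ⟨⟨J.addCorner Z, hZZ⟩, ⟨cornerProj (J.opAlg.tilde p).carrier n, cornerProj_mul_self⟩, rfl,
    val_addCorner_sub Z, ?_⟩
  have hx := exists_isExactBoundary_of_lifts hJ r l
  rw [hU] at hx
  rw [hd n u _ hx, J.opAlg.idem_cls_conj p hSS ⟨J.addCorner Y, hYY⟩ ⟨J.addCorner Z, hZZ⟩ hc]
  rfl

/-- The map given on classes by `relIdem` is the boundary map, for nonunital ideals. -/
theorem isBoundaryMap_of_isExactBoundary [CompleteSpace E] (hJ : ¬ J.opAlg.IsUnital)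
    (d : J.quotK1 p →+ J.opAlg.K0 p)
    (hd : ∀ (n : ℕ) (u : {u : (J.quot p).Mat n // IsUnit u}) a, J.IsExactBoundary u.1 a →
        (d ((J.quot p).invSystem.cls u) : (J.opAlg.tilde p).K0) = a) : J.IsBoundaryMap p d :=
  fun _ u _ _ _ h h' _ hw₂ hw => exists_idem_of_isExactBoundary hJ d hd u h h' hw₂ hw

/-! ### Unital ideals -/

theorem unit_mem (hJ : J.opAlg.IsUnital) : J.opAlg.unit ∈ J.alg := by
  unfold OpAlg.unit
  rw [dif_pos hJ]
  exact hJ.choose_spec.1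

theorem unit_mul_val_mem (hJ : J.opAlg.IsUnital) (x : A.Tilde) :
    J.opAlg.unit * A.val x ∈ J.alg := by
  obtain ⟨a, ha, h⟩ := A.coeff_spec x
  rw [h, mul_add, mul_smul_comm, A.mul_unit (J.le _ (unit_mem hJ))]
  exact add_mem (J.mul_mem_right a ha _ (unit_mem hJ)) (SMulMemClass.smul_mem _ (unit_mem hJ))

/-- Multiplication by the identity of a unital ideal. -/
noncomputable def cutHom (hJ : J.opAlg.IsUnital) : A.Tilde →+* J.opAlg.Tilde where
  toFun x := Subtype.mk (J.opAlg.unit * A.val x) (J.mem_tildeAlg_of_mem (unit_mul_val_mem hJ x))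
  map_one' := J.opAlg.val_injective (A.mul_unit (J.le _ (unit_mem hJ)))
  map_zero' := J.opAlg.val_injective (mul_zero _)
  map_add' x y := J.opAlg.val_injective (mul_add _ _ _)
  map_mul' x y := by
    apply J.opAlg.val_injective
    change J.opAlg.unit * (A.val x * A.val y) =
      J.opAlg.unit * A.val x * (J.opAlg.unit * A.val y)
    rw [← mul_assoc, ← mul_assoc (J.opAlg.unit * A.val x),
      J.opAlg.mul_unit (unit_mul_val_mem hJ x)]

/-- Cutting w by the identity of J gives an invertible matrix over J̃ that conjugates diag(1,0) to
the boundary idempotent; the two classes therefore cancel. -/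
theorem exists_idem_of_isUnital [CompleteSpace E] (hJ : J.opAlg.IsUnital) {n : ℕ}
    {u u' : (J.quot p).Mat n} {w w' : (A.tilde p).Mat (n + n)} (h : u * u' = 1) (h' : u' * u = 1)
    (hw₂ : w' * w = 1) (hw : J.mkMat p (n + n) w = bdiag u u') :
    ∃ e q : {e : (J.opAlg.tilde p).Mat (n + n) // e * e = e},
      q.1 = cornerProj (J.opAlg.tilde p).carrier n ∧
      (∀ i j, J.opAlg.val ((e.1 - q.1) i j) =
        A.val ((w * cornerProj (A.tilde p).carrier n * w' -
          cornerProj (A.tilde p).carrier n) i j)) ∧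
      (0 : (J.opAlg.tilde p).K0) =
        (J.opAlg.tilde p).idemSystem.cls e - (J.opAlg.tilde p).idemSystem.cls q := by
  set Z : J.matIdeal p (n + n) := ⟨_, conj_sub_mem h h' hw₂ hw⟩
  have hZ : cornerProj (A.tilde p).carrier n + Z.1 = w * cornerProj (A.tilde p).carrier n * w' :=
    add_sub_cancel _ _
  let θ : (A.tilde p).Mat (n + n) →+* (J.opAlg.tilde p).Mat (n + n) := (cutHom hJ).mapMatrix
  have hθq : θ (cornerProj (A.tilde p).carrier n) = cornerProj (J.opAlg.tilde p).carrier n :=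
    cornerProj_map _ (map_zero _) (map_one _)
  have hθZ : θ Z.1 = J.toTilde p (n + n) Z := by
    ext i j
    apply J.opAlg.val_injective
    exact J.opAlg.unit_mul (Z.2 i j)
  have hc : J.addCorner Z = θ w * cornerProj (J.opAlg.tilde p).carrier n * θ w' := by
    rw [← hθq, ← map_mul, ← map_mul]
    refine Eq.trans ?_ (congrArg θ hZ)
    rw [map_add, hθq, hθZ]
    rfl
  have hww : θ w' * θ w = 1 := by
    refine (map_mul θ w' w).symm.trans ((congrArg θ ?_).trans (map_one θ))
    exact hw₂
  have hZZ : J.addCorner Z * J.addCorner Z = J.addCorner Z := by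
    rw [hc]
    calc _ = θ w * (cornerProj (J.opAlg.tilde p).carrier n * (θ w' * θ w) *
          cornerProj (J.opAlg.tilde p).carrier n) * θ w' := by simp only [mul_assoc]
      _ = _ := by rw [hww, mul_one, cornerProj_mul_self]
  refine ⟨⟨J.addCorner Z, hZZ⟩, ⟨cornerProj (J.opAlg.tilde p).carrier n, cornerProj_mul_self⟩, rfl,
    val_addCorner_sub Z, ?_⟩
  rw [J.opAlg.idem_cls_conj p hww ⟨cornerProj (J.opAlg.tilde p).carrier n, cornerProj_mul_self⟩
    ⟨J.addCorner Z, hZZ⟩ hc, sub_self]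

/-- For a unital ideal, the boundary map is zero. -/
theorem isBoundaryMap_zero [CompleteSpace E] (hJ : J.opAlg.IsUnital) :
    J.IsBoundaryMap p (0 : J.quotK1 p →+ J.opAlg.K0 p) :=
  fun _ _ _ _ _ h h' _ hw₂ hw => exists_idem_of_isUnital hJ h h' hw₂ hw

end ClosedIdeal


/-! ### Comparison of the quantitative and the ordinary boundary map -/

/-- An inverse of a quasi-invertible element is bounded in terms of its quasi-inverse. -/
theorem norm_le_of_mul_eq_one {S : Type*} [SeminormedRing S] {u v w : S} {ε N : ℝ} (hε : ε ≤ 1 / 2)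
    (h : w * u = 1) (hv : ‖v‖ ≤ N) (huv : ‖u * v - 1‖ < ε) : ‖w‖ ≤ 2 * N := by
  have e : w = v - w * (u * v - 1) := by
    rw [mul_sub, ← mul_assoc, h, one_mul, mul_one, sub_sub_cancel]
  have h1 : ‖w‖ ≤ ‖v‖ + ‖w * (u * v - 1)‖ := by
    conv_lhs => rw [e]
    exact norm_sub_le _ _
  have h2 := norm_mul_le w (u * v - 1)
  nlinarith [norm_nonneg w]

namespace ClosedIdeal

variable {E : Type u} [NormedAddCommGroup E] [NormedSpace ℂ E] [CompleteSpace E] {p : ℝ≥0∞}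
  [Fact (1 ≤ p)] {A : OpAlg E} {J : ClosedIdeal A} {C ε r N : ℝ}

/-- The quantitative value uses a lift V of the quasi-inverse, the ordinary one a lift V' of the
true inverse. Both pair with the same U, so a path of lift pairs joins them, and the spectral
idempotents along it connect κ_0 of diag(1,0) + Y to the exact idempotent. -/
theorem exists_quantBoundary_kappa0 (hp : p ≠ ∞) (H : IsFilteredSQpAlg.{u, v} p A)
    (hJC : J.IsCompletelyFiltered p C) (hJ : ¬ J.opAlg.IsUnital) (h : IsAdmissible C ε r N) {n : ℕ}
    {u v : (J.quot p).Mat n} (huv : (J.quot p).QInvPair ε r N n u v) :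
    ∃ a b, J.IsQuantBoundary C ε r N u a ∧ J.IsExactBoundary u b ∧
      J.opAlg.kappa0 p h.lam_mul_lt a = b := by
  have hε := h.pos
  have hε' := h.lt_one_div
  have hN := h.one_le
  have hr := h.r_pos
  have hM := one_le_liftBound h.one_le_C hN
  obtain ⟨w, huw, hwu⟩ := isUnit_iff_exists.1 (J.quot_isUnit_of_invPair p (by linarith) huv)
  have hw : ‖w‖ < 4 * N + 1 :=
    -- The true inverse has norm at most 2N, so it too has a lift within `liftBound`, although
    -- without control of propagation.
    (norm_le_of_mul_eq_one (by linarith) hwu huv.2.2.2.1 huv.2.2.2.2.1).trans_lt (by linarith)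
  obtain ⟨U, V, hUV, rfl, rfl⟩ := exists_liftPair hp H hJC h
    (huv.mono (by linarith) hr (by linarith) (by linarith))
  obtain ⟨V', rfl, hV'⟩ := (J.norm_lt_iff p).1 hw
  have hV'' : ‖V'‖ ≤ liftBound C N := by
    have := h.one_le_C
    unfold liftBound
    nlinarith
  obtain ⟨Y, hY, hD⟩ := hUV.exists_correction_of_admissible hp H hJC h
  have h0 : J.IsLiftPair p (5 * ε) ⊤ (liftBound C N) U V :=
    ⟨trivial, trivial, hUV.3, hUV.4, hUV.5, hUV.6⟩
  have h1 : J.IsLiftPair p (5 * ε) ⊤ (liftBound C N) U V' :=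
    ⟨trivial, trivial, hUV.3, hV'', by rw [huw, sub_self, norm_zero]; linarith,
      by rw [hwu, sub_self, norm_zero]; linarith⟩
  obtain ⟨Ut, Vt, hUt, hVt, hpair, hU0, hV0, hU1, hV1⟩ := h0.exists_path h1 rfl
  have hI : 24 * liftBound C N ^ 5 * idealDist C N ε = lamBound C N * ε := mul_idealDist C N ε
  have hD0 : 0 < idealDist C N ε := (norm_nonneg _).trans_lt hD
  have hid : 6 * liftBound C N ^ 3 * (5 * ε) ≤ idealDist C N ε := by
    have := h.one_le_C
    exact le_mul_of_one_le_left (by positivity) (by linarith)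
  have hQ := qIdem_addCorner_of_admissible H hJ h hUV hY hD
  have hlam := h.lam_mul_lt
  have hs : ‖J.addCorner Y * J.addCorner Y - J.addCorner Y‖ < 1 / 4 :=
    lt_trans hQ.1 (by linarith)
  refine ⟨_, _, exists_isQuantBoundary H hJ h hUV hY hD, exists_isExactBoundary_of_lifts hJ huw hwu,
    ?_⟩
  have k1 := J.opAlg.kappa0_cls p h.lam_mul_lt ⟨J.addCorner Y, hQ⟩ ⟨_, spectralIdem_mul_self hs⟩ rfl
  have k2 := J.opAlg.kappa0_cls p (r := 10 * r) h.lam_mul_lt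
    ⟨_, J.qIdem_cornerProj hJ n h.lam_mul_pos (one_le_lamBound h.one_le_C h.one_le)⟩
    ⟨cornerProj (J.opAlg.tilde p).carrier n, cornerProj_mul_self⟩
    (spectralIdem_of_idem (R := (J.opAlg.tilde p).Mat (n + n)) cornerProj_mul_self).symm
  refine (map_sub _ _ _).trans (congrArg₂ _ (k1.trans ?_) k2)
  refine idem_cls_eq_of_liftPath H.norm_unit_le hJ hM (by linarith) hid h.idealDist_le
    (by linarith) hUt hVt hpair (Y₀ := Y) (Y₁ := ⟨relIdem U V', relIdem_mem_matIdeal huw hwu⟩)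
    ?_ ?_ _ _ rfl ?_
  · rwa [hU0, hV0]
  · rw [hU1, hV1, sub_self, norm_zero]
    exact hD0
  · exact (spectralIdem_of_idem (addCorner_relIdem_mul_self hJ rfl)).symm

theorem exists_induces (hC : 1 ≤ C) (hp : p ≠ ∞) (H : IsFilteredSQpAlg.{u, v} p A)
    (hJC : J.IsCompletelyFiltered p C) (hJ : ¬ J.opAlg.IsUnital) :
    ∃ (D : ControlledMorphism (boundaryControl C hC) (J.familyQuotK1 p) (J.opAlg.familyK0 p))
      (d : J.quotK1 p →+ J.opAlg.K0 p), J.IsBoundaryMap p d ∧ J.Induces p D d := by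
  obtain ⟨D, f, hf, hDf⟩ := exists_controlledBoundary hC hp H hJC hJ
  obtain ⟨d, hd⟩ := exists_boundary (p := p) (J := J) H.norm_unit_le hJ
  refine ⟨D, d, isBoundaryMap_of_isExactBoundary hJ d hd, ?_⟩
  intro ε r N hε hε' hr hN
  have h : IsAdmissible C ε r N := ⟨hC, hε, hε', hr, hN⟩
  refine ⟨J.kappa1 p h.lt_one_div, J.opAlg.kappa0 p h.lam_mul_lt, J.isKappa1_kappa1 p _,
    J.opAlg.isKappa0_kappa0 p _, fun x => ?_⟩
  have key : ((J.opAlg.K0 p).subtype.comp d).comp (J.kappa1 p h.lt_one_div) =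
      (J.opAlg.kappa0 p h.lam_mul_lt).comp (f ε r N) := by
    refine KSystem.hom_ext _ ?_
    rintro n ⟨u, v, huv⟩
    obtain ⟨a, b, ha, hb, hab⟩ := exists_quantBoundary_kappa0 hp H hJC hJ h huv
    have hu : IsUnit u := J.quot_isUnit_of_invPair p (by linarith [h.lt_one_div]) huv
    refine ((congrArg (fun x => (d x : (J.opAlg.tilde p).K0))
      (J.kappa1_cls p h.lt_one_div ⟨u, v, huv⟩ hu)).trans (hd n ⟨u, hu⟩ b hb)).trans ?_
    rw [← hab]
    exact congrArg _ (hf ε r N h n ⟨u, v, huv⟩ a ha).symm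
  exact (DFunLike.congr_fun key x.1).trans (congrArg _ (hDf ε r N x).symm)

end ClosedIdeal


/-! ### Connectedness of GL_n(ℂ) and density of the filtration -/

/-- `GL_n(ℂ)` is path connected. -/
theorem exists_path_isUnit_complex {n : ℕ} {a : Matrix (Fin n) (Fin n) ℂ} (ha : IsUnit a) :
    ∃ γ : unitInterval → Matrix (Fin n) (Fin n) ℂ, Continuous γ ∧ (∀ t, IsUnit (γ t)) ∧
      γ 0 = 1 ∧ γ 1 = a := by
  -- On the complex line through 1 and a the determinant is a nonzero polynomial. Its zeros form a
  -- countable set, whose complement in ℂ is path connected.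
  set P : Polynomial ℂ := (1 + (Polynomial.X : Polynomial ℂ) • (a - 1).map Polynomial.C).det
    with hP
  have heval : ∀ c : ℂ, P.eval c = (1 + c • (a - 1)).det := by
    intro c
    rw [hP, ← Polynomial.coe_evalRingHom, RingHom.map_det]
    congr 1
    ext i j
    by_cases hij : i = j
    · simp [hij]
    · simp [hij, mul_comm c]
  have h0 : P.eval 0 = 1 := by simp [heval]
  have h1 : P.eval 1 ≠ 0 := by
    rw [heval, one_smul, add_sub_cancel]
    exact ((Matrix.isUnit_iff_isUnit_det a).1 ha).ne_zero
  have hP0 : P ≠ 0 := by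
    rintro h
    simp [h] at h0
  have hc : {c : ℂ | P.IsRoot c}.Countable := (Polynomial.finite_setOfPred_isRoot hP0).countable
  obtain ⟨γ, hγ⟩ := (hc.isPathConnected_compl_of_one_lt_rank (E := ℂ)
    (Complex.rank_real_complex ▸ Nat.one_lt_ofNat)).joinedIn 0 (by simp [h0]) 1 h1
  refine ⟨fun t => 1 + γ t • (a - 1), by fun_prop, fun t => ?_, by simp, by simp⟩
  rw [Matrix.isUnit_iff_isUnit_det, isUnit_iff_ne_zero, ← heval]
  exact hγ t

namespace KSystem

/-- The class of the stabilizing matrix is zero. -/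
theorem cls_fill {R : Type u} [Zero R] (S : KSystem R) {n : ℕ}
    (x : {x : Matrix (Fin n) (Fin n) R // S.mem n x}) (hx : x.1 = S.fill n)
    (h : S.mem (n + n) (bdiag (S.fill n) (S.fill n))) : S.cls x = 0 := by
  have h1 := S.cls_sum x x ⟨_, h⟩ (by rw [hx])
  have h2 := S.cls_stab (k := n) x ⟨_, h⟩ (by rw [hx])
  rw [h2] at h1
  exact left_eq_add.1 h1

end KSystem

namespace OpAlg

variable {E : Type u} [NormedAddCommGroup E] [NormedSpace ℂ E] {p : ℝ≥0∞} [Fact (1 ≤ p)]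
  {A : OpAlg E}

theorem norm_matOp_single_le {n : ℕ} (i j : Fin n) (a : E →L[ℂ] E) :
    ‖matOp p (Matrix.single i j a)‖ ≤ ‖a‖ := by
  refine ContinuousLinearMap.opNorm_le_bound _ (norm_nonneg _) fun x => ?_
  have : matOp p (Matrix.single i j a) x = PiLp.single p i (a (x j)) := by
    ext k
    rw [matOp_apply]
    by_cases hk : k = i
    · subst hk
      rw [Finset.sum_eq_single j (fun b _ hb => by simp [Matrix.single, hb.symm]) (by simp)]
      simp [Matrix.single]
    · simp [Matrix.single, hk, Ne.symm hk]
  rw [this, PiLp.norm_single]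
  exact (a.le_opNorm _).trans (by gcongr; exact PiLp.norm_apply_le x j)

theorem norm_le_sum_norm_val {n : ℕ} (X : (A.tilde p).Mat n) :
    ‖X‖ ≤ ∑ i, ∑ j, ‖A.val (X i j)‖ := by
  have : matOp p (Matrix.map X A.val) = ∑ i, ∑ j, matOp p (Matrix.single i j (A.val (X i j))) := by
    let Φ := AddMonoidHom.mk' (matOp (E := E) p (n := n)) (matOp_add p)
    change Φ _ = ∑ i, ∑ j, Φ _
    simp only [← map_sum]
    exact congrArg Φ (Matrix.matrix_eq_sum_single _)
  rw [norm_def]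
  change ‖matOp p (Matrix.map X A.val)‖ ≤ _
  rw [this]
  exact norm_sum_le_of_le _ fun i _ => norm_sum_le_of_le _ fun j _ => norm_matOp_single_le i j _

end OpAlg

/-- Matrices over `Ã` are approximated by matrices over the filtration, modulo matrices over `A`. -/
theorem IsFilteredSQpAlg.exists_mem_matFil_norm_sub_lt {E : Type u} [NormedAddCommGroup E]
    [NormedSpace ℂ E] {p : ℝ≥0∞} [Fact (1 ≤ p)] {A : OpAlg E} (H : IsFilteredSQpAlg.{u, v} p A)
    {n : ℕ} (X : (A.tilde p).Mat n) {η : ℝ} (hη : 0 < η) :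
    ∃ r, 0 < r ∧ ∃ X' ∈ A.matFil p n r, ‖X' - X‖ < η ∧ ∀ i j, A.val ((X' - X) i j) ∈ A.alg := by
  -- Each of the n² entries gets this share of the error; the added 1 covers n = 0 and keeps the
  -- total strictly below η.
  have hd : 0 < η / (n * n + 1) := by positivity
  have : ∀ i j, ∃ r, 0 < r ∧ ∃ x ∈ (A.tilde p).fil r, ‖A.val (x - X i j)‖ < η / (n * n + 1) ∧
      A.val (x - X i j) ∈ A.alg := by
    intro i j
    obtain ⟨a, ha, h⟩ := A.coeff_spec (X i j)
    obtain ⟨b, ⟨r, hr, hb⟩, hab⟩ := Metric.mem_closure_iff.1 (H.dense a ha) _ hd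
    have e : b + A.coeff (X i j) • A.unit - A.val (X i j) = b - a := by
      rw [h]
      abel
    have hm : b + A.coeff (X i j) • A.unit ∈ A.tildeAlg := ⟨b, H.fil_le r hr b hb, _, rfl⟩
    refine ⟨r, hr, ⟨_, hm⟩, ⟨b, hb, _, rfl⟩, ?_, ?_⟩
    · change ‖b + A.coeff (X i j) • A.unit - A.val (X i j)‖ < _
      rw [e, ← dist_eq_norm, dist_comm]
      exact hab
    · change b + A.coeff (X i j) • A.unit - A.val (X i j) ∈ _
      rw [e]
      exact sub_mem (H.fil_le r hr b hb) ha
  choose r hr x hx hn hm using this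
  have hr' : ∀ i j, r i j ≤ 1 + ∑ i, ∑ j, r i j := by
    intro i j
    have h1 := Finset.single_le_sum (f := fun j => r i j) (fun j _ => (hr i j).le)
      (Finset.mem_univ j)
    have h2 := Finset.single_le_sum (f := fun i => ∑ j, r i j)
      (fun i _ => Finset.sum_nonneg fun j _ => (hr i j).le) (Finset.mem_univ i)
    linarith
  have hpos : 0 < 1 + ∑ i, ∑ j, r i j :=
    add_pos_of_pos_of_nonneg one_pos (Finset.sum_nonneg fun i _ =>
      Finset.sum_nonneg fun j _ => (hr i j).le)
  refine ⟨_, hpos, (Matrix.of x : Matrix (Fin n) (Fin n) A.Tilde),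
    fun i j => (A.tilde p).fil_mono _ _ (hr i j) (hr' i j) (hx i j), ?_, hm⟩
  refine (OpAlg.norm_le_sum_norm_val _).trans_lt ?_
  calc _ ≤ ∑ _i : Fin n, ∑ _j : Fin n, η / (n * n + 1) :=
        Finset.sum_le_sum fun i _ => Finset.sum_le_sum fun j _ => (hn i j).le
    _ = n * n * (η / (n * n + 1)) := by simp [mul_assoc]
    _ < η := by
      rw [mul_div_assoc', div_lt_iff₀ (by positivity)]
      nlinarith


/-! ### Every class of ordinary `K_1` comes from quantitative `K_1` -/

theorem MatrixAlg.Hom.mapQK1_cls_eq_zero {B : MatrixAlg.{u}} {B' : MatrixAlg.{v}}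
    (φ : MatrixAlg.Hom B B') {ε r N : ℝ} {n : ℕ} (u : {u : B.Mat n // B.QInv ε r N n u})
    (hu : φ.mat n u.1 = 1) (h : B.QInvPair ε r N (n + n) 1 1) :
    φ.mapQK1 ε r N ((B.qInvSystem ε r N).cls u) = 0 := by
  obtain ⟨u, v, huv⟩ := u
  have h1 : φ.mapQK1 ε r N ((B.qInvSystem ε r N).cls ⟨u, v, huv⟩) =
      (B'.qInvSystem ε r N).cls ⟨φ.mat n u, φ.mat n v, φ.qInvPair huv⟩ :=
    KSystem.map_cls (S := B.qInvSystem ε r N) _ _ _ _ _ _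
  have h2 : B'.QInv ε r N (n + n) (bdiag 1 1) := by
    have := φ.qInvPair h
    rw [map_one] at this
    rw [bdiag_one]
    exact ⟨1, this⟩
  exact h1.trans ((B'.qInvSystem ε r N).cls_fill _ hu h2)

namespace ClosedIdeal

variable {E : Type u} [NormedAddCommGroup E] [NormedSpace ℂ E] {p : ℝ≥0∞} [Fact (1 ≤ p)]
  {A : OpAlg E} {J : ClosedIdeal A}

theorem mkMat_mem_fil {n : ℕ} {r : ℝ} {X : (A.tilde p).Mat n} (hX : X ∈ A.matFil p n r)
    (i j : Fin n) : J.mkMat p n X i j ∈ (J.quot p).fil r :=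
  ⟨X i j, hX i j, rfl⟩

/-- Matrices of scalars over the quotient. -/
noncomputable def scalarMat (p : ℝ≥0∞) [Fact (1 ≤ p)] (J : ClosedIdeal A) (n : ℕ) :
    Matrix (Fin n) (Fin n) ℂ →ₐ[ℂ] (J.quot p).Mat n :=
  (Algebra.ofId ℂ (J.quot p).carrier).mapMatrix

theorem continuous_scalarMat (n : ℕ) : Continuous (J.scalarMat p n) :=
  LinearMap.continuous_of_finiteDimensional (J.scalarMat p n).toLinearMap

variable [CompleteSpace E]

theorem character_mkMat_eq (hA : ¬ A.IsUnital) {n : ℕ} {X X' : (A.tilde p).Mat n}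
    (h : ∀ i j, A.val ((X' - X) i j) ∈ A.alg) :
    (J.characterHom p hA).mat n (J.mkMat p n X') = (J.characterHom p hA).mat n (J.mkMat p n X) := by
  ext i j
  have h0 : A.character hA (X' i j - X i j) = 0 := A.character_eq_zero hA (h i j)
  exact sub_eq_zero.1 ((map_sub (A.character hA) (X' i j) (X i j)).symm.trans h0)

/-- An invertible and its inverse are perturbed separately into the filtration. The perturbation is
small enough that the segment back to u consists of invertibles, and it changes entries only by
elements of A, so the scalar part stays the same. -/
theorem exists_qInvPair_near (H : IsFilteredSQpAlg.{u, v} p A) {n : ℕ} {u v : (J.quot p).Mat n}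
    (huv : u * v = 1) (hvu : v * u = 1) {ε N : ℝ} (hε : 0 < ε) (hε1 : ε < 1 / 20)
    (hu : ‖u‖ + 1 ≤ N) (hv : ‖v‖ + 1 ≤ N) :
    ∃ r, 0 < r ∧ ∃ u' v' : (J.quot p).Mat n, (J.quot p).QInvPair ε r N n u' v' ∧
      (∀ (h : IsUnit u) (h' : IsUnit u'),
        (J.quot p).invSystem.cls ⟨u', h'⟩ = (J.quot p).invSystem.cls ⟨u, h⟩) ∧
      ∀ hA : ¬ A.IsUnital, (J.characterHom p hA).mat n u' = (J.characterHom p hA).mat n u := by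
  have hN : 1 ≤ N := by linarith [norm_nonneg u]
  -- The perturbation estimate returns five times its parameter, so it is used with ε/5.
  have hη₀ : 0 < ε / 5 / (2 * N) := by positivity
  have hη₁ : ε / 5 / (2 * N) ≤ 1 := by
    rw [div_le_one (by positivity)]
    linarith
  obtain ⟨U, rfl⟩ := J.mkMat_surjective p n u
  obtain ⟨V, rfl⟩ := J.mkMat_surjective p n v
  obtain ⟨r, hr, U', hU', hUU, hUa⟩ := H.exists_mem_matFil_norm_sub_lt U hη₀
  obtain ⟨s, hs, V', hV', hVV, -⟩ := H.exists_mem_matFil_norm_sub_lt V hη₀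
  have near : ∀ {X X' : (A.tilde p).Mat n}, ‖X' - X‖ < ε / 5 / (2 * N) →
      ‖J.mkMat p n X - J.mkMat p n X'‖ < ε / 5 / (2 * N) := by
    intro X X' h
    rw [← map_sub]
    refine (J.norm_mkMat_le p _).trans_lt ?_
    rwa [norm_sub_rev]
  have bound : ∀ {x y : (J.quot p).Mat n}, ‖x - y‖ < ε / 5 / (2 * N) → ‖x‖ + 1 ≤ N → ‖y‖ ≤ N := by
    intro x y h h'
    have := norm_sub_le x (x - y)
    rw [sub_sub_cancel] at this
    linarith
  have err : ∀ {x y x' y' : (J.quot p).Mat n}, x * y = 1 → ‖x‖ + 1 ≤ N → ‖y‖ + 1 ≤ N →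
      ‖x - x'‖ < ε / 5 / (2 * N) → ‖y - y'‖ < ε / 5 / (2 * N) → ‖x' * y' - 1‖ < ε := by
    intro x y x' y' h hx hy hx' hy'
    have h1 : ‖x * y - 1‖ < 4 * (ε / 5) := by
      rw [h, sub_self, norm_zero]
      positivity
    have := norm_mul_sub_one_lt (by positivity) (by linarith) (bound hy' hy) h1 hN hx' hy'
    linarith
  have hself : ∀ y : (J.quot p).Mat n, ‖y - y‖ < ε / 5 / (2 * N) := fun y => by
    rwa [sub_self, norm_zero]
  refine ⟨max r s, hr.trans_le (le_max_left _ _), J.mkMat p n U', J.mkMat p n V',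
    ⟨mkMat_mem_fil (OpAlg.matFil_mono hr (le_max_left _ _) hU'),
      mkMat_mem_fil (OpAlg.matFil_mono hs (le_max_right _ _) hV'), bound (near hUU) hu,
      bound (near hVV) hv, err huv hu hv (near hUU) (near hVV),
      err hvu hv hu (near hVV) (near hUU)⟩, fun h h' => ?_, fun hA => character_mkMat_eq hA hUa⟩
  obtain ⟨γ, hγ, hK, h0, h1⟩ := exists_path_in_convex
    (convex_ball (J.mkMat p n U) (ε / 5 / (2 * N)))
    (x₀ := J.mkMat p n U') (x₁ := J.mkMat p n U)
    (by rw [mem_ball_iff_norm']; exact near hUU) (Metric.mem_ball_self hη₀)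
  refine KSystem.cls_eq_of_htpy _ _ _ ⟨γ, (J.quot_normCont_iff p).2 hγ, fun t => ?_, h0, h1⟩
  have ht : ‖J.mkMat p n U - γ t‖ < ε / 5 / (2 * N) := mem_ball_iff_norm'.1 (hK t)
  exact J.quot_isUnit_of_mul p ((err huv hu hv ht (hself _)).trans (by linarith))
    ((err hvu hv hu (hself _) ht).trans (by linarith))

theorem character_scalarMat (hA : ¬ A.IsUnital) {n : ℕ} (z : Matrix (Fin n) (Fin n) ℂ) :
    (J.characterHom p hA).mat n (J.scalarMat p n z) = z := by
  ext i j
  change A.character hA (algebraMap ℂ A.Tilde (z i j)) = z i j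
  refine A.coeff_eq hA (a := 0) (zero_mem _) ?_
  rw [Algebra.algebraMap_eq_smul_one, A.val_smul, A.val_one, A.unit_of_not hA, zero_add]

/-- For nonunital `A`, every class in `K_1` is represented by a matrix with scalar part `1`. -/
theorem exists_character_eq_one (hA : ¬ A.IsUnital) {n : ℕ}
    (u : {u : (J.quot p).Mat n // IsUnit u}) :
    ∃ u' : {u : (J.quot p).Mat n // IsUnit u},
      (J.quot p).invSystem.cls u' = (J.quot p).invSystem.cls u ∧
      (J.characterHom p hA).mat n u'.1 = 1 := by
  set χ := (J.characterHom p hA).mat n with hχ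
  obtain ⟨v, huv, hvu⟩ := isUnit_iff_exists.1 u.2
  have hz : χ u.1 * χ v = 1 := by rw [← map_mul, huv, map_one]
  have hz' : χ v * χ u.1 = 1 := by rw [← map_mul, hvu, map_one]
  -- Multiplying u by scalar matrices along a path from 1 to the inverse of its scalar part stays
  -- among invertibles and ends with scalar part 1.
  obtain ⟨γ, hγ, hu, h0, h1⟩ := exists_path_isUnit_complex (a := χ v) ⟨⟨_, _, hz', hz⟩, rfl⟩
  have hunit : ∀ t, IsUnit (u.1 * J.scalarMat p n (γ t)) := fun t =>
    u.2.mul ((hu t).map (J.scalarMat p n))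
  have hpath : (J.quot p).invSystem.htpy n u.1 (u.1 * J.scalarMat p n (γ 1)) :=
    ⟨fun t => u.1 * J.scalarMat p n (γ t), (J.quot_normCont_iff p).2
      (continuous_const.mul ((continuous_scalarMat n).comp hγ)), hunit,
      by simp only [h0, map_one, mul_one], rfl⟩
  refine ⟨⟨_, hunit 1⟩, (KSystem.cls_eq_of_htpy (J.quot p).invSystem u ⟨_, hunit 1⟩ hpath).symm, ?_⟩
  have h2 : χ (J.scalarMat p n (γ 1)) = χ v := (character_scalarMat hA (γ 1)).trans h1
  exact (map_mul χ _ _).trans ((congrArg (χ u.1 * ·) h2).trans hz)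

theorem cls_mem_quotQK1 (H : IsFilteredSQpAlg.{u, v} p A) {ε r N : ℝ} (hε : 0 < ε) (hN : 1 ≤ N)
    {n : ℕ} (u : {u : (J.quot p).Mat n // (J.quot p).QInv ε r N n u})
    (hu : ∀ hA : ¬ A.IsUnital, (J.characterHom p hA).mat n u.1 = 1) :
    ((J.quot p).qInvSystem ε r N).cls u ∈ J.quotQK1 p ε r N := by
  unfold quotQK1
  split_ifs with hA
  · exact AddSubgroup.mem_top _
  · have h1 : (J.quot p).QInvPair ε r N (n + n) 1 1 := by
      have h2 : ∀ i j, (1 : (J.quot p).Mat (n + n)) i j ∈ (J.quot p).fil r := by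
        have := mkMat_mem_fil (J := J) (OpAlg.one_mem_matFil (A := A) (p := p) (n + n) r)
        rwa [map_one] at this
      have h3 : ‖(1 : (J.quot p).Mat (n + n))‖ ≤ N := (J.norm_one_le p H.norm_unit_le _).trans hN
      have h4 : ‖(1 : (J.quot p).Mat (n + n)) * 1 - 1‖ < ε := by
        rwa [mul_one, sub_self, norm_zero]
      exact ⟨h2, h2, h3, h3, h4, h4⟩
    exact AddMonoidHom.mem_ker.2 ((J.characterHom p hA).mapQK1_cls_eq_zero u (hu hA) h1)

/-- Every class of `K_1(A/J)` is the image of quantitative classes for all small `ε`. -/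
theorem exists_kappa1_eq (H : IsFilteredSQpAlg.{u, v} p A) {n : ℕ}
    (u : {u : (J.quot p).Mat n // IsUnit u}) :
    ∃ N : ℝ, 1 ≤ N ∧ ∀ ε : ℝ, 0 < ε → ε < 1 / 20 → ∃ r, 0 < r ∧ ∃ x : J.quotQK1 p ε r N,
      ∀ κ, IsKappa1 (J.quot p) ε r N κ → κ x.1 = (J.quot p).invSystem.cls u := by
  obtain ⟨u', hu', hχ⟩ : ∃ u' : {u : (J.quot p).Mat n // IsUnit u},
      (J.quot p).invSystem.cls u' = (J.quot p).invSystem.cls u ∧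
      ∀ hA : ¬ A.IsUnital, (J.characterHom p hA).mat n u'.1 = 1 := by
    by_cases hA : A.IsUnital
    · exact ⟨u, rfl, fun h => absurd hA h⟩
    · obtain ⟨u', h, h'⟩ := exists_character_eq_one hA u
      exact ⟨u', h, fun _ => h'⟩
  obtain ⟨v, huv, hvu⟩ := isUnit_iff_exists.1 u'.2
  -- N depends on u' and v alone. It has to be fixed before ε, because the admissible range of ε
  -- depends on λ_N.
  refine ⟨‖u'.1‖ + ‖v‖ + 1, by linarith [norm_nonneg u'.1, norm_nonneg v], fun ε hε hε1 => ?_⟩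
  have hu0 := norm_nonneg u'.1
  have hv0 := norm_nonneg v
  obtain ⟨r, hr, x, y, hxy, hcls, hx⟩ := exists_qInvPair_near H huv hvu (N := ‖u'.1‖ + ‖v‖ + 1)
    hε hε1 (by linarith) (by linarith)
  refine ⟨r, hr, ⟨_, cls_mem_quotQK1 H hε (by linarith) ⟨x, y, hxy⟩ fun hA =>
    (hx hA).trans (hχ hA)⟩, fun κ hκ => ?_⟩
  obtain ⟨h, h'⟩ := hκ n ⟨x, y, hxy⟩
  exact h'.trans ((hcls u'.2 h).trans hu')

/-- Both homomorphisms are prescribed on the image of κ_1, and each class of K_1(A/J) lies in that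
image for suitable N and all sufficiently small ε; the value ε = 1/(40λ_N) is admissible. -/
theorem Induces.unique (H : IsFilteredSQpAlg.{u, v} p A) {c : ControlPair}
    {D : ControlledMorphism c (J.familyQuotK1 p) (J.opAlg.familyK0 p)}
    {F F' : J.quotK1 p →+ J.opAlg.K0 p} (h : J.Induces p D F) (h' : J.Induces p D F') : F = F' := by
  refine KSystem.hom_ext _ fun n u => Subtype.ext ?_
  obtain ⟨N, hN, hu⟩ := exists_kappa1_eq H u
  have hl := c.one_le_lam N hN
  have hε : 0 < 1 / (40 * c.lam N) := by positivity
  have hε' : 1 / (40 * c.lam N) < 1 / (20 * c.lam N) :=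
    one_div_lt_one_div_of_lt (by positivity) (by linarith)
  obtain ⟨r, hr, x, hx⟩ := hu _ hε (c.lt_of_lt hN hε')
  obtain ⟨κ₁, κ₀, hκ₁, hκ₀, e⟩ := h _ r N hε hε' hr hN
  obtain ⟨κ₁', κ₀', hκ₁', hκ₀', e'⟩ := h' _ r N hε hε' hr hN
  rw [← hx κ₁ hκ₁, e x, hκ₀.unique hκ₀', ← e' x, hκ₁.unique hκ₁']

theorem induces_zero {c : ControlPair}
    {D : ControlledMorphism c (J.familyQuotK1 p) (J.opAlg.familyK0 p)}
    (hD : ∀ ε r N x, D.map ε r N x = 0) : J.Induces p D 0 := by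
  intro ε r N hε hε' hr hN
  have hl := c.one_le_lam N hN
  have h : c.lam N * ε < 1 / 20 := by
    have := (lt_div_iff₀ (by positivity : (0 : ℝ) < 20 * c.lam N)).1 hε'
    linarith
  refine ⟨J.kappa1 p (c.lt_of_lt hN hε'), J.opAlg.kappa0 p h, J.isKappa1_kappa1 p _,
    J.opAlg.isKappa0_kappa0 p _, fun x => ?_⟩
  exact (((congrArg (fun y : J.opAlg.QK0 p _ _ _ => J.opAlg.kappa0 p h y.1) (hD ε r N x))).trans
    (map_zero (J.opAlg.kappa0 p h))).symm

end ClosedIdeal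

end QuantK

/-! ### The proposition -/

theorem mainTheorem3 (C : ℝ) (hC : 1 ≤ C) :
    ∃ c : QuantK.ControlPair,
      ∀ (p : ℝ≥0∞) [Fact (1 ≤ p)], p ≠ ∞ →
      ∀ (E : Type u) [NormedAddCommGroup E] [NormedSpace ℂ E] [CompleteSpace E]
        (A : QuantK.OpAlg E) (J : QuantK.ClosedIdeal A),
        QuantK.IsFilteredSQpAlg.{u, v} p A → J.IsCompletelyFiltered p C →
        ∃ (D : QuantK.ControlledMorphism c (J.familyQuotK1 p) (J.opAlg.familyK0 p))
          (d : J.quotK1 p →+ J.opAlg.K0 p),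
          J.IsBoundaryMap p d ∧
          ∀ F : J.quotK1 p →+ J.opAlg.K0 p, J.Induces p D F ↔ F = d := by
  refine ⟨QuantK.boundaryControl C hC, fun p _ hp E _ _ _ A J H hJC => ?_⟩
  suffices ∃ (D : QuantK.ControlledMorphism (QuantK.boundaryControl C hC) (J.familyQuotK1 p)
      (J.opAlg.familyK0 p)) (d : J.quotK1 p →+ J.opAlg.K0 p),
      J.IsBoundaryMap p d ∧ J.Induces p D d by
    obtain ⟨D, d, hd, hD⟩ := this
    exact ⟨D, d, hd, fun F => ⟨fun h => h.unique H hD, fun h => h ▸ hD⟩⟩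
  -- For a unital ideal the ordinary boundary is zero, so the zero controlled morphism suffices. The
  -- construction from lifts requires J to be nonunital, since it compares J̃ with Ã through an
  -- injective unital homomorphism.
  by_cases hJ : J.opAlg.IsUnital
  · exact ⟨⟨fun _ _ _ => 0, fun _ _ _ _ _ _ _ _ _ => (map_zero _).symm⟩, 0,
      QuantK.ClosedIdeal.isBoundaryMap_zero hJ,
      QuantK.ClosedIdeal.induces_zero fun _ _ _ _ => rfl⟩
  · exact QuantK.ClosedIdeal.exists_induces hC hp H hJC hJ
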